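/- Notation. Let $\mathbb T=\mathbb R/2\pi\mathbb Z$, $\langle x\rangle=(1+x^2)^{1/2}$, and for $1\le p\le\infty$ let $p'$ denote the dual exponent, $\frac1p+\frac1{p'}=1$. For $u$ on $\mathbb R_t\times\mathbb T_x$ write $$\widehat u(\xi)(t)=\frac1{\sqrt{2\pi}}\int_0^{2\pi}u(t,x)e^{-ix\xi}\,dx\quad(\xi\in\mathbb Z),\qquad \mathcal F_tf(\tau)=\frac1{\sqrt{2\pi}}\int_{\mathbb R}f(t)e^{-it\tau}\,dt,\qquad \mathcal F=\mathcal F_t\mathcal F_x ,$$ and let $X^{s,b}_{r,p}$ be the space with norm $$\|u\|_{X^{s,b}_{r,p}}=\big\|\langle\tau+\xi^2\rangle^{b}\langle\xi\rangle^{s}\,\mathcal Fu(\xi,\tau)\big\|_{\ell^{r'}_\xi L^{p'}_\tau}.$$ Let $T(u_1,u_2,u_3)$ be the trilinear operator given (suppressing the $t$-dependence) by $$\widehat{T(u_1,u_2,u_3)}(\xi)=\frac1{2\pi}\sum_{\substack{\xi=\xi_1+\xi_2+\xi_3\\ \xi_1\ne\xi,\ \xi_2\ne\xi}}\widehat u_1(\xi_1)\,\widehat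 u_2(\xi_2)\,i\xi_3\,\widehat{\overline{u}}_3(\xi_3)+\frac1{2\pi}\,\widehat u_1(\xi)\,\widehat u_2(\xi)\,i\xi\,\widehat{\overline{u}}_3(-\xi).$$ (For functions $u_i$ of low regularity the series is understood after taking the Fourier transform in $t$ term by term; for smooth $u_i$ this is the same.) Theorem. Let $\frac43<q\le r\le2$ and $0\le\delta<\frac1{q'}$. There is a constant $C>0$, depending only on $q,r,\delta$, such that the following holds for all $0<T\le1$ and all $u_1,u_2\in X^{\frac12,\frac12}_{q,2}$, $u_3\in X^{\frac12,\frac12}_{r,2}$ (these are functions in $L^2(\mathbb R\times\mathbb T)$) with $\operatorname{supp}(u_i)\subset\{(t,x)\mid |t|\le T\}$, $i=1,2,3$. For every $\xi\in\mathbb Z$ the products of Fourier coefficients in the definition of $T(u_1,u_2,u_3)$ are integrable in $t$, the series of their Fourier transforms in $t$ converges absolutely for almost every $\tau\in\mathbb R$, and $$\|T(u_1,u_2,u_3)\|_{X^{\frac12,-1}_{r,\infty}}\le C\,T^{\delta}\,\|u_1\|_{X^{\frac12,\frac12}_{q,2}}\|u_2\|_{X^{\frac12,\frac12}_{q,2}}\|u_3\|_{X^{\frac12,\frac12}_{r,2}}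 .$$ -/

import Mathlib

open MeasureTheory
open scoped ENNReal

noncomputable section

namespace PeriodicDNLS

instance factTwoPiPos : Fact (0 < 2 * Real.pi) := Fact.mk Real.two_pi_pos

/-- The torus `ℝ / 2πℤ`; its `volume` is Lebesgue measure of total mass `2π`. -/
abbrev Torus : Type := AddCircle (2 * Real.pi)

/-- The bracket `⟨x⟩ = (1 + x²)^{1/2}`. -/
def bracket (x : ℝ) : ℝ := Real.sqrt (1 + x ^ 2)

/-- Spatial Fourier coefficient `(2π)^{-1/2} ∫_0^{2π} u(t,x) e^{-ixξ} dx`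
(here `fourier (-ξ) x = e^{-ixξ}`). -/
def spaceFourier (u : ℝ × Torus → ℂ) (ξ : ℤ) (t : ℝ) : ℂ :=
  ((Real.sqrt (2 * Real.pi) : ℝ) : ℂ)⁻¹ * ∫ x : Torus, fourier (-ξ) x * u (t, x)

/-- Fourier transform in time, `(2π)^{-1/2} ∫_ℝ f(t) e^{-itτ} dt`, for `f ∈ L¹(ℝ)`. -/
def timeFourier (f : ℝ → ℂ) (τ : ℝ) : ℂ :=
  ((Real.sqrt (2 * Real.pi) : ℝ) : ℂ)⁻¹ *
    ∫ t : ℝ, Complex.exp (-(Complex.I * (t : ℂ) * (τ : ℂ))) * f t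

/-- The space-time Fourier transform `𝓕 = 𝓕_t 𝓕_x` of `u ∈ L¹(ℝ × 𝕋)`. -/
def spaceTimeFourier (u : ℝ × Torus → ℂ) (ξ : ℤ) (τ : ℝ) : ℂ :=
  timeFourier (spaceFourier u ξ) τ

/-- The `X^{s,b}_{r,p}` norm of an object with space-time Fourier transform `v`:
`‖⟨τ + ξ²⟩^b ⟨ξ⟩^s v(ξ,τ)‖_{ℓ^{r'}_ξ L^{p'}_τ}`, where `r'`, `p'` are the dual exponents. -/
def xNormFourier (s b : ℝ) (r p : ℝ≥0∞) (v : ℤ → ℝ → ℂ) : ℝ≥0∞ :=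
  eLpNorm
    (fun ξ : ℤ =>
      eLpNorm
        (fun τ : ℝ =>
          ((bracket (τ + (ξ : ℝ) ^ 2) ^ b * bracket (ξ : ℝ) ^ s : ℝ) : ℂ) * v ξ τ)
        (ENNReal.conjExponent p) volume)
    (ENNReal.conjExponent r) Measure.count

/-- The `X^{s,b}_{r,p}` norm of `u`, with values in `[0, ∞]`. -/
def xNorm (s b : ℝ) (r p : ℝ≥0∞) (u : ℝ × Torus → ℂ) : ℝ≥0∞ :=
  xNormFourier s b r p (spaceTimeFourier u)

/-- The complex conjugate of `u`. -/
def conjFun (u : ℝ × Torus → ℂ) : ℝ × Torus → ℂ := fun z => starRingEnd ℂ (u z)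

/-- The pairs `(ξ₁, ξ₂)` with `ξ₁ ≠ ξ` and `ξ₂ ≠ ξ`; then `ξ₃ = ξ - ξ₁ - ξ₂`. -/
abbrev FreqPairs (ξ : ℤ) : Type := {p : ℤ × ℤ // p.1 ≠ ξ ∧ p.2 ≠ ξ}

/-- The summand `û₁(ξ₁) û₂(ξ₂) i ξ₃ (ū₃)^(ξ₃)` at time `t`, with `ξ₃ = ξ - ξ₁ - ξ₂`. -/
def triTerm (u₁ u₂ u₃ : ℝ × Torus → ℂ) (ξ : ℤ) (p : FreqPairs ξ) (t : ℝ) : ℂ :=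
  spaceFourier u₁ p.1.1 t * spaceFourier u₂ p.1.2 t *
    (Complex.I * ((ξ - p.1.1 - p.1.2 : ℤ) : ℂ)) *
    spaceFourier (conjFun u₃) (ξ - p.1.1 - p.1.2) t

/-- The diagonal expression `û₁(ξ) û₂(ξ) i ξ (ū₃)^(-ξ)` at time `t`. -/
def triDiag (u₁ u₂ u₃ : ℝ × Torus → ℂ) (ξ : ℤ) (t : ℝ) : ℂ :=
  spaceFourier u₁ ξ t * spaceFourier u₂ ξ t * (Complex.I * (ξ : ℂ)) *
    spaceFourier (conjFun u₃) (-ξ) t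

/-- The spatial Fourier coefficients at time `t` of `T(u₁,u₂,u₃)`, as a series at fixed time. It
converges for smooth functions; see `triFourier` for functions of low regularity. -/
def triCoeff (u₁ u₂ u₃ : ℝ × Torus → ℂ) (ξ : ℤ) (t : ℝ) : ℂ :=
  (2 * (Real.pi : ℂ))⁻¹ * ∑' p : FreqPairs ξ, triTerm u₁ u₂ u₃ ξ p t +
    (2 * (Real.pi : ℂ))⁻¹ * triDiag u₁ u₂ u₃ ξ t

/-- The space-time Fourier transform of `T(u₁,u₂,u₃)`: the defining series of `T`, Fourier
transformed in time term by term. For functions in the `X` spaces the series at fixed time need not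
converge, while this one does for a.e. `τ`; the two agree whenever the series at fixed time
converges absolutely in `L¹(ℝ)`, see `timeFourier_triCoeff`. -/
def triFourier (u₁ u₂ u₃ : ℝ × Torus → ℂ) (ξ : ℤ) (τ : ℝ) : ℂ :=
  (2 * (Real.pi : ℂ))⁻¹ * ∑' p : FreqPairs ξ, timeFourier (triTerm u₁ u₂ u₃ ξ p) τ +
    (2 * (Real.pi : ℂ))⁻¹ * timeFourier (triDiag u₁ u₂ u₃ ξ) τ

theorem norm_timeKernel (t τ : ℝ) :
    ‖Complex.exp (-(Complex.I * (t : ℂ) * (τ : ℂ)))‖ = 1 := by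
  rw [Complex.norm_exp]
  simp

theorem integrable_timeKernel_mul {f : ℝ → ℂ} (hf : Integrable f) (τ : ℝ) :
    Integrable (fun t : ℝ => Complex.exp (-(Complex.I * (t : ℂ) * (τ : ℂ))) * f t) := by
  refine hf.bdd_mul (c := 1) ?_ (Filter.Eventually.of_forall fun t => ?_)
  · exact (by fun_prop : Continuous fun t : ℝ =>
      Complex.exp (-(Complex.I * (t : ℂ) * (τ : ℂ)))).aestronglyMeasurable
  · exact (norm_timeKernel t τ).le

theorem integrable_tsum_of_summable {ι : Type} [Countable ι] {F : ι → ℝ → ℂ}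
    (hF : ∀ i, Integrable (F i)) (hs : Summable fun i => ∫ t, ‖F i t‖) :
    Integrable (fun t => ∑' i, F i t) := by
  have hfin : (∑' i, ∫⁻ t, ‖F i t‖ₑ) ≠ ∞ := by
    have h : ∀ i, ∫⁻ t, ‖F i t‖ₑ = ENNReal.ofReal (∫ t, ‖F i t‖) := fun i =>
      (ofReal_integral_norm_eq_lintegral_enorm (hF i)).symm
    simp_rw [h]
    exact hs.tsum_ofReal_ne_top
  have hae : ∀ᵐ t : ℝ, (∑' i, ‖F i t‖ₑ) < ∞ := by
    refine ae_lt_top' (AEMeasurable.tsum fun i => (hF i).1.enorm) ?_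
    rwa [lintegral_tsum fun i => (hF i).1.enorm]
  have hsum : ∀ᵐ t : ℝ, Summable fun i => F i t := by
    filter_upwards [hae] with t ht
    refine Summable.of_norm ?_
    have := ENNReal.summable_toReal ht.ne
    simpa using this
  refine ⟨?_, ?_⟩
  · by_cases hne : Nonempty ι
    · exact aestronglyMeasurable_of_tendsto_ae Filter.atTop
        (fun s : Finset ι => Finset.aestronglyMeasurable_fun_sum s fun i _ => (hF i).1)
        (by filter_upwards [hsum] with t ht using ht.hasSum)
    · have := not_nonempty_iff.mp hne
      simpa using aestronglyMeasurable_const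
  · refine lt_of_le_of_lt (lintegral_mono fun t => enorm_tsum_le_tsum_enorm) ?_
    rw [lintegral_tsum fun i => (hF i).1.enorm]
    exact hfin.lt_top

/-- Whenever the series defining `T(u₁,u₂,u₃)^(ξ)` converges absolutely in `L¹` in time, `triFourier`
is the Fourier transform in time of `triCoeff`. -/
theorem timeFourier_triCoeff (u₁ u₂ u₃ : ℝ × Torus → ℂ) (ξ : ℤ)
    (hF : ∀ p, Integrable (triTerm u₁ u₂ u₃ ξ p))
    (hs : Summable fun p => ∫ t, ‖triTerm u₁ u₂ u₃ ξ p t‖)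
    (hD : Integrable (triDiag u₁ u₂ u₃ ξ)) (τ : ℝ) :
    timeFourier (triCoeff u₁ u₂ u₃ ξ) τ = triFourier u₁ u₂ u₃ ξ τ := by
  have hI := integrable_tsum_of_summable hF hs
  have h1 : ∫ t : ℝ, Complex.exp (-(Complex.I * (t : ℂ) * (τ : ℂ))) *
        (∑' p : FreqPairs ξ, triTerm u₁ u₂ u₃ ξ p t) =
      ∑' p : FreqPairs ξ, ∫ t : ℝ, Complex.exp (-(Complex.I * (t : ℂ) * (τ : ℂ))) *
        triTerm u₁ u₂ u₃ ξ p t := by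
    rw [integral_tsum_of_summable_integral_norm
      (fun p => integrable_timeKernel_mul (hF p) τ)]
    · simp_rw [tsum_mul_left]
    · simpa only [norm_mul, norm_timeKernel, one_mul] using hs
  unfold timeFourier triFourier triCoeff timeFourier
  simp_rw [mul_add, mul_left_comm _ ((2 * (Real.pi : ℂ))⁻¹)]
  rw [integral_add ((integrable_timeKernel_mul hI τ).const_mul _)
    ((integrable_timeKernel_mul hD τ).const_mul _), integral_const_mul, integral_const_mul, h1,
    tsum_mul_left]
  ring

end PeriodicDNLS

end

open MeasureTheory
open scoped ENNReal

noncomputable section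

namespace PeriodicDNLS

/-! Write the input frequencies as `ξ - a`, `ξ - b` and, for the conjugated factor, `ξ - a - b`.
Measured from the parabola, the input modulations `x`, `y`, `z` and the output modulation `s`
satisfy `s = 2ab + x + y + z`, since `ξ² - (ξ-a)² - (ξ-b)² + (ξ-a-b)² = 2ab`. The frequencies
removed from the sum are exactly those with `ab = 0`, so elsewhere one of the four modulations is at
least `|ab|/2`. The derivative and the weights cost `κ^{1/2}` with `κ = freqRatio`; trading the
largest modulation against `|ab|` turns this into powers of `ℓ = resWeight = (1 + κ)/|ab|`
(`freqRatio_mul_japInv_le`).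

Frequency sums. `ℓ` is bounded by a product of a function of `a` and a function of `b`, both for
fixed `ξ` (`resWeight_le`) and for fixed `ξ - a - b` (`resWeight_le'`). Hölder and interpolation
between these two Schur bounds control the sum as soon as the power of `ℓ` exceeds `1/q`
(`exists_quadSum_le`). The exponent `1/2` must therefore be raised to `1/2 + η` with `η > 1/q -
1/2`.

Modulation integrals. If the output modulation dominates, the dual weight `⟨s⟩^{-1}` pays for the
extra `ℓ^η`, and Cauchy–Schwarz (`exists_triInt_le`) concludes. If an input with modulation `σ`
dominates, `ℓ^η` is gained where `⟨2ab + σ⟩ ℓ > 1`. In the remaining region `2ab` is within `ℓ⁻¹` of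
`-σ`, so the translates by `2ab` are almost orthogonal (`exists_tsum_cutoff_le`). This rests on a
uniform bound for the sum of `⟨σ + 2ab⟩^{-p} ⟨a - b⟩^{-ε}`, which follows from the divisor bound and
the scarcity of factorizations with `a` close to `b`. The factor `⟨a - b⟩^{-ε}` is supplied by
`resWeight_sq_mul_jap_le`. Almost orthogonality consumes some `ℓ^γ` with `γ > 0`, and the remaining
sum requires `γ < 3/2 - 2/q` when an unconjugated input dominates; this is where `q > 4/3` enters.

Power of `T`. Each modulation estimate measures two of the inputs with only `⟨·⟩^{β/2}`, `β = 1 -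
δ`. Functions supported in `|t| ≤ T` obey the uncertainty principle
`lintegral_enorm_timeFourier_sq_le`, so each of these two inputs gains `T^{δ/2}`. On the diagonal `κ
= 1`, and a fixed-frequency estimate suffices.

These bounds concern nonnegative functions. Plancherel and the product rule for Fourier transforms
in `L¹ ∩ L²` transfer them to the Fourier coefficients, and the duality of `ℓ^r` and `ℓ^{r'}` turns
the tested sum into a norm. -/

/-! ### Brackets: convolutions and lattice sums of their powers. -/

/-- The bracket `⟨x⟩` as an extended nonnegative real. -/
def jap (x : ℝ) : ℝ≥0∞ := ENNReal.ofReal (bracket x)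

theorem bracket_sq (x : ℝ) : bracket x ^ 2 = 1 + x ^ 2 :=
  Real.sq_sqrt (by positivity)

theorem one_le_bracket (x : ℝ) : 1 ≤ bracket x :=
  Real.one_le_sqrt.mpr (by nlinarith [sq_nonneg x])

theorem bracket_pos (x : ℝ) : 0 < bracket x := one_pos.trans_le (one_le_bracket x)

theorem abs_le_bracket (x : ℝ) : |x| ≤ bracket x :=
  Real.abs_le_sqrt (by linarith)

theorem bracket_le_one_add_abs (x : ℝ) : bracket x ≤ 1 + |x| :=
  Real.sqrt_le_iff.mpr ⟨by positivity, by nlinarith [abs_nonneg x, sq_abs x]⟩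

theorem bracket_neg (x : ℝ) : bracket (-x) = bracket x := by simp [bracket]

theorem bracket_add_le (x y : ℝ) : bracket (x + y) ≤ bracket x + |y| := by
  refine Real.sqrt_le_iff.mpr ⟨by have := bracket_pos x; positivity, ?_⟩
  nlinarith [bracket_sq x, abs_le_bracket x, abs_nonneg y, sq_abs y, abs_mul x y,
    le_abs_self (x * y), mul_le_mul_of_nonneg_right (abs_le_bracket x) (abs_nonneg y)]

theorem bracket_le_of_abs_le {x y : ℝ} (h : |x| ≤ |y|) : bracket x ≤ bracket y :=
  Real.sqrt_le_sqrt (by nlinarith [sq_abs x, sq_abs y, abs_nonneg x])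

@[fun_prop]
theorem continuous_bracket : Continuous bracket := by
  unfold bracket; fun_prop

@[fun_prop]
theorem measurable_jap : Measurable jap :=
  continuous_bracket.measurable.ennreal_ofReal

theorem jap_ne_top (x : ℝ) : jap x ≠ ∞ := ENNReal.ofReal_ne_top

theorem one_le_jap (x : ℝ) : 1 ≤ jap x := by
  rw [← ENNReal.ofReal_one]; exact ENNReal.ofReal_le_ofReal (one_le_bracket x)

theorem jap_ne_zero (x : ℝ) : jap x ≠ 0 := (one_pos.trans_le (one_le_jap x)).ne'

theorem jap_neg (x : ℝ) : jap (-x) = jap x := by rw [jap, bracket_neg, jap]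

theorem jap_add_le (x y : ℝ) : jap (x + y) ≤ jap x + jap y := by
  rw [jap, jap, jap, ← ENNReal.ofReal_add (bracket_pos x).le (bracket_pos y).le]
  exact ENNReal.ofReal_le_ofReal
    ((bracket_add_le x y).trans (add_le_add_right (abs_le_bracket y) _))

theorem jap_rpow_add (x s t : ℝ) : jap x ^ (s + t) = jap x ^ s * jap x ^ t :=
  ENNReal.rpow_add _ _ (jap_ne_zero x) (jap_ne_top x)

theorem jap_rpow_ne_top (x s : ℝ) : jap x ^ s ≠ ∞ :=
  ENNReal.rpow_ne_top_of_ne_zero (jap_ne_zero x) (jap_ne_top x)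

theorem jap_rpow_ne_zero (x s : ℝ) : jap x ^ s ≠ 0 := by
  rw [Ne, ENNReal.rpow_eq_zero_iff]
  simp [jap_ne_zero, jap_ne_top]

theorem jap_rpow_eq_ofReal (x s : ℝ) : jap x ^ s = ENNReal.ofReal (bracket x ^ s) :=
  ENNReal.ofReal_rpow_of_pos (bracket_pos x)

theorem jap_rpow_le_one (x : ℝ) {s : ℝ} (hs : s ≤ 0) : jap x ^ s ≤ 1 := by
  simpa using ENNReal.rpow_le_rpow_of_exponent_le (one_le_jap x) hs

theorem ennreal_rpow_le_rpow_of_nonpos {x y : ℝ≥0∞} {s : ℝ} (h : x ≤ y) (hs : s ≤ 0) :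
    y ^ s ≤ x ^ s := by
  have := ENNReal.inv_le_inv.mpr (ENNReal.rpow_le_rpow h (neg_nonneg.mpr hs))
  simpa [ENNReal.rpow_neg] using this

/-- Weighted comparison `x^s y^t ≤ x^{s+t} + y^{s+t}` for negative powers of brackets. -/
theorem jap_rpow_mul_le (x y : ℝ) {s t : ℝ} (hs : s ≤ 0) (ht : t ≤ 0) :
    jap x ^ s * jap y ^ t ≤ jap x ^ (s + t) + jap y ^ (s + t) := by
  rcases le_total (jap x) (jap y) with h | h
  · refine le_add_right ?_
    rw [jap_rpow_add]
    gcongr 1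
    exact ennreal_rpow_le_rpow_of_nonpos h ht
  · refine le_add_left ?_
    rw [jap_rpow_add]
    gcongr 1
    exact ennreal_rpow_le_rpow_of_nonpos h hs

theorem add_rpow_le_two_mul (x y : ℝ≥0∞) {s : ℝ} (hs : 0 ≤ s) :
    (x + y) ^ s ≤ 2 ^ s * (x ^ s + y ^ s) := by
  rcases le_total x y with h | h
  · calc (x + y) ^ s ≤ (2 * y) ^ s := by rw [two_mul]; gcongr
      _ = 2 ^ s * y ^ s := ENNReal.mul_rpow_of_nonneg _ _ hs
      _ ≤ _ := by gcongr; exact le_add_self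
  · calc (x + y) ^ s ≤ (2 * x) ^ s := by rw [two_mul]; gcongr
      _ = 2 ^ s * x ^ s := ENNReal.mul_rpow_of_nonneg _ _ hs
      _ ≤ _ := by gcongr; exact le_self_add

theorem lintegral_jap_rpow_lt_top {p : ℝ} (hp : 1 < p) : ∫⁻ x, jap x ^ (-p) < ∞ := by
  have h : Integrable fun x : ℝ => (1 + ‖x‖ ^ 2) ^ (-p / 2) :=
    integrable_rpow_neg_one_add_norm_sq (by simpa using hp)
  have h2 : ∀ x, jap x ^ (-p) = ENNReal.ofReal ((1 + ‖x‖ ^ 2) ^ (-p / 2)) := fun x => by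
    rw [jap_rpow_eq_ofReal, bracket, Real.sqrt_eq_rpow, ← Real.rpow_mul (by positivity)]
    simp only [Real.norm_eq_abs, sq_abs]
    congr 2
    ring
  simp_rw [h2]
  exact h.lintegral_lt_top

/-- The integral of `⟨x⟩^{-p}`. -/
def japInt (p : ℝ) : ℝ≥0∞ := ∫⁻ x, jap x ^ (-p)

theorem lintegral_jap_add (p y : ℝ) : ∫⁻ x, jap (x + y) ^ (-p) = japInt p :=
  lintegral_add_right_eq_self (fun x => jap x ^ (-p)) y

/-- Convolution of two negative powers of the bracket. -/
theorem lintegral_jap_mul_jap_le {α β γ : ℝ} (hα : α ≤ 1) (hβ : β ≤ 1) (hγ : 0 ≤ γ)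
    (h : γ < α + β - 1) (y : ℝ) :
    ∫⁻ x, jap x ^ (-α) * jap (y + x) ^ (-β) ≤
      2 ^ γ * (4 * japInt (α + β - γ)) * jap y ^ (-γ) := by
  have key : ∀ x, jap x ^ (-α) * jap (y + x) ^ (-β) * jap y ^ γ ≤
      2 ^ γ * (2 * (jap x ^ (-(α + β - γ)) + jap (x + y) ^ (-(α + β - γ)))) := fun x => by
    -- The triangle inequality lets one of the two brackets absorb the decay in `y`.
    have h1 : jap y ^ γ ≤ 2 ^ γ * (jap (y + x) ^ γ + jap x ^ γ) := by
      refine le_trans ?_ (add_rpow_le_two_mul _ _ hγ)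
      gcongr
      have := jap_add_le (y + x) (-x)
      simpa [jap_neg] using this
    calc jap x ^ (-α) * jap (y + x) ^ (-β) * jap y ^ γ
        ≤ jap x ^ (-α) * jap (y + x) ^ (-β) * (2 ^ γ * (jap (y + x) ^ γ + jap x ^ γ)) := by
          gcongr
      _ = 2 ^ γ * (jap x ^ (-α) * jap (y + x) ^ (-β + γ) +
            jap x ^ (-α + γ) * jap (y + x) ^ (-β)) := by
          rw [jap_rpow_add, jap_rpow_add]; ring
      -- As `α, β ≤ 1`, the hypothesis forces `γ < α` and `γ < β`, so all exponents stay nonpositive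
      -- and each product splits into single brackets of exponent `α + β - γ > 1`.
      _ ≤ 2 ^ γ * ((jap x ^ (-α + (-β + γ)) + jap (y + x) ^ (-α + (-β + γ))) +
            (jap x ^ (-α + γ + -β) + jap (y + x) ^ (-α + γ + -β))) := by
          gcongr
          · exact jap_rpow_mul_le _ _ (by linarith) (by linarith)
          · exact jap_rpow_mul_le _ _ (by linarith) (by linarith)
      _ = _ := by
          rw [show -α + (-β + γ) = -(α + β - γ) by ring,
            show -α + γ + -β = -(α + β - γ) by ring, add_comm y x]
          ring
  have h2 : (∫⁻ x, jap x ^ (-α) * jap (y + x) ^ (-β)) * jap y ^ γ ≤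
      2 ^ γ * (4 * japInt (α + β - γ)) := by
    rw [← lintegral_mul_const _ (by fun_prop)]
    refine (lintegral_mono key).trans_eq ?_
    rw [lintegral_const_mul _ (by fun_prop), lintegral_const_mul _ (by fun_prop),
      lintegral_add_left (by fun_prop), lintegral_jap_add, ← japInt]
    ring
  calc ∫⁻ x, jap x ^ (-α) * jap (y + x) ^ (-β)
      = (∫⁻ x, jap x ^ (-α) * jap (y + x) ^ (-β)) * jap y ^ γ * jap y ^ (-γ) := by
        rw [mul_assoc, ← jap_rpow_add]; simp
    _ ≤ _ := by gcongr

theorem japInt_lt_top {p : ℝ} (hp : 1 < p) : japInt p < ∞ := lintegral_jap_rpow_lt_top hp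

/-- The sum of `⟨n⟩^{-p}` over the integers. -/
def japSum (p : ℝ) : ℝ≥0∞ := ∑' n : ℤ, jap n ^ (-p)

theorem japSum_lt_top {p : ℝ} (hp : 1 < p) : japSum p < ∞ := by
  have hs : Summable fun n : ℤ => |(n : ℝ)| ^ (-p) := Real.summable_abs_int_rpow hp
  have h : ∀ n : ℤ, jap n ^ (-p) ≤ ENNReal.ofReal (|(n : ℝ)| ^ (-p)) + if n = 0 then 1 else 0 := by
    intro n
    split_ifs with hn
    · exact le_add_left (jap_rpow_le_one _ (by linarith))
    · rw [add_zero, jap_rpow_eq_ofReal]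
      refine ENNReal.ofReal_le_ofReal ?_
      exact Real.rpow_le_rpow_of_nonpos (by positivity) (abs_le_bracket _) (by linarith)
  refine (ENNReal.tsum_le_tsum h).trans_lt ?_
  rw [ENNReal.tsum_add]
  refine ENNReal.add_lt_top.mpr ⟨hs.tsum_ofReal_lt_top, ?_⟩
  rw [tsum_ite_eq]
  exact ENNReal.one_lt_top

/-- Replacing `x` by its integer part moves the argument by less than `1`, which at most doubles the
bracket; the lattice sum is then invariant under the shift. -/
theorem tsum_jap_add_int_le {p : ℝ} (hp : 0 ≤ p) (x : ℝ) :
    ∑' n : ℤ, jap (x + n) ^ (-p) ≤ 2 ^ p * japSum p := by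
  have h : ∀ n : ℤ, jap (x + n) ^ (-p) ≤ 2 ^ p * jap ((⌊x⌋ + n : ℤ) : ℝ) ^ (-p) := fun n => by
    have h1 : jap ((⌊x⌋ + n : ℤ) : ℝ) ≤ 2 * jap (x + n) := by
      have h2 : ((⌊x⌋ + n : ℤ) : ℝ) = (x + n) + (-Int.fract x) := by
        push_cast; linarith [Int.floor_add_fract x]
      have h3 : |-Int.fract x| ≤ 1 := by
        rw [abs_neg, abs_of_nonneg (Int.fract_nonneg x)]; exact (Int.fract_lt_one x).le
      rw [h2, jap, jap, ← ENNReal.ofReal_ofNat 2, ← ENNReal.ofReal_mul (by norm_num)]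
      refine ENNReal.ofReal_le_ofReal ?_
      linarith [bracket_add_le (x + n) (-Int.fract x), one_le_bracket (x + n)]
    have h4 := ennreal_rpow_le_rpow_of_nonpos h1 (neg_nonpos.mpr hp)
    rw [ENNReal.mul_rpow_of_ne_top (by simp) (jap_ne_top _)] at h4
    calc jap (x + n) ^ (-p) = 2 ^ p * (2 ^ (-p) * jap (x + n) ^ (-p)) := by
          rw [← mul_assoc, ← ENNReal.rpow_add _ _ (by simp) (by simp)]; simp
      _ ≤ _ := by gcongr
  refine (ENNReal.tsum_le_tsum h).trans_eq ?_
  rw [ENNReal.tsum_mul_left, japSum,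
    ← (Equiv.addLeft ⌊x⌋).tsum_eq fun n : ℤ => jap n ^ (-p)]
  rfl

theorem tsum_jap_add_two_mul_le {p : ℝ} (hp : 0 ≤ p) (x : ℝ) :
    ∑' n : ℤ, jap (x + 2 * n) ^ (-p) ≤ 2 ^ p * japSum p := by
  refine (ENNReal.tsum_le_tsum fun n => ?_).trans (tsum_jap_add_int_le hp (x / 2))
  refine ennreal_rpow_le_rpow_of_nonpos ?_ (neg_nonpos.mpr hp)
  refine ENNReal.ofReal_le_ofReal (bracket_le_of_abs_le ?_)
  rw [show x + 2 * (n : ℝ) = 2 * (x / 2 + n) by ring, abs_mul, abs_two]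
  linarith [abs_nonneg (x / 2 + n)]

/-! ### Divisors and sums over hyperbolas. -/

/-- The divisor bound `d(n) ≤ C n^ε`. -/
theorem exists_card_divisors_le {ε : ℝ} (hε : 0 < ε) :
    ∃ C : ℝ, 0 < C ∧ ∀ n : ℕ, n ≠ 0 → (n.divisors.card : ℝ) ≤ C * (n : ℝ) ^ ε := by
  -- Primes `p ≥ P` satisfy `p^ε ≥ 2` and so `v + 1 ≤ 2^v ≤ (p^v)^ε` without loss. Each of the fewer
  -- than `P` smaller primes loses at most the factor `M`, read off from `1 + x ≤ e^x`; hence the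
  -- constant `M ^ P`.
  obtain ⟨P, hP⟩ := exists_nat_ge ((2 : ℝ) ^ (1 / ε))
  have hl : 0 < ε * Real.log 2 := mul_pos hε (Real.log_pos one_lt_two)
  set M : ℝ := 1 + (ε * Real.log 2)⁻¹ with hM
  have hM1 : 1 ≤ M := by rw [hM]; linarith [inv_pos.mpr hl]
  have hsmall : ∀ p v : ℕ, p.Prime → ((v : ℝ) + 1) ≤ M * ((p : ℝ) ^ v) ^ ε := by
    intro p v hp
    have h2 : (2 : ℝ) ≤ p := by exact_mod_cast hp.two_le
    have h1 : 1 + ε * Real.log 2 * v ≤ ((p : ℝ) ^ v) ^ ε := by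
      calc 1 + ε * Real.log 2 * v ≤ Real.exp (ε * Real.log 2 * v) := by
            linarith [Real.add_one_le_exp (ε * Real.log 2 * v)]
        _ = ((2 : ℝ) ^ v) ^ ε := by
            rw [← Real.rpow_natCast, ← Real.rpow_mul (by norm_num),
              Real.rpow_def_of_pos (by norm_num)]
            ring_nf
        _ ≤ _ := by gcongr
    have h3 : (v : ℝ) + 1 ≤ M * (1 + ε * Real.log 2 * v) := by
      have : M * (1 + ε * Real.log 2 * v) =
          1 + v + ε * Real.log 2 * v + (ε * Real.log 2)⁻¹ := by
        rw [hM]; field_simp; ring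
      rw [this]
      have := inv_pos.mpr hl
      have : 0 ≤ ε * Real.log 2 * v := by positivity
      linarith
    exact h3.trans (by gcongr)
  have hlarge : ∀ p v : ℕ, P ≤ p → ((v : ℝ) + 1) ≤ ((p : ℝ) ^ v) ^ ε := by
    intro p v hp
    have h1 : (2 : ℝ) ≤ (p : ℝ) ^ ε := by
      calc (2 : ℝ) = ((2 : ℝ) ^ (1 / ε)) ^ ε := by
            rw [← Real.rpow_mul (by norm_num), one_div, inv_mul_cancel₀ hε.ne', Real.rpow_one]
        _ ≤ (p : ℝ) ^ ε := by
            have : (P : ℝ) ≤ p := by exact_mod_cast hp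
            gcongr
            linarith
    have h2 : ((p : ℝ) ^ v) ^ ε = ((p : ℝ) ^ ε) ^ v := by
      rw [← Real.rpow_natCast, ← Real.rpow_natCast, ← Real.rpow_mul (by positivity),
        ← Real.rpow_mul (by positivity), mul_comm]
    rw [h2]
    calc (v : ℝ) + 1 ≤ (2 : ℝ) ^ v := by exact_mod_cast Nat.lt_two_pow_self
      _ ≤ _ := by gcongr
  refine ⟨M ^ P, by positivity, fun n hn => ?_⟩
  have hnp : (n : ℝ) ^ ε = ∏ p ∈ n.primeFactors, ((p : ℝ) ^ n.factorization p) ^ ε := by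
    rw [Real.finsetProd_rpow _ _ (fun i _ => by positivity)]
    congr 1
    exact_mod_cast (Nat.prod_factorization_pow_eq_self hn).symm
  have hterm : ∀ p ∈ n.primeFactors, ((n.factorization p : ℝ) + 1) ≤
      (if p < P then M else 1) * ((p : ℝ) ^ n.factorization p) ^ ε := by
    intro p hp
    split_ifs with h
    · exact hsmall p _ (Nat.prime_of_mem_primeFactors hp)
    · rw [one_mul]; exact hlarge p _ (not_lt.mp h)
  rw [Nat.card_divisors hn, hnp]
  push_cast
  refine (Finset.prod_le_prod (fun i _ => by positivity) hterm).trans ?_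
  rw [Finset.prod_mul_distrib]
  gcongr
  · rw [Finset.prod_ite, Finset.prod_const_one, mul_one, Finset.prod_const]
    refine pow_le_pow_right₀ hM1 ?_
    calc _ ≤ (Finset.range P).card := Finset.card_le_card fun p hp => by
          simpa using (Finset.mem_filter.mp hp).2
      _ = P := Finset.card_range P

theorem card_divisorsAntidiag_le {n : ℤ} (hn : n ≠ 0) :
    n.divisorsAntidiag.card ≤ 2 * n.natAbs.divisors.card := by
  have h := Finset.card_le_card_of_injOn (s := n.divisorsAntidiag)
    (t := n.natAbs.divisors ×ˢ (Finset.univ : Finset Bool))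
    (fun p => (p.1.natAbs, decide (0 ≤ p.1))) ?_ ?_
  · rw [Finset.card_product, Finset.card_univ, Fintype.card_bool] at h
    linarith
  · intro p hp
    have hp' := (Int.mem_divisorsAntidiag.mp hp).1
    have : p.1.natAbs ∣ n.natAbs := Int.natAbs_dvd_natAbs.mpr ⟨p.2, hp'.symm⟩
    simp [this, hn, le_or_gt]
  · intro p hp p' hp' h
    have h1 := (Int.mem_divisorsAntidiag.mp hp).1
    have h1' := (Int.mem_divisorsAntidiag.mp hp').1
    simp only [Prod.mk.injEq, decide_eq_decide] at h
    have h2 : p.1 = p'.1 := by omega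
    have h3 : p.1 ≠ 0 := by rintro h0; rw [h0, zero_mul] at h1; exact hn h1.symm
    refine Prod.ext h2 (mul_left_cancel₀ h3 ?_)
    rw [h1, h2, h1']

/-- There are at most four factorizations `n = ab` with `|a - b| ≤ |n|^{1/4}`. -/
theorem card_close_divisors_le {n : ℤ} (hn : n ≠ 0) :
    (n.divisorsAntidiag.filter fun p => (p.1 - p.2) ^ 4 ≤ |n|).card ≤ 4 := by
  have h := Finset.card_le_card_of_injOn
    (s := n.divisorsAntidiag.filter fun p => (p.1 - p.2) ^ 4 ≤ |n|)
    (t := (Finset.univ : Finset (Bool × Bool)))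
    -- The four possibilities are the signs of `a + b` and `a - b`: the moduli of these two numbers
    -- turn out to be determined by `n`.
    (fun p => (decide (0 ≤ p.1 + p.2), decide (0 ≤ p.1 - p.2))) (fun _ _ => Finset.mem_univ _) ?_
  · simpa using h
  · intro p hp p' hp' h
    obtain ⟨hp1, hp2⟩ := Finset.mem_filter.mp hp
    obtain ⟨hp1', hp2'⟩ := Finset.mem_filter.mp hp'
    have h1 := (Int.mem_divisorsAntidiag.mp hp1).1
    have h1' := (Int.mem_divisorsAntidiag.mp hp1').1
    simp only [Prod.mk.injEq, decide_eq_decide] at h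
    obtain ⟨a, b⟩ := p
    obtain ⟨a', b'⟩ := p'
    simp only at h1 h1' hp2 hp2' h
    -- From `(a+b)² = (a-b)² + 4n`, two different values of `|a+b|` force `2|a+b| + 1 ≤ (a'-b')²`.
    -- Squaring gives `(2|a+b| + 1)² ≤ n`, against `4n ≤ |a+b|²`. For negative `n` a close pair is
    -- already impossible, since `(a-b)² ≥ 4|n|`.
    have key : ∀ {a b a' b' : ℤ}, a * b = n → a' * b' = n → (a - b) ^ 4 ≤ |n| →
        (a' - b') ^ 4 ≤ |n| → ¬ |a + b| < |a' + b'| := by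
      intro a b a' b' h1 h1' h2 h2' hlt
      have hsq : (a + b) ^ 2 = (a - b) ^ 2 + 4 * n := by rw [← h1]; ring
      have hsq' : (a' + b') ^ 2 = (a' - b') ^ 2 + 4 * n := by rw [← h1']; ring
      have h3 : 2 * |a + b| + 1 ≤ (a' - b') ^ 2 := by
        nlinarith [sq_abs (a + b), sq_abs (a' + b'), sq_nonneg (a - b), abs_nonneg (a + b)]
      have h5 : 0 < n := by
        by_contra hneg
        rw [abs_of_nonpos (by omega)] at h2
        have h6 : 4 * (-n) ≤ (a - b) ^ 2 := by nlinarith [sq_nonneg (a + b)]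
        have h9 : (4 * -n) ^ 2 ≤ ((a - b) ^ 2) ^ 2 := pow_le_pow_left₀ (by omega) h6 2
        have h10 : 1 ≤ -n := by omega
        nlinarith
      rw [abs_of_pos h5] at h2 h2'
      have h7 : 4 * n ≤ |a + b| ^ 2 := by rw [sq_abs]; nlinarith [sq_nonneg (a - b)]
      have h8 : (2 * |a + b| + 1) ^ 2 ≤ ((a' - b') ^ 2) ^ 2 := by
        have := abs_nonneg (a + b); gcongr
      nlinarith [abs_nonneg (a + b)]
    have h2 : |a + b| = |a' + b'| :=
      le_antisymm (not_lt.mp (key h1' h1 hp2' hp2)) (not_lt.mp (key h1 h1' hp2 hp2'))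
    have hs : a + b = a' + b' := by
      rcases abs_eq_abs.mp h2 with h3 | h3
      · exact h3
      · omega
    have hd : a - b = a' - b' := by
      have h4 : (a - b) ^ 2 = (a' - b') ^ 2 := by
        have e1 : (a - b) ^ 2 = (a + b) ^ 2 - 4 * n := by rw [← h1]; ring
        have e2 : (a' - b') ^ 2 = (a' + b') ^ 2 - 4 * n := by rw [← h1']; ring
        rw [e1, e2, hs]
      rcases sq_eq_sq_iff_eq_or_eq_neg.mp h4 with h3 | h3
      · exact h3
      · omega
    ext <;> simp only <;> omega

/-- At most four factorizations have `|a-b| ≤ |n|^{1/4}`, and each contributes at most `1`. Every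
other term is at most `|n|^{-ε/4}`, which cancels the divisor bound with exponent `ε/4`. The bound
is thus uniform in `n`, with no divisor loss. -/
theorem exists_sum_divisorsAntidiag_le {ε : ℝ} (hε : 0 < ε) :
    ∃ C : ℝ≥0∞, C ≠ ∞ ∧ ∀ n : ℤ,
      ∑ p ∈ n.divisorsAntidiag, jap ((p.1 - p.2 : ℤ) : ℝ) ^ (-ε) ≤ C := by
  obtain ⟨C, hC, hd⟩ := exists_card_divisors_le (ε := ε / 4) (by positivity)
  refine ⟨4 + ENNReal.ofReal (2 * C), ENNReal.add_ne_top.mpr ⟨by simp, ENNReal.ofReal_ne_top⟩, fun n => ?_⟩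
  rcases eq_or_ne n 0 with rfl | hn
  · simp
  rw [← Finset.sum_filter_add_sum_filter_not _ fun p : ℤ × ℤ => (p.1 - p.2) ^ 4 ≤ |n|]
  gcongr
  · refine (Finset.sum_le_card_nsmul _ _ 1 fun p _ => jap_rpow_le_one _ (by linarith)).trans ?_
    rw [nsmul_one]
    exact_mod_cast card_close_divisors_le hn
  · have hpos : (0 : ℝ) < |(n : ℝ)| := abs_pos.mpr (by exact_mod_cast hn)
    have hfar : ∀ p ∈ n.divisorsAntidiag.filter (fun p => ¬ (p.1 - p.2) ^ 4 ≤ |n|),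
        jap ((p.1 - p.2 : ℤ) : ℝ) ^ (-ε) ≤ ENNReal.ofReal (|(n : ℝ)| ^ (-(ε / 4))) := by
      intro p hp
      have h1 : |(n : ℝ)| ≤ |((p.1 - p.2 : ℤ) : ℝ)| ^ 4 := by
        have := (not_le.mp (Finset.mem_filter.mp hp).2).le
        rw [Even.pow_abs (by decide)]
        exact_mod_cast this
      have h2 : |(n : ℝ)| ≤ bracket ((p.1 - p.2 : ℤ) : ℝ) ^ 4 :=
        h1.trans (by gcongr; exact abs_le_bracket _)
      rw [jap_rpow_eq_ofReal]
      refine ENNReal.ofReal_le_ofReal ?_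
      have h3 := Real.rpow_le_rpow_of_nonpos hpos h2 (z := -(ε / 4)) (by linarith)
      refine le_of_eq_of_le ?_ h3
      rw [← Real.rpow_natCast, ← Real.rpow_mul (bracket_pos _).le]
      congr 1
      push_cast
      ring
    refine (Finset.sum_le_card_nsmul _ _ _ hfar).trans ?_
    rw [nsmul_eq_mul, ← ENNReal.ofReal_natCast, ← ENNReal.ofReal_mul (by positivity)]
    refine ENNReal.ofReal_le_ofReal ?_
    have h1 : ((n.divisorsAntidiag.filter (fun p => ¬ (p.1 - p.2) ^ 4 ≤ |n|)).card : ℝ) ≤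
        2 * (C * |(n : ℝ)| ^ (ε / 4)) := by
      have h2 := hd n.natAbs (by simpa using hn)
      rw [Nat.cast_natAbs, Int.cast_abs] at h2
      have h3 : ((n.divisorsAntidiag.filter (fun p => ¬ (p.1 - p.2) ^ 4 ≤ |n|)).card : ℝ) ≤
          2 * n.natAbs.divisors.card := by
        exact_mod_cast (Finset.card_filter_le _ _).trans (card_divisorsAntidiag_le hn)
      linarith
    calc _ ≤ 2 * (C * |(n : ℝ)| ^ (ε / 4)) * |(n : ℝ)| ^ (-(ε / 4)) := by gcongr
      _ = 2 * C * (|(n : ℝ)| ^ (ε / 4) * |(n : ℝ)| ^ (-(ε / 4))) := by ring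
      _ = 2 * C := by rw [← Real.rpow_add hpos]; simp

/-- Uniformly in `σ`, the sum of `⟨σ + 2ab⟩^{-p} ⟨a - b⟩^{-ε}` over nonzero `a, b` is bounded. -/
theorem exists_tsum_jap_hyperbola_le {p ε : ℝ} (hp : 1 < p) (hε : 0 < ε) :
    ∃ C : ℝ≥0∞, C ≠ ∞ ∧ ∀ σ : ℝ, ∑' z : ℤ × ℤ, (if z.1 * z.2 = 0 then 0 else
      jap (σ + 2 * (z.1 * z.2 : ℤ)) ^ (-p) * jap ((z.1 - z.2 : ℤ) : ℝ) ^ (-ε)) ≤ C := by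
  obtain ⟨C, hC, hd⟩ := exists_sum_divisorsAntidiag_le hε
  refine ⟨2 ^ p * japSum p * C, ENNReal.mul_ne_top
    (ENNReal.mul_ne_top (by simp) (japSum_lt_top hp).ne) hC, fun σ => ?_⟩
  -- Group the pairs by their product `n`: the first bracket depends only on `n`, and the second is
  -- summed over the factorizations of `n`.
  have h1 : ∀ z : ℤ × ℤ, (if z.1 * z.2 = 0 then 0 else
      jap (σ + 2 * (z.1 * z.2 : ℤ)) ^ (-p) * jap ((z.1 - z.2 : ℤ) : ℝ) ^ (-ε)) =
      ∑' n : ℤ, if z ∈ n.divisorsAntidiag then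
        jap (σ + 2 * n) ^ (-p) * jap ((z.1 - z.2 : ℤ) : ℝ) ^ (-ε) else 0 := by
    intro z
    rw [tsum_eq_single (z.1 * z.2) fun n hn => ?_]
    · by_cases h : z.1 * z.2 = 0
      · rw [if_pos h, if_neg]
        rw [Int.mem_divisorsAntidiag]
        exact fun h' => h'.2 h
      · rw [if_neg h, if_pos]
        exact Int.mem_divisorsAntidiag.mpr ⟨rfl, h⟩
    · rw [if_neg]
      rw [Int.mem_divisorsAntidiag]
      exact fun h => hn h.1.symm
  simp_rw [h1]
  rw [ENNReal.tsum_comm]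
  have h2 : ∀ n : ℤ, (∑' z : ℤ × ℤ, if z ∈ n.divisorsAntidiag then
        jap (σ + 2 * n) ^ (-p) * jap ((z.1 - z.2 : ℤ) : ℝ) ^ (-ε) else 0) ≤
        jap (σ + 2 * n) ^ (-p) * C := by
    intro n
    rw [tsum_eq_sum (s := n.divisorsAntidiag) (fun z hz => if_neg hz),
      Finset.sum_congr rfl (fun z hz => if_pos hz), ← Finset.mul_sum]
    gcongr
    exact hd n
  refine (ENNReal.tsum_le_tsum h2).trans ?_
  rw [ENNReal.tsum_mul_right]
  gcongr
  exact tsum_jap_add_two_mul_le (by linarith) σ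

/-! ### Cauchy–Schwarz bounds for the modulation integrals. -/

theorem sq_lintegral_mul_le {α : Type*} [MeasurableSpace α] {μ : Measure α} {f g : α → ℝ≥0∞}
    (hf : AEMeasurable f μ) (hg : AEMeasurable g μ) :
    (∫⁻ a, f a * g a ∂μ) ^ 2 ≤ (∫⁻ a, f a ^ 2 ∂μ) * ∫⁻ a, g a ^ 2 ∂μ := by
  have h := ENNReal.lintegral_mul_norm_pow_le (μ := μ) (hf.pow_const (2 : ℕ))
    (hg.pow_const (2 : ℕ)) (p := 1 / 2) (q := 1 / 2) (by norm_num) (by norm_num) (by norm_num)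
  have h1 : ∀ x : ℝ≥0∞, (x ^ 2) ^ (1 / 2 : ℝ) = x := fun x => by
    rw [← ENNReal.rpow_natCast, ← ENNReal.rpow_mul]; norm_num
  have h2 : ∀ x : ℝ≥0∞, (x ^ (1 / 2 : ℝ)) ^ 2 = x := fun x => by
    rw [← ENNReal.rpow_natCast, ← ENNReal.rpow_mul]; norm_num
  simp only [h1] at h
  calc _ ≤ ((∫⁻ a, f a ^ 2 ∂μ) ^ (1 / 2 : ℝ) * (∫⁻ a, g a ^ 2 ∂μ) ^ (1 / 2 : ℝ)) ^ 2 := by gcongr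
    _ = _ := by rw [mul_pow, h2, h2]

/-- The squared weighted norm `‖⟨x⟩^e P‖_{L²}²`. -/
def energy (e : ℝ) (P : ℝ → ℝ≥0∞) : ℝ≥0∞ := ∫⁻ x, jap x ^ (2 * e) * P x ^ 2

/-- The bilinear expression `∫∫ P(x) Q(y) Φ(s + x + y) dy dx`. -/
def biInt (Φ P Q : ℝ → ℝ≥0∞) (s : ℝ) : ℝ≥0∞ := ∫⁻ x, P x * ∫⁻ y, Q y * Φ (s + x + y)

/-- The trilinear expression `∫∫∫ P(x) Q(y) R(z) Φ(c + x + y + z) dz dy dx`. -/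
def triInt (Φ P Q R : ℝ → ℝ≥0∞) (c : ℝ) : ℝ≥0∞ := ∫⁻ x, P x * biInt Φ Q R (c + x)

section measurability
variable {Φ P Q R : ℝ → ℝ≥0∞}

theorem biInt_eq_lintegral_prod (hΦ : Measurable Φ) (hP : Measurable P) (hQ : Measurable Q)
    (s : ℝ) : biInt Φ P Q s = ∫⁻ z : ℝ × ℝ, P z.1 * Q z.2 * Φ (s + z.1 + z.2) := by
  rw [Measure.volume_eq_prod, lintegral_prod _ (by fun_prop)]
  refine lintegral_congr fun x => ?_
  rw [← lintegral_const_mul _ (by fun_prop)]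
  simp_rw [mul_assoc]

@[fun_prop]
theorem measurable_biInt (hΦ : Measurable Φ) (hP : Measurable P) (hQ : Measurable Q) :
    Measurable (biInt Φ P Q) := by
  have h : Measurable fun p : ℝ × ℝ × ℝ => P p.2.1 * Q p.2.2 * Φ (p.1 + p.2.1 + p.2.2) := by
    fun_prop
  have h2 := h.lintegral_prod_right' (ν := volume)
  have h3 : biInt Φ P Q = fun s => ∫⁻ z : ℝ × ℝ, P z.1 * Q z.2 * Φ (s + z.1 + z.2) :=
    funext fun s => biInt_eq_lintegral_prod hΦ hP hQ s
  rwa [h3]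

theorem biInt_comm (hΦ : Measurable Φ) (hP : Measurable P) (hQ : Measurable Q) :
    biInt Φ P Q = biInt Φ Q P := by
  have h : ∀ {P Q : ℝ → ℝ≥0∞}, Measurable P → Measurable Q → ∀ s,
      biInt Φ P Q s = ∫⁻ x, ∫⁻ y, P x * (Q y * Φ (s + x + y)) := fun hP hQ s =>
    lintegral_congr fun x => (lintegral_const_mul _ (by fun_prop)).symm
  ext s
  rw [h hP hQ, h hQ hP, lintegral_lintegral_swap (by fun_prop)]
  refine lintegral_congr fun x => lintegral_congr fun y => ?_
  rw [show s + y + x = s + x + y by ring]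
  ring

theorem triInt_swap_right (hΦ : Measurable Φ) (hQ : Measurable Q) (hR : Measurable R) :
    triInt Φ P Q R = triInt Φ P R Q := by
  ext c
  unfold triInt
  rw [biInt_comm hΦ hQ hR]

theorem triInt_swap_left (hΦ : Measurable Φ) (hP : Measurable P) (hQ : Measurable Q)
    (hR : Measurable R) : triInt Φ P Q R = triInt Φ Q P R := by
  ext c
  have hm : Measurable fun s => ∫⁻ z, R z * Φ (s + z) := by
    have h : Measurable fun p : ℝ × ℝ => R p.2 * Φ (p.1 + p.2) := by fun_prop
    exact h.lintegral_prod_right' (ν := volume)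
  have := congrFun (biInt_comm hm hP hQ) c
  exact this

end measurability

variable {β η : ℝ}

/-- Cauchy–Schwarz in `(x, y)` after dividing the kernel unequally. The part carrying `P` and `Q`
keeps `⟨s+x+y⟩^{-(1+d/4)}`, integrable in `s`. The other part is `⟨s+x+y⟩^{-(1-d/4)}` convolved with
two copies of `⟨·⟩^{-β}`, which decays like `⟨s⟩^{-2η}`. -/
theorem exists_biInt_le (hβ : β ≤ 1) (hη : 0 ≤ η) (h : 2 * η < 2 * β - 1) :
    ∃ C : ℝ≥0∞, C ≠ ∞ ∧ ∀ P Q : ℝ → ℝ≥0∞, Measurable P → Measurable Q →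
      ∫⁻ s, jap s ^ (2 * η) * biInt (fun x => jap x ^ (-1 : ℝ)) P Q s ^ 2 ≤
        C * (energy (β / 2) P * energy (β / 2) Q) := by
  -- `d` is the slack in the hypothesis; fractions of it pay for the strict inequalities in the
  -- successive convolutions.
  obtain ⟨d, hd⟩ : ∃ d, d = 2 * β - 1 - 2 * η := ⟨_, rfl⟩
  have hd0 : 0 < d := by linarith
  obtain ⟨C, hC, hJ⟩ : ∃ C : ℝ≥0∞, C ≠ ∞ ∧ ∀ s : ℝ, (∫⁻ z : ℝ × ℝ,
      (jap z.1 ^ (-(β / 2)) * jap z.2 ^ (-(β / 2)) * jap (s + z.1 + z.2) ^ (-((1 - d / 4) / 2)))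
        ^ 2) ≤ C * jap s ^ (-(2 * η)) := by
    refine ⟨2 ^ (β - d / 2) * (4 * japInt (β + (1 - d / 4) - (β - d / 2))) *
      (2 ^ (2 * η) * (4 * japInt (β + (β - d / 2) - 2 * η))), ?_, fun s => ?_⟩
    · refine ENNReal.mul_ne_top (ENNReal.mul_ne_top ?_ (ENNReal.mul_ne_top (by simp) ?_))
        (ENNReal.mul_ne_top ?_ (ENNReal.mul_ne_top (by simp) ?_))
      · exact ENNReal.rpow_ne_top_of_ne_zero (by simp) (by simp)
      · exact (japInt_lt_top (by linarith)).ne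
      · exact ENNReal.rpow_ne_top_of_ne_zero (by simp) (by simp)
      · exact (japInt_lt_top (by linarith)).ne
    · rw [Measure.volume_eq_prod, lintegral_prod _ (by fun_prop)]
      have h1 : ∀ x y : ℝ,
          (jap x ^ (-(β / 2)) * jap y ^ (-(β / 2)) * jap (s + x + y) ^ (-((1 - d / 4) / 2))) ^ 2 =
          jap x ^ (-β) * (jap y ^ (-β) * jap (s + x + y) ^ (-(1 - d / 4))) := fun x y => by
        rw [mul_pow, mul_pow, ← ENNReal.rpow_mul_natCast, ← ENNReal.rpow_mul_natCast,
          ← ENNReal.rpow_mul_natCast, mul_assoc]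
        congr 3 <;> push_cast <;> ring
      simp_rw [h1]
      calc _ ≤ ∫⁻ x, jap x ^ (-β) * (2 ^ (β - d / 2) *
            (4 * japInt (β + (1 - d / 4) - (β - d / 2))) * jap (s + x) ^ (-(β - d / 2))) := by
            refine lintegral_mono fun x => ?_
            rw [lintegral_const_mul _ (by fun_prop)]
            gcongr
            exact lintegral_jap_mul_jap_le hβ (by linarith) (by linarith) (by linarith) _
        _ = 2 ^ (β - d / 2) * (4 * japInt (β + (1 - d / 4) - (β - d / 2))) *
            ∫⁻ x, jap x ^ (-β) * jap (s + x) ^ (-(β - d / 2)) := by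
            rw [← lintegral_const_mul _ (by fun_prop)]
            refine lintegral_congr fun x => by ring
        _ ≤ _ := by
            rw [mul_assoc _ _ (jap s ^ _)]
            gcongr
            exact lintegral_jap_mul_jap_le hβ (by linarith) (by linarith) (by linarith) _
  refine ⟨C * japInt (1 + d / 4), ENNReal.mul_ne_top hC (japInt_lt_top (by linarith)).ne,
    fun P Q hP hQ => ?_⟩
  have hA : ∀ s, jap s ^ (2 * η) * biInt (fun x => jap x ^ (-1 : ℝ)) P Q s ^ 2 ≤
      C * ∫⁻ z : ℝ × ℝ, (P z.1 * Q z.2 * (jap z.1 ^ (β / 2) * jap z.2 ^ (β / 2) *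
        jap (s + z.1 + z.2) ^ (-((1 + d / 4) / 2)))) ^ 2 := by
    intro s
    have h1 : biInt (fun x => jap x ^ (-1 : ℝ)) P Q s = ∫⁻ z : ℝ × ℝ,
        (P z.1 * Q z.2 * (jap z.1 ^ (β / 2) * jap z.2 ^ (β / 2) *
          jap (s + z.1 + z.2) ^ (-((1 + d / 4) / 2)))) *
        (jap z.1 ^ (-(β / 2)) * jap z.2 ^ (-(β / 2)) *
          jap (s + z.1 + z.2) ^ (-((1 - d / 4) / 2))) := by
      rw [biInt_eq_lintegral_prod (by fun_prop) hP hQ]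
      refine lintegral_congr fun z => ?_
      calc _ = P z.1 * Q z.2 * ((jap z.1 ^ (β / 2) * jap z.1 ^ (-(β / 2))) *
            (jap z.2 ^ (β / 2) * jap z.2 ^ (-(β / 2))) *
            (jap (s + z.1 + z.2) ^ (-((1 + d / 4) / 2)) *
              jap (s + z.1 + z.2) ^ (-((1 - d / 4) / 2)))) := by
            rw [← jap_rpow_add, ← jap_rpow_add, ← jap_rpow_add,
              show -((1 + d / 4) / 2) + -((1 - d / 4) / 2) = -1 by ring]
            simp
        _ = _ := by ring
    rw [h1]
    calc _ ≤ jap s ^ (2 * η) * ((∫⁻ z : ℝ × ℝ, (P z.1 * Q z.2 * (jap z.1 ^ (β / 2) *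
            jap z.2 ^ (β / 2) * jap (s + z.1 + z.2) ^ (-((1 + d / 4) / 2)))) ^ 2) *
            (C * jap s ^ (-(2 * η)))) := by
          gcongr
          refine (sq_lintegral_mul_le (by fun_prop) (by fun_prop)).trans ?_
          gcongr
          exact hJ s
      _ = (jap s ^ (2 * η) * jap s ^ (-(2 * η))) * (C * (∫⁻ z : ℝ × ℝ, (P z.1 * Q z.2 *
            (jap z.1 ^ (β / 2) * jap z.2 ^ (β / 2) *
            jap (s + z.1 + z.2) ^ (-((1 + d / 4) / 2)))) ^ 2)) := by ring
      _ = _ := by rw [← jap_rpow_add]; simp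
  refine (lintegral_mono hA).trans ?_
  rw [lintegral_const_mul _ (by
    refine Measurable.lintegral_prod_right'
      (f := fun p : ℝ × ℝ × ℝ => (P p.2.1 * Q p.2.2 * (jap p.2.1 ^ (β / 2) * jap p.2.2 ^ (β / 2) *
        jap (p.1 + p.2.1 + p.2.2) ^ (-((1 + d / 4) / 2)))) ^ 2) ?_
    fun_prop)]
  rw [mul_assoc]
  gcongr
  rw [lintegral_lintegral_swap (by fun_prop)]
  have h2 : ∀ z : ℝ × ℝ, ∫⁻ s, (P z.1 * Q z.2 * (jap z.1 ^ (β / 2) * jap z.2 ^ (β / 2) *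
      jap (s + z.1 + z.2) ^ (-((1 + d / 4) / 2)))) ^ 2 =
      japInt (1 + d / 4) * ((jap z.1 ^ (2 * (β / 2)) * P z.1 ^ 2) *
        (jap z.2 ^ (2 * (β / 2)) * Q z.2 ^ 2)) := by
    intro z
    have h3 : ∀ s, (P z.1 * Q z.2 * (jap z.1 ^ (β / 2) * jap z.2 ^ (β / 2) *
      jap (s + z.1 + z.2) ^ (-((1 + d / 4) / 2)))) ^ 2 =
        jap (s + (z.1 + z.2)) ^ (-(1 + d / 4)) * ((jap z.1 ^ (2 * (β / 2)) * P z.1 ^ 2) *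
        (jap z.2 ^ (2 * (β / 2)) * Q z.2 ^ 2)) := fun s => by
      rw [mul_pow, mul_pow, mul_pow, mul_pow, ← ENNReal.rpow_mul_natCast,
        ← ENNReal.rpow_mul_natCast, ← ENNReal.rpow_mul_natCast, ← add_assoc,
        show β / 2 * ((2 : ℕ) : ℝ) = 2 * (β / 2) by push_cast; ring,
        show -((1 + d / 4) / 2) * ((2 : ℕ) : ℝ) = -(1 + d / 4) by push_cast; ring]
      ring
    simp_rw [h3]
    rw [lintegral_mul_const _ (by fun_prop), lintegral_jap_add]
  simp_rw [h2]
  rw [lintegral_const_mul _ (by fun_prop), Measure.volume_eq_prod,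
    lintegral_prod_mul (f := fun x => jap x ^ (2 * (β / 2)) * P x ^ 2)
      (g := fun x => jap x ^ (2 * (β / 2)) * Q x ^ 2) (by fun_prop) (by fun_prop)]
  rfl

/-- Cauchy–Schwarz in all three variables leaves the integral of `⟨x⟩^{-1} ⟨y⟩^{-β} ⟨z⟩^{-β}
⟨c+x+y+z⟩^{-(1-2η)}`. Integrating in `z`, `y`, `x` in turn leaves decay exponents `β - 2η - d/4`,
`d/4` and `0`, so the bound is uniform in `c`. -/
theorem exists_triInt_le (hβ : β ≤ 1) (hη : 0 ≤ η) (h : 2 * η < 2 * β - 1) :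
    ∃ C : ℝ≥0∞, C ≠ ∞ ∧ ∀ P Q R : ℝ → ℝ≥0∞, Measurable P → Measurable Q → Measurable R →
      ∀ c : ℝ, triInt (fun x => jap x ^ (-(1 / 2 - η))) P Q R c ^ 2 ≤
        C * (energy (1 / 2) P * (energy (β / 2) Q * energy (β / 2) R)) := by
  obtain ⟨d, hd⟩ : ∃ d, d = 2 * β - 1 - 2 * η := ⟨_, rfl⟩
  have hd0 : 0 < d := by linarith
  set C₁ : ℝ≥0∞ := 2 ^ (β - 2 * η - d / 4) *
    (4 * japInt (β + (1 - 2 * η) - (β - 2 * η - d / 4))) with hC₁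
  set C₂ : ℝ≥0∞ := 2 ^ (d / 4) * (4 * japInt (β + (β - 2 * η - d / 4) - d / 4)) with hC₂
  set C₃ : ℝ≥0∞ := 2 ^ (0 : ℝ) * (4 * japInt (1 + d / 4 - 0)) with hC₃
  have hfin : ∀ (x p : ℝ), 1 < p → (2 : ℝ≥0∞) ^ x * (4 * japInt p) ≠ ∞ := fun x p hp =>
    ENNReal.mul_ne_top (ENNReal.rpow_ne_top_of_ne_zero (by simp) (by simp))
      (ENNReal.mul_ne_top (by simp) (japInt_lt_top hp).ne)
  refine ⟨C₁ * (C₂ * C₃), ENNReal.mul_ne_top (hfin _ _ (by linarith))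
    (ENNReal.mul_ne_top (hfin _ _ (by linarith)) (hfin _ _ (by linarith))), ?_⟩
  intro P Q R hP hQ hR c
  have h1 : triInt (fun x => jap x ^ (-(1 / 2 - η))) P Q R c =
      ∫⁻ z : ℝ × ℝ × ℝ, ((jap z.1 ^ (1 / 2 : ℝ) * P z.1) * ((jap z.2.1 ^ (β / 2) * Q z.2.1) *
        (jap z.2.2 ^ (β / 2) * R z.2.2))) * (jap z.1 ^ (-(1 / 2 : ℝ)) *
        (jap z.2.1 ^ (-(β / 2)) * jap z.2.2 ^ (-(β / 2))) *
        jap (c + z.1 + z.2.1 + z.2.2) ^ (-(1 / 2 - η))) := by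
    rw [Measure.volume_eq_prod, lintegral_prod _ (by fun_prop)]
    refine lintegral_congr fun x => ?_
    rw [biInt_eq_lintegral_prod (by fun_prop) hQ hR, ← lintegral_const_mul _ (by fun_prop)]
    refine lintegral_congr fun z => ?_
    calc _ = ((jap x ^ (1 / 2 : ℝ) * jap x ^ (-(1 / 2 : ℝ))) *
            (jap z.1 ^ (β / 2) * jap z.1 ^ (-(β / 2))) *
            (jap z.2 ^ (β / 2) * jap z.2 ^ (-(β / 2)))) * (P x * (Q z.1 * R z.2) *
            jap (c + x + z.1 + z.2) ^ (-(1 / 2 - η))) := by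
          rw [← jap_rpow_add, ← jap_rpow_add, ← jap_rpow_add]
          simp [mul_assoc]
      _ = _ := by ring
  have hsq : ∀ (x e : ℝ), (jap x ^ e) ^ 2 = jap x ^ (2 * e) := fun x e => by
    rw [← ENNReal.rpow_mul_natCast, mul_comm]; norm_num
  rw [h1, mul_comm (C₁ * (C₂ * C₃))]
  refine (sq_lintegral_mul_le (by fun_prop) (by fun_prop)).trans ?_
  refine mul_le_mul' (le_of_eq ?_) ?_
  · simp_rw [mul_pow, hsq]
    rw [Measure.volume_eq_prod, lintegral_prod_mul (f := fun x => jap x ^ (2 * (1 / 2 : ℝ)) *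
      P x ^ 2) (g := fun z : ℝ × ℝ => (jap z.1 ^ (2 * (β / 2)) * Q z.1 ^ 2) *
        (jap z.2 ^ (2 * (β / 2)) * R z.2 ^ 2)) (by fun_prop) (by fun_prop),
      Measure.volume_eq_prod,
      lintegral_prod_mul (f := fun x => jap x ^ (2 * (β / 2)) * Q x ^ 2)
        (g := fun x => jap x ^ (2 * (β / 2)) * R x ^ 2) (by fun_prop) (by fun_prop)]
    rfl
  · simp_rw [mul_pow, hsq]
    rw [Measure.volume_eq_prod, lintegral_prod _ (by fun_prop)]
    have e1 : 2 * -(1 / 2 : ℝ) = -1 := by norm_num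
    have e2 : 2 * -(β / 2) = -β := by ring
    have e3 : 2 * -(1 / 2 - η) = -(1 - 2 * η) := by ring
    rw [e1, e2, e3]
    calc _ ≤ ∫⁻ x, jap x ^ (-1 : ℝ) * (C₁ * (C₂ * jap (c + x) ^ (-(d / 4)))) := by
          refine lintegral_mono fun x => ?_
          rw [Measure.volume_eq_prod, lintegral_prod _ (by fun_prop)]
          calc _ ≤ ∫⁻ y, jap x ^ (-1 : ℝ) * (C₁ * (jap y ^ (-β) *
                jap (c + x + y) ^ (-(β - 2 * η - d / 4)))) := by
                refine lintegral_mono fun y => ?_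
                simp only
                calc _ = ∫⁻ z, jap x ^ (-1 : ℝ) * jap y ^ (-β) * (jap z ^ (-β) *
                      jap (c + x + y + z) ^ (-(1 - 2 * η))) :=
                      lintegral_congr fun z => by ring
                  _ ≤ jap x ^ (-1 : ℝ) * jap y ^ (-β) *
                      (C₁ * jap (c + x + y) ^ (-(β - 2 * η - d / 4))) := by
                      rw [lintegral_const_mul _ (by fun_prop)]
                      gcongr
                      exact lintegral_jap_mul_jap_le hβ (by linarith) (by linarith)
                        (by linarith) _
                  _ = _ := by ring
            _ = jap x ^ (-1 : ℝ) * (C₁ * ∫⁻ y, (jap y ^ (-β) *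
                jap (c + x + y) ^ (-(β - 2 * η - d / 4)))) := by
                rw [lintegral_const_mul _ (by fun_prop), lintegral_const_mul _ (by fun_prop)]
            _ ≤ _ := by
                gcongr
                exact lintegral_jap_mul_jap_le hβ (by linarith) (by linarith) (by linarith) _
      _ = C₁ * (C₂ * ∫⁻ x, jap x ^ (-1 : ℝ) * jap (c + x) ^ (-(d / 4))) := by
          rw [← lintegral_const_mul _ (by fun_prop), ← lintegral_const_mul _ (by fun_prop)]
          refine lintegral_congr fun x => by ring
      _ ≤ C₁ * (C₂ * (C₃ * jap c ^ (-(0 : ℝ)))) := by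
          gcongr
          exact lintegral_jap_mul_jap_le le_rfl (by linarith) le_rfl (by linarith) _
      _ = _ := by simp

/-! ### Hölder's inequality for sums. -/

section sums
variable {ι : Type*}

theorem tsum_rpow_mul_rpow_le (f g : ι → ℝ≥0∞) {p q : ℝ} (hp : 0 ≤ p) (hq : 0 ≤ q)
    (hpq : p + q = 1) :
    ∑' i, f i ^ p * g i ^ q ≤ (∑' i, f i) ^ p * (∑' i, g i) ^ q := by
  let _ : MeasurableSpace ι := ⊤
  have := ENNReal.lintegral_mul_norm_pow_le (μ := Measure.count) (f := f) (g := g)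
    measurable_from_top.aemeasurable measurable_from_top.aemeasurable hp hq hpq
  simpa only [lintegral_count] using this

/-- The `ℓ^p` norm of an extended nonnegative function. -/
def lpNorm (p : ℝ) (f : ι → ℝ≥0∞) : ℝ≥0∞ := (∑' i, f i ^ p) ^ (1 / p)

theorem lpNorm_rpow {p : ℝ} (hp : 0 < p) (f : ι → ℝ≥0∞) : lpNorm p f ^ p = ∑' i, f i ^ p := by
  rw [lpNorm, ← ENNReal.rpow_mul, one_div, inv_mul_cancel₀ hp.ne', ENNReal.rpow_one]

theorem le_lpNorm {p : ℝ} (hp : 0 < p) (f : ι → ℝ≥0∞) (i : ι) : f i ≤ lpNorm p f := by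
  rw [← ENNReal.rpow_le_rpow_iff hp, lpNorm_rpow hp]
  exact ENNReal.le_tsum i

theorem tsum_mul_le_lpNorm_mul_lpNorm (f g : ι → ℝ≥0∞) {p q : ℝ} (hp : 0 < p) (hq : 0 < q)
    (hpq : 1 / p + 1 / q = 1) : ∑' i, f i * g i ≤ lpNorm p f * lpNorm q g := by
  have := tsum_rpow_mul_rpow_le (fun i => f i ^ p) (fun i => g i ^ q) (one_div_pos.mpr hp).le
    (one_div_pos.mpr hq).le hpq
  unfold lpNorm
  simpa only [← ENNReal.rpow_mul, mul_one_div_cancel hp.ne', mul_one_div_cancel hq.ne',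
    ENNReal.rpow_one] using this

end sums

/-! ### Frequency weights and their majorants. -/

/-- The majorant weight `⟨a⟩^{-1} + ⟨k - a⟩^{-1}`. -/
def twoWeight (k a : ℤ) : ℝ≥0∞ := jap a ^ (-1 : ℝ) + jap (k - a) ^ (-1 : ℝ)

theorem twoWeight_le_two (k a : ℤ) : twoWeight k a ≤ 2 := by
  rw [← one_add_one_eq_two]
  exact add_le_add (jap_rpow_le_one _ (by norm_num)) (jap_rpow_le_one _ (by norm_num))

theorem tsum_twoWeight_rpow_le {p : ℝ} (hp : 0 ≤ p) (k : ℤ) :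
    ∑' a, twoWeight k a ^ p ≤ 2 ^ p * (2 * japSum p) := by
  have h : ∀ a : ℤ, twoWeight k a ^ p ≤ 2 ^ p * (jap a ^ (-p) + jap ((k - a : ℤ) : ℝ) ^ (-p)) :=
    fun a => by
    refine (add_rpow_le_two_mul _ _ hp).trans_eq ?_
    rw [← ENNReal.rpow_mul, ← ENNReal.rpow_mul]
    push_cast
    simp
  refine (ENNReal.tsum_le_tsum h).trans_eq ?_
  rw [ENNReal.tsum_mul_left, ENNReal.tsum_add, two_mul, japSum]
  congr 2
  exact (Equiv.subLeft k).tsum_eq fun n : ℤ => jap n ^ (-p)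

/-- Hölder with exponents `1/(1-y)` and `1/y`: the weight is then raised to `x/(1-y) > 1` and is
summable uniformly in `k`. At `y = 1` the boundedness of the weight replaces this. -/
theorem exists_tsum_twoWeight_mul_le {x y : ℝ} (hx : 0 < x) (hy : 0 ≤ y) (hy1 : y ≤ 1)
    (hxy : 1 < x + y) :
    ∃ C : ℝ≥0∞, C ≠ ∞ ∧ ∀ (k : ℤ) (F : ℤ → ℝ≥0∞),
      ∑' a, twoWeight k a ^ x * F a ^ y ≤ C * (∑' a, F a) ^ y := by
  rcases hy1.eq_or_lt with rfl | hy1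
  · refine ⟨2 ^ x, ENNReal.rpow_ne_top_of_ne_zero (by simp) (by simp), fun k F => ?_⟩
    simp only [ENNReal.rpow_one]
    rw [← ENNReal.tsum_mul_left]
    gcongr
    exact twoWeight_le_two _ _
  · have h1 : 0 < 1 - y := by linarith
    have hp : 1 < x / (1 - y) := by rw [one_lt_div h1]; linarith
    refine ⟨(2 ^ (x / (1 - y)) * (2 * japSum (x / (1 - y)))) ^ (1 - y),
      ENNReal.rpow_ne_top_of_nonneg h1.le (ENNReal.mul_ne_top
        (ENNReal.rpow_ne_top_of_ne_zero (by simp) (by simp))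
        (ENNReal.mul_ne_top (by simp) (japSum_lt_top hp).ne)), fun k F => ?_⟩
    have := tsum_rpow_mul_rpow_le (fun a => twoWeight k a ^ (x / (1 - y))) F h1.le hy (by ring)
    simp only [← ENNReal.rpow_mul, div_mul_cancel₀ x h1.ne'] at this
    refine this.trans ?_
    gcongr
    exact tsum_twoWeight_rpow_le (by linarith) k

/-- The one-variable bound is used in `a`, uniformly in `b`, and then in `b`. Hence `B` may depend
on `b`, as needed for factors such as `f₃ (ξ - a - b)`. -/
theorem exists_tsum_twoWeight_prod_le {x y : ℝ} (hx : 0 < x) (hy : 0 ≤ y) (hy1 : y ≤ 1)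
    (hxy : 1 < x + y) :
    ∃ C : ℝ≥0∞, C ≠ ∞ ∧ ∀ (k : ℤ) (A : ℤ → ℝ≥0∞) (B : ℤ → ℤ → ℝ≥0∞) (M N : ℝ≥0∞),
      ∑' b, A b ≤ M → (∀ b, ∑' a, B b a ≤ N) →
      ∑' z : ℤ × ℤ, (8 * (twoWeight k z.1 * twoWeight k z.2)) ^ x * (A z.2 ^ y * B z.2 z.1 ^ y) ≤
        C * (M ^ y * N ^ y) := by
  obtain ⟨C, hC, h⟩ := exists_tsum_twoWeight_mul_le hx hy hy1 hxy
  refine ⟨8 ^ x * (C * C), ENNReal.mul_ne_top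
    (ENNReal.rpow_ne_top_of_ne_zero (by simp) (by simp)) (ENNReal.mul_ne_top hC hC), ?_⟩
  intro k A B M N hM hN
  have e : ∀ a b, (8 * (twoWeight k a * twoWeight k b)) ^ x * (A b ^ y * B b a ^ y) =
      8 ^ x * ((twoWeight k b ^ x * A b ^ y) * (twoWeight k a ^ x * B b a ^ y)) := fun a b => by
    rw [ENNReal.mul_rpow_of_nonneg _ _ hx.le, ENNReal.mul_rpow_of_nonneg _ _ hx.le]
    ring
  rw [ENNReal.tsum_prod', ENNReal.tsum_comm]
  calc _ = ∑' b, 8 ^ x * ((twoWeight k b ^ x * A b ^ y) * ∑' a, twoWeight k a ^ x * B b a ^ y) := by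
        simp_rw [e, ENNReal.tsum_mul_left]
    _ ≤ ∑' b, 8 ^ x * ((twoWeight k b ^ x * A b ^ y) * (C * N ^ y)) := by
        gcongr with b
        exact (h k _).trans (by gcongr; exact hN b)
    _ = 8 ^ x * ((∑' b, twoWeight k b ^ x * A b ^ y) * (C * N ^ y)) := by
        rw [ENNReal.tsum_mul_left, ENNReal.tsum_mul_right]
    _ ≤ 8 ^ x * ((C * M ^ y) * (C * N ^ y)) := by
        gcongr
        exact (h k _).trans (by gcongr)
    _ = _ := by ring

/-- The ratio `⟨ξ⟩⟨ξ-a-b⟩ / (⟨ξ-a⟩⟨ξ-b⟩)`. -/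
def freqRatio (ξ a b : ℤ) : ℝ :=
  bracket ξ * bracket (ξ - a - b) / (bracket (ξ - a) * bracket (ξ - b))

/-- The ratio of one plus `freqRatio` to the resonance `|ab|`; it vanishes when `ab = 0`. -/
def resWeight (ξ a b : ℤ) : ℝ≥0∞ :=
  ENNReal.ofReal ((1 + freqRatio ξ a b) / (|(a : ℝ)| * |(b : ℝ)|))

theorem freqRatio_nonneg (ξ a b : ℤ) : 0 ≤ freqRatio ξ a b := by
  have := fun x => (bracket_pos x).le
  exact div_nonneg (mul_nonneg (this _) (this _)) (mul_nonneg (this _) (this _))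

theorem freqRatio_swap (ξ a b : ℤ) : freqRatio ξ b a = freqRatio ξ a b := by
  unfold freqRatio
  rw [sub_right_comm, mul_comm (bracket (ξ - b))]

theorem resWeight_swap (ξ a b : ℤ) : resWeight ξ b a = resWeight ξ a b := by
  unfold resWeight
  rw [freqRatio_swap, mul_comm |(b : ℝ)|]

theorem resWeight_of_mul_eq_zero (ξ : ℤ) {a b : ℤ} (h : a * b = 0) : resWeight ξ a b = 0 := by
  rcases mul_eq_zero.mp h with rfl | rfl <;> simp [resWeight]

/-- Each bracket in the numerator is compared with one in the denominator across the same shift `a`.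
By symmetry `b` can serve instead, so the smaller of `|a|` and `|b|` may be used in both factors.
This is why the direct pairing of shifts and brackets in `freqRatio_le` and the crossed pairing in
`freqRatio_le'` both hold. -/
theorem freqRatio_le_left (ξ a b : ℤ) :
    freqRatio ξ a b ≤ (1 + |(a : ℝ)| / bracket (ξ - a)) * (1 + |(a : ℝ)| / bracket (ξ - b)) := by
  have h1 := bracket_pos (ξ - a : ℝ)
  have h2 := bracket_pos (ξ - b : ℝ)
  have e1 : bracket ξ ≤ bracket (ξ - a) + |(a : ℝ)| := by
    simpa using bracket_add_le (ξ - a) a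
  have e2 : bracket (ξ - a - b) ≤ bracket (ξ - b) + |(a : ℝ)| := by
    have := bracket_add_le (ξ - b) (-a)
    rw [abs_neg] at this
    convert this using 2
    ring
  have h3 := (bracket_pos (ξ - a - b : ℝ)).le
  have : (1 + |(a : ℝ)| / bracket (ξ - a)) * (1 + |(a : ℝ)| / bracket (ξ - b)) =
      (bracket (ξ - a) + |(a : ℝ)|) * (bracket (ξ - b) + |(a : ℝ)|) /
        (bracket (ξ - a) * bracket (ξ - b)) := by
    field_simp
  rw [this, freqRatio]
  gcongr

theorem freqRatio_le (ξ a b : ℤ) :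
    freqRatio ξ a b ≤ (1 + |(a : ℝ)| / bracket (ξ - a)) * (1 + |(b : ℝ)| / bracket (ξ - b)) := by
  have h1 := bracket_pos (ξ - a : ℝ)
  have h2 := bracket_pos (ξ - b : ℝ)
  rcases le_total |(a : ℝ)| |(b : ℝ)| with h | h
  · exact (freqRatio_le_left ξ a b).trans (by gcongr)
  · have := freqRatio_le_left ξ b a
    rw [freqRatio_swap] at this
    refine this.trans ?_
    rw [mul_comm]
    gcongr

theorem freqRatio_le' (ξ a b : ℤ) :
    freqRatio ξ a b ≤ (1 + |(b : ℝ)| / bracket (ξ - a)) * (1 + |(a : ℝ)| / bracket (ξ - b)) := by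
  have h1 := bracket_pos (ξ - a : ℝ)
  have h2 := bracket_pos (ξ - b : ℝ)
  rcases le_total |(a : ℝ)| |(b : ℝ)| with h | h
  · exact (freqRatio_le_left ξ a b).trans (by gcongr)
  · have := freqRatio_le_left ξ b a
    rw [freqRatio_swap] at this
    refine this.trans ?_
    rw [mul_comm]
    gcongr

theorem resWeight_le_aux {κ x y u v : ℝ} (hx : 0 < x) (hy : 0 < y) (hu : 0 < u) (hv : 0 < v)
    (h : κ ≤ (1 + x / u) * (1 + y / v)) :
    (1 + κ) / (x * y) ≤ 2 * ((1 / x + 1 / u) * (1 / y + 1 / v)) := by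
  have h1 : (1 : ℝ) ≤ (1 + x / u) * (1 + y / v) :=
    one_le_mul_of_one_le_of_one_le (by linarith [div_pos hx hu]) (by linarith [div_pos hy hv])
  calc (1 + κ) / (x * y) ≤ 2 * ((1 + x / u) * (1 + y / v)) / (x * y) := by gcongr; linarith
    _ = _ := by field_simp

theorem one_div_abs_le {a : ℤ} (ha : a ≠ 0) : 1 / |(a : ℝ)| ≤ 2 * (1 / bracket a) := by
  have h1 : (1 : ℝ) ≤ |(a : ℝ)| := by exact_mod_cast Int.one_le_abs ha
  have h2 := bracket_le_one_add_abs a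
  rw [← mul_div_assoc, div_le_div_iff₀ (by linarith) (bracket_pos _)]
  linarith

theorem ofReal_one_div_bracket (x : ℝ) : ENNReal.ofReal (1 / bracket x) = jap x ^ (-1 : ℝ) := by
  rw [jap_rpow_eq_ofReal, Real.rpow_neg_one, one_div]

theorem ofReal_weight_le {a : ℤ} (ha : a ≠ 0) (x : ℝ) :
    ENNReal.ofReal (1 / |(a : ℝ)| + 1 / bracket x) ≤
      2 * (jap a ^ (-1 : ℝ) + jap x ^ (-1 : ℝ)) := by
  have h := bracket_pos x
  have h' := bracket_pos (a : ℝ)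
  rw [← ofReal_one_div_bracket, ← ofReal_one_div_bracket,
    ← ENNReal.ofReal_add (by positivity) (by positivity), ← ENNReal.ofReal_ofNat 2,
    ← ENNReal.ofReal_mul (by norm_num)]
  refine ENNReal.ofReal_le_ofReal ?_
  have : 0 < 1 / bracket x := by positivity
  linarith [one_div_abs_le ha]

/-- For fixed `ξ`, the direct pairing attaches `ξ - a` to `a` and `ξ - b` to `b`, so the variables
separate. -/
theorem resWeight_le (ξ a b : ℤ) :
    resWeight ξ a b ≤ 8 * (twoWeight ξ a * twoWeight ξ b) := by
  by_cases h : a * b = 0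
  · rw [resWeight_of_mul_eq_zero ξ h]; exact zero_le
  obtain ⟨ha, hb⟩ := mul_ne_zero_iff.mp h
  have ha' : 0 < |(a : ℝ)| := abs_pos.mpr (by exact_mod_cast ha)
  have hb' : 0 < |(b : ℝ)| := abs_pos.mpr (by exact_mod_cast hb)
  have := bracket_pos (ξ - a : ℝ)
  calc resWeight ξ a b ≤ ENNReal.ofReal (2 * ((1 / |(a : ℝ)| + 1 / bracket (ξ - a)) *
        (1 / |(b : ℝ)| + 1 / bracket (ξ - b)))) :=
        ENNReal.ofReal_le_ofReal (resWeight_le_aux ha' hb' (bracket_pos _) (bracket_pos _)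
          (freqRatio_le ξ a b))
    _ = 2 * (ENNReal.ofReal (1 / |(a : ℝ)| + 1 / bracket (ξ - a)) *
        ENNReal.ofReal (1 / |(b : ℝ)| + 1 / bracket (ξ - b))) := by
        rw [ENNReal.ofReal_mul (by norm_num), ENNReal.ofReal_mul (by positivity)]
        simp
    _ ≤ 2 * ((2 * twoWeight ξ a) * (2 * twoWeight ξ b)) := by
        gcongr
        · exact ofReal_weight_le ha _
        · exact ofReal_weight_le hb _
    _ = _ := by ring

/-- With `ξ = c + a + b` one has `ξ - a = c + b` and `ξ - b = c + a`, so now the crossed pairing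
separates the variables, with centre `-c`. -/
theorem resWeight_le' (c a b : ℤ) :
    resWeight (c + a + b) a b ≤ 8 * (twoWeight (-c) a * twoWeight (-c) b) := by
  by_cases h : a * b = 0
  · rw [resWeight_of_mul_eq_zero _ h]; exact zero_le
  obtain ⟨ha, hb⟩ := mul_ne_zero_iff.mp h
  have ha' : 0 < |(a : ℝ)| := abs_pos.mpr (by exact_mod_cast ha)
  have hb' : 0 < |(b : ℝ)| := abs_pos.mpr (by exact_mod_cast hb)
  have e1 : bracket (((-c : ℤ) : ℝ) - a) = bracket (((c + a + b : ℤ) : ℝ) - b) := by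
    rw [← bracket_neg]; push_cast; congr 1; ring
  have e2 : bracket (((-c : ℤ) : ℝ) - b) = bracket (((c + a + b : ℤ) : ℝ) - a) := by
    rw [← bracket_neg]; push_cast; congr 1; ring
  have := bracket_pos (((c + a + b : ℤ) : ℝ) - b)
  calc resWeight (c + a + b) a b ≤ ENNReal.ofReal (2 *
        ((1 / |(a : ℝ)| + 1 / bracket (((c + a + b : ℤ) : ℝ) - b)) *
        (1 / |(b : ℝ)| + 1 / bracket (((c + a + b : ℤ) : ℝ) - a)))) :=
        ENNReal.ofReal_le_ofReal (resWeight_le_aux ha' hb' (bracket_pos _) (bracket_pos _)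
          ((freqRatio_le' _ a b).trans_eq (mul_comm _ _)))
    _ = 2 * (ENNReal.ofReal (1 / |(a : ℝ)| + 1 / bracket (((c + a + b : ℤ) : ℝ) - b)) *
        ENNReal.ofReal (1 / |(b : ℝ)| + 1 / bracket (((c + a + b : ℤ) : ℝ) - a))) := by
        rw [ENNReal.ofReal_mul (by norm_num), ENNReal.ofReal_mul (by positivity)]
        simp
    _ ≤ 2 * ((2 * twoWeight (-c) a) * (2 * twoWeight (-c) b)) := by
        rw [← e1, ← e2]
        gcongr
        · exact ofReal_weight_le ha _
        · exact ofReal_weight_le hb _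
    _ = _ := by ring

theorem weight_mul_bracket_le {x : ℤ} {d u : ℝ} (hx : x ≠ 0) (h1 : |d| ≤ 2 * |(x : ℝ)|)
    (h2 : |d| ≤ 2 * bracket u) : (1 / |(x : ℝ)| + 1 / bracket u) * bracket d ≤ 6 := by
  have hx1 : (1 : ℝ) ≤ |(x : ℝ)| := by exact_mod_cast Int.one_le_abs hx
  have hd := bracket_le_one_add_abs d
  have hu := one_le_bracket u
  have e1 : 1 / |(x : ℝ)| * bracket d ≤ 3 := by
    rw [one_div_mul_eq_div, div_le_iff₀ (by linarith)]; linarith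
  have e2 : 1 / bracket u * bracket d ≤ 3 := by
    rw [one_div_mul_eq_div, div_le_iff₀ (by linarith)]; linarith
  linarith

theorem weight_le_two {x : ℤ} {u : ℝ} (hx : x ≠ 0) : 1 / |(x : ℝ)| + 1 / bracket u ≤ 2 := by
  have hx1 : (1 : ℝ) ≤ |(x : ℝ)| := by exact_mod_cast Int.one_le_abs hx
  have e1 : 1 / |(x : ℝ)| ≤ 1 := div_le_one_of_le₀ hx1 (by linarith)
  have e2 : 1 / bracket u ≤ 1 := div_le_one_of_le₀ (one_le_bracket u) (bracket_pos u).le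
  linarith

/-- The direct bound times the crossed bound contains all four factors `1/|a| + 1/⟨ξ-a⟩`, and so on.
Both `|a-b| ≤ |a| + |b|` and `|a-b| ≤ ⟨ξ-a⟩ + ⟨ξ-b⟩` hold. Hence the factor joining the larger shift
with the larger bracket is at most `6/⟨a-b⟩`. The other three are at most `2`, and `192 = 4 · 6 ·
2³`. -/
theorem resWeight_sq_mul_jap_le (ξ a b : ℤ) :
    resWeight ξ a b ^ 2 * jap ((a - b : ℤ) : ℝ) ≤ 192 := by
  by_cases h : a * b = 0
  · rw [resWeight_of_mul_eq_zero _ h]; simp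
  obtain ⟨ha, hb⟩ := mul_ne_zero_iff.mp h
  have ha' : 0 < |(a : ℝ)| := abs_pos.mpr (by exact_mod_cast ha)
  have hb' : 0 < |(b : ℝ)| := abs_pos.mpr (by exact_mod_cast hb)
  have hu := bracket_pos (ξ - a : ℝ)
  have hv := bracket_pos (ξ - b : ℝ)
  have h1 := resWeight_le_aux ha' hb' hu hv (freqRatio_le ξ a b)
  have h2 := resWeight_le_aux hb' ha' hu hv (freqRatio_le' ξ a b)
  rw [mul_comm |(b : ℝ)| |(a : ℝ)|] at h2
  set d : ℝ := ((a - b : ℤ) : ℝ) with hd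
  have hd1 : |d| ≤ |(a : ℝ)| + |(b : ℝ)| := by rw [hd]; push_cast; exact abs_sub _ _
  have hd2 : |d| ≤ bracket (ξ - a) + bracket (ξ - b) := by
    have e : d = (ξ - b) - (ξ - a) := by rw [hd]; push_cast; ring
    rw [e]
    linarith [abs_sub ((ξ : ℝ) - b) (ξ - a), abs_le_bracket (ξ - a : ℝ),
      abs_le_bracket (ξ - b : ℝ)]
  have hpos : 0 ≤ (1 + freqRatio ξ a b) / (|(a : ℝ)| * |(b : ℝ)|) := by
    have := freqRatio_nonneg ξ a b; positivity
  have hprod : ∀ {p₁ p₂ p₃ p₄ m : ℝ}, 0 < p₁ → 0 < p₂ → 0 < p₃ → 0 < p₄ → 0 < m → p₂ ≤ 2 →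
      p₃ ≤ 2 → p₄ ≤ 2 → p₁ * m ≤ 6 → p₁ * p₂ * (p₃ * p₄) * m ≤ 48 := by
    intro p₁ p₂ p₃ p₄ m h₁ h₂ h₃ h₄ hm i₂ i₃ i₄ i
    calc p₁ * p₂ * (p₃ * p₄) * m = p₁ * m * p₂ * p₃ * p₄ := by ring
      _ ≤ 6 * 2 * 2 * 2 := by gcongr
      _ = 48 := by norm_num
  have hm := bracket_pos d
  have key : ((1 + freqRatio ξ a b) / (|(a : ℝ)| * |(b : ℝ)|)) ^ 2 * bracket d ≤ 192 := by
    have hau : 0 < 1 / |(a : ℝ)| + 1 / bracket (ξ - a) := by positivity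
    have hav : 0 < 1 / |(a : ℝ)| + 1 / bracket (ξ - b) := by positivity
    have hbu : 0 < 1 / |(b : ℝ)| + 1 / bracket (ξ - a) := by positivity
    have hbv : 0 < 1 / |(b : ℝ)| + 1 / bracket (ξ - b) := by positivity
    have key' : ((1 / |(a : ℝ)| + 1 / bracket (ξ - a)) * (1 / |(b : ℝ)| + 1 / bracket (ξ - b))) *
        ((1 / |(b : ℝ)| + 1 / bracket (ξ - a)) * (1 / |(a : ℝ)| + 1 / bracket (ξ - b))) *
        bracket d ≤ 48 := by
      rcases le_total |(a : ℝ)| |(b : ℝ)| with hab | hab <;>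
        rcases le_total (bracket (ξ - a)) (bracket (ξ - b)) with huv | huv
      · have := hprod hbv hau hbu hav hm (weight_le_two ha) (weight_le_two hb) (weight_le_two ha)
          (weight_mul_bracket_le hb (by linarith) (by linarith))
        linarith
      · have := hprod hbu hau hbv hav hm (weight_le_two ha) (weight_le_two hb) (weight_le_two ha)
          (weight_mul_bracket_le hb (by linarith) (by linarith))
        linarith
      · have := hprod hav hau hbu hbv hm (weight_le_two ha) (weight_le_two hb) (weight_le_two hb)
          (weight_mul_bracket_le ha (by linarith) (by linarith))
        linarith
      · have := hprod hau hav hbu hbv hm (weight_le_two ha) (weight_le_two hb) (weight_le_two hb)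
          (weight_mul_bracket_le ha (by linarith) (by linarith))
        linarith
    calc _ ≤ (2 * ((1 / |(a : ℝ)| + 1 / bracket (ξ - a)) *
          (1 / |(b : ℝ)| + 1 / bracket (ξ - b)))) *
          (2 * ((1 / |(b : ℝ)| + 1 / bracket (ξ - a)) *
          (1 / |(a : ℝ)| + 1 / bracket (ξ - b)))) * bracket d := by
          rw [pow_two]; gcongr
      _ = 4 * (((1 / |(a : ℝ)| + 1 / bracket (ξ - a)) *
          (1 / |(b : ℝ)| + 1 / bracket (ξ - b))) *
          ((1 / |(b : ℝ)| + 1 / bracket (ξ - a)) *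
          (1 / |(a : ℝ)| + 1 / bracket (ξ - b))) * bracket d) := by ring
      _ ≤ 192 := by linarith
  rw [resWeight, jap, ← ENNReal.ofReal_pow hpos, ← ENNReal.ofReal_mul (by positivity)]
  exact (ENNReal.ofReal_le_ofReal key).trans (by simp)

/-! ### Reindexing -/

theorem tsum_sub_fst_eq (f : ℤ → ℤ × ℤ → ℝ≥0∞) :
    ∑' ξ, ∑' z : ℤ × ℤ, f ξ z = ∑' k, ∑' z : ℤ × ℤ, f (k + z.1) z := by
  rw [ENNReal.tsum_comm, ENNReal.tsum_comm (f := fun k (z : ℤ × ℤ) => f (k + z.1) z)]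
  exact tsum_congr fun z => ((Equiv.addRight z.1).tsum_eq fun k => f k z).symm

theorem tsum_sub_both_eq (f : ℤ → ℤ × ℤ → ℝ≥0∞) :
    ∑' ξ, ∑' z : ℤ × ℤ, f ξ z = ∑' c, ∑' z : ℤ × ℤ, f (c + z.1 + z.2) z := by
  rw [ENNReal.tsum_comm, ENNReal.tsum_comm (f := fun k (z : ℤ × ℤ) => f (k + z.1 + z.2) z)]
  refine tsum_congr fun z => ?_
  rw [← (Equiv.addRight (z.1 + z.2)).tsum_eq fun k => f k z]
  simp [add_assoc]

theorem tsum_swap_pair (f : ℤ × ℤ → ℝ≥0∞) : ∑' z : ℤ × ℤ, f z = ∑' z : ℤ × ℤ, f (z.2, z.1) :=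
  ((Equiv.prodComm ℤ ℤ).tsum_eq f).symm

theorem tsum_comp_sub (f : ℤ → ℝ≥0∞) (k : ℤ) : ∑' a, f (k - a) = ∑' a, f a :=
  (Equiv.subLeft k).tsum_eq f

theorem tsum_comp_add (f : ℤ → ℝ≥0∞) (k : ℤ) : ∑' a, f (k + a) = ∑' a, f a :=
  (Equiv.addLeft k).tsum_eq f

/-! ### Weighted sums over resonance pairs -/

variable {x y : ℝ}

/-- Bound for fixed output frequency. -/
theorem exists_tsum_resWeight_le (hx : 0 < x) (hy : 0 ≤ y) (hy1 : y ≤ 1) (hxy : 1 < x + y) :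
    ∃ C : ℝ≥0∞, C ≠ ∞ ∧ ∀ (A : ℤ → ℝ≥0∞) (B : ℤ → ℤ → ℝ≥0∞) (M N : ℝ≥0∞),
      ∑' b, A b ≤ M → (∀ b, ∑' a, B b a ≤ N) → ∀ ξ : ℤ,
      ∑' z : ℤ × ℤ, resWeight ξ z.1 z.2 ^ x * (A z.2 ^ y * B z.2 z.1 ^ y) ≤
        C * (M ^ y * N ^ y) := by
  obtain ⟨C, hC, h⟩ := exists_tsum_twoWeight_prod_le hx hy hy1 hxy
  refine ⟨C, hC, fun A B M N hM hN ξ => le_trans ?_ (h ξ A B M N hM hN)⟩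
  gcongr
  exact resWeight_le _ _ _

/-- Bound for fixed conjugate input frequency. -/
theorem exists_tsum_resWeight_le' (hx : 0 < x) (hy : 0 ≤ y) (hy1 : y ≤ 1) (hxy : 1 < x + y) :
    ∃ C : ℝ≥0∞, C ≠ ∞ ∧ ∀ (A : ℤ → ℝ≥0∞) (B : ℤ → ℤ → ℝ≥0∞) (M N : ℝ≥0∞),
      ∑' a, A a ≤ M → (∀ a, ∑' b, B a b ≤ N) → ∀ c : ℤ,
      ∑' z : ℤ × ℤ, resWeight (c + z.1 + z.2) z.1 z.2 ^ x * (A z.1 ^ y * B z.1 z.2 ^ y) ≤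
        C * (M ^ y * N ^ y) := by
  obtain ⟨C, hC, h⟩ := exists_tsum_twoWeight_prod_le hx hy hy1 hxy
  refine ⟨C, hC, fun A B M N hM hN c => le_trans ?_ (h (-c) A B M N hM hN)⟩
  rw [tsum_swap_pair]
  gcongr with z
  rw [mul_comm (twoWeight _ _)]
  exact resWeight_le' _ _ _

theorem tsum_rpow_le_of_le {f g : ℤ → ℝ≥0∞} {p : ℝ} (hp : 0 < p) {C M : ℝ≥0∞}
    (h : ∀ i, f i ≤ g i ^ p * C) (hM : lpNorm p g ≤ M) : ∑' i, f i ≤ M ^ p * C := by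
  calc ∑' i, f i ≤ ∑' i, g i ^ p * C := ENNReal.tsum_le_tsum h
    _ = lpNorm p g ^ p * C := by rw [ENNReal.tsum_mul_right, lpNorm_rpow hp]
    _ ≤ _ := by gcongr

/-! ### Interpolated Schur bounds for the frequency sums. -/

/-- Hölder interpolation of a quadrilinear sum between the two Schur bounds. -/
theorem tsum_mul_rpow_interpolate {ι : Type*} (W f g : ι → ℝ≥0∞) {s t s₀ t₀ s₁ t₁ θ ϑ : ℝ}
    (hs₀ : 0 ≤ s₀) (ht₀ : 0 ≤ t₀) (hs₁ : 0 ≤ s₁) (ht₁ : 0 ≤ t₁)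
    (hθ : 0 ≤ θ) (hϑ : 0 ≤ ϑ) (h1 : θ + ϑ = 1) (hs : s₀ * θ + s₁ * ϑ = s)
    (ht : t₀ * θ + t₁ * ϑ = t) :
    ∑' i, W i * (f i ^ s * g i ^ t) ≤
      (∑' i, W i * (f i ^ s₀ * g i ^ t₀)) ^ θ * (∑' i, W i * (f i ^ s₁ * g i ^ t₁)) ^ ϑ := by
  refine le_of_eq_of_le (tsum_congr fun i => ?_) (tsum_rpow_mul_rpow_le _ _ hθ hϑ h1)
  rw [ENNReal.mul_rpow_of_nonneg _ _ hθ, ENNReal.mul_rpow_of_nonneg _ _ hθ,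
    ENNReal.mul_rpow_of_nonneg _ _ hϑ, ENNReal.mul_rpow_of_nonneg _ _ hϑ,
    ← ENNReal.rpow_mul, ← ENNReal.rpow_mul, ← ENNReal.rpow_mul, ← ENNReal.rpow_mul,
    ← hs, ← ht, ENNReal.rpow_add_of_nonneg _ _ (by positivity) (by positivity),
    ENNReal.rpow_add_of_nonneg _ _ (by positivity) (by positivity)]
  nth_rewrite 1 [← ENNReal.rpow_one (W i), ← h1, ENNReal.rpow_add_of_nonneg _ _ hθ hϑ]
  ring

theorem tsum_iterated {α β : Type*} (f : α → β → ℝ≥0∞) :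
    ∑' i, ∑' j, f i j = ∑' p : α × β, f p.1 p.2 := (ENNReal.tsum_prod (f := f)).symm

section
variable {q r : ℝ}

theorem lpNorm_conj_rpow {ι : Type*} {p s : ℝ} (hp : 0 < p) (f : ι → ℝ≥0∞) :
    (∑' i, f i ^ p) ^ (s / p) = lpNorm p f ^ s := by
  rw [lpNorm, ← ENNReal.rpow_mul]; congr 1; field_simp

/-- The Schur bound for the quadrilinear sum. -/
theorem exists_quadSum_le {q' r r' : ℝ} (hq' : 1 ≤ q') (hr : 0 < r) (hr' : 0 < r')
    (hrr : 1 / r + 1 / r' = 1) (hx : 0 < x) (hxy : 1 < x + 1 / q') :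
    ∃ C : ℝ≥0∞, C ≠ ∞ ∧ ∀ g f₁ f₂ f₃ : ℤ → ℝ≥0∞,
      ∑' ξ : ℤ, ∑' z : ℤ × ℤ, resWeight ξ z.1 z.2 ^ x *
        (g ξ * (f₁ (ξ - z.1) * f₂ (ξ - z.2) * f₃ (ξ - z.1 - z.2))) ≤
      C * (lpNorm r g * (lpNorm q' f₁ * lpNorm q' f₂ * lpNorm r' f₃)) := by
  have hq0 : 0 < q' := by linarith
  have hy : 0 ≤ 1 / q' := by positivity
  have hy1 : 1 / q' ≤ 1 := by rw [div_le_one hq0]; exact hq'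
  obtain ⟨C₁, hC₁, h₁⟩ := exists_tsum_resWeight_le hx hy hy1 hxy
  obtain ⟨C₂, hC₂, h₂⟩ := exists_tsum_resWeight_le' hx hy hy1 hxy
  have hir : 0 ≤ 1 / r := by positivity
  have hir' : 0 ≤ 1 / r' := by positivity
  refine ⟨C₁ ^ (1 / r) * C₂ ^ (1 / r'), ENNReal.mul_ne_top (ENNReal.rpow_ne_top_of_nonneg hir hC₁)
    (ENNReal.rpow_ne_top_of_nonneg hir' hC₂), fun g f₁ f₂ f₃ => ?_⟩
  have hroot : ∀ u : ℝ≥0∞, (u ^ q') ^ (1 / q') = u := fun u => by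
    rw [← ENNReal.rpow_mul, mul_one_div_cancel hq0.ne', ENNReal.rpow_one]
  set W : ℤ × (ℤ × ℤ) → ℝ≥0∞ := fun p => resWeight p.1 p.2.1 p.2.2 ^ x *
    (f₁ (p.1 - p.2.1) * f₂ (p.1 - p.2.2)) with hW
  -- The endpoints put `g^r` alone, summed with `ξ` fixed, and `f₃^{r'}` alone, summed with `ξ - a -
  -- b` fixed. In both sums `f₁` and `f₂` enter to the first power, as `1/q'`-th powers of `ℓ¹`
  -- sequences.
  have hmain := tsum_mul_rpow_interpolate W (fun p => g p.1) (fun p => f₃ (p.1 - p.2.1 - p.2.2))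
    (s := 1) (t := 1) (s₀ := r) (t₀ := 0) (s₁ := 0) (t₁ := r') hr.le le_rfl le_rfl hr'.le hir hir'
    hrr (by field_simp; ring) (by field_simp; ring)
  simp only [ENNReal.rpow_one, ENNReal.rpow_zero, mul_one, one_mul] at hmain
  have hleft : ∑' i, W i * g i.1 ^ r ≤
      lpNorm r g ^ r * (C₁ * (lpNorm q' f₁ * lpNorm q' f₂)) := by
    rw [← tsum_iterated fun ξ z => W (ξ, z) * g ξ ^ r]
    refine tsum_rpow_le_of_le hr (fun ξ => ?_) le_rfl
    rw [ENNReal.tsum_mul_right, mul_comm]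
    gcongr
    refine le_of_eq_of_le (tsum_congr fun z => ?_)
      ((h₁ (fun b => f₂ (ξ - b) ^ q') (fun _ a => f₁ (ξ - a) ^ q') (∑' b, f₂ b ^ q')
        (∑' a, f₁ a ^ q') (tsum_comp_sub (fun k => f₂ k ^ q') ξ).le
        (fun _ => (tsum_comp_sub (fun k => f₁ k ^ q') ξ).le) ξ).trans_eq ?_)
    · simp only [hW, hroot]; ring
    · rw [mul_comm (_ ^ _)]; rfl
  have hright : ∑' i, W i * f₃ (i.1 - i.2.1 - i.2.2) ^ r' ≤
      lpNorm r' f₃ ^ r' * (C₂ * (lpNorm q' f₁ * lpNorm q' f₂)) := by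
    rw [← tsum_iterated fun ξ z => W (ξ, z) * f₃ (ξ - z.1 - z.2) ^ r', tsum_sub_both_eq]
    refine tsum_rpow_le_of_le hr' (fun c => ?_) le_rfl
    have e : ∀ z : ℤ × ℤ, W (c + z.1 + z.2, z) * f₃ (c + z.1 + z.2 - z.1 - z.2) ^ r' =
        resWeight (c + z.1 + z.2) z.1 z.2 ^ x *
        ((f₂ (c + z.1) ^ q') ^ (1 / q') * (f₁ (c + z.2) ^ q') ^ (1 / q')) * f₃ c ^ r' := fun z => by
      simp only [hW, hroot]
      rw [show c + z.1 + z.2 - z.1 - z.2 = c by ring, show c + z.1 + z.2 - z.1 = c + z.2 by ring,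
        show c + z.1 + z.2 - z.2 = c + z.1 by ring]
      ring
    simp_rw [e]
    rw [ENNReal.tsum_mul_right, mul_comm]
    gcongr
    refine (h₂ (fun a => f₂ (c + a) ^ q') (fun _ b => f₁ (c + b) ^ q') (∑' b, f₂ b ^ q')
        (∑' a, f₁ a ^ q') (tsum_comp_add (fun k => f₂ k ^ q') c).le
        (fun _ => (tsum_comp_add (fun k => f₁ k ^ q') c).le) c).trans_eq ?_
    rw [mul_comm (_ ^ _)]; rfl
  calc _ = ∑' i, W i * (g i.1 * f₃ (i.1 - i.2.1 - i.2.2)) := by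
        rw [tsum_iterated]
        refine tsum_congr fun p => ?_
        simp only [hW]; ring
    _ ≤ _ := hmain
    _ ≤ (lpNorm r g ^ r * (C₁ * (lpNorm q' f₁ * lpNorm q' f₂))) ^ (1 / r) *
        (lpNorm r' f₃ ^ r' * (C₂ * (lpNorm q' f₁ * lpNorm q' f₂))) ^ (1 / r') := by gcongr
    _ = _ := by
        simp only [ENNReal.mul_rpow_of_nonneg _ _ hir, ENNReal.mul_rpow_of_nonneg _ _ hir',
          ← ENNReal.rpow_mul, mul_one_div_cancel hr.ne', mul_one_div_cancel hr'.ne',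
          ENNReal.rpow_one]
        have e : ∀ u : ℝ≥0∞, u = u ^ (1 / r) * u ^ (1 / r') := fun u => by
          rw [← ENNReal.rpow_add_of_nonneg _ _ hir hir', hrr, ENNReal.rpow_one]
        conv_rhs => rw [e (lpNorm q' f₁), e (lpNorm q' f₂)]
        ring

/-- The sum arising when an input of frequency `ξ - a` carries the large modulation. -/
theorem exists_localSum_le {q' r' : ℝ} (hq : 1 < q) (hq2 : q ≤ 2) (hqr : q ≤ r) (hr2 : r ≤ 2)
    (hqq : 1 / q + 1 / q' = 1) (hrr : 1 / r + 1 / r' = 1)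
    (hx : 0 < x) (hxy : 1 < x + (q - 1)) :
    ∃ C : ℝ≥0∞, C ≠ ∞ ∧ ∀ g f₂ f₃ : ℤ → ℝ≥0∞,
      ∑' ξ : ℤ, ∑' z : ℤ × ℤ, resWeight ξ z.1 z.2 ^ x *
        (g ξ * (f₂ (ξ - z.2) * f₃ (ξ - z.1 - z.2))) ^ q ≤
      C * (lpNorm r g * (lpNorm q' f₂ * lpNorm r' f₃)) ^ q := by
  have hq0 : 0 < q := by linarith
  have hr0 : 0 < r := by linarith
  have hq'e : q' = q / (q - 1) := by
    have hne : q' ≠ 0 := by rintro rfl; simp at hqq; linarith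
    have : q - 1 ≠ 0 := by linarith
    field_simp at hqq ⊢; linarith
  have hr'e : r' = r / (r - 1) := by
    have hne : r' ≠ 0 := by rintro rfl; simp at hrr; linarith
    have : r - 1 ≠ 0 := by linarith
    field_simp at hrr ⊢; linarith
  have hq1 : 0 < q - 1 := by linarith
  have hr1 : 0 < r - 1 := by linarith
  have hq'0 : 0 < q' := by rw [hq'e]; positivity
  have hr'0 : 0 < r' := by rw [hr'e]; positivity
  obtain ⟨C₁, hC₁, h₁⟩ := exists_tsum_resWeight_le hx hq1.le (by linarith) hxy
  obtain ⟨C₂, hC₂, h₂⟩ := exists_tsum_resWeight_le' hx hq1.le (by linarith) hxy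
  -- The target `g^q f₃^q` lies between the endpoints `g^r f₃^{r'(q-1)}` and `g^{r(q-1)} f₃^{r'}`,
  -- where each factor raised to `q-1` is a power of an `ℓ¹` sequence. For `q = 2` also `r = 2`; the
  -- endpoints coincide and the general formula would divide by zero.
  obtain ⟨θ, ϑ, hθ, hϑ, hsum, hsg, hsf⟩ : ∃ θ ϑ : ℝ, 0 ≤ θ ∧ 0 ≤ ϑ ∧ θ + ϑ = 1 ∧
      r * θ + r * (q - 1) * ϑ = q ∧ r' * (q - 1) * θ + r' * ϑ = q := by
    rcases hq2.eq_or_lt with rfl | hq2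
    · obtain rfl : r = 2 := le_antisymm hr2 hqr
      refine ⟨1, 0, by norm_num, le_rfl, by norm_num, by norm_num, ?_⟩
      rw [hr'e]; norm_num
    · have h2q : 0 < 2 - q := by linarith
      refine ⟨(q - r * (q - 1)) / (r * (2 - q)), (r - q) / (r * (2 - q)), ?_, ?_, ?_, ?_, ?_⟩
      · refine div_nonneg ?_ (by positivity)
        nlinarith
      · exact div_nonneg (by linarith) (by positivity)
      · field_simp; ring
      · field_simp; ring
      · rw [hr'e]; field_simp; ring
  refine ⟨C₁ ^ θ * C₂ ^ ϑ, ENNReal.mul_ne_top (ENNReal.rpow_ne_top_of_nonneg hθ hC₁)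
    (ENNReal.rpow_ne_top_of_nonneg hϑ hC₂), fun g f₂ f₃ => ?_⟩
  have hroot : ∀ u : ℝ≥0∞, (u ^ q') ^ (q - 1) = u ^ q := fun u => by
    rw [← ENNReal.rpow_mul, hq'e, div_mul_cancel₀ _ hq1.ne']
  have hnorm : ∀ (p : ℝ), 0 < p → ∀ u : ℤ → ℝ≥0∞, ∀ s : ℝ,
      (∑' i, u i ^ p) ^ s = lpNorm p u ^ (p * s) := fun p hp u s => by
    rw [ENNReal.rpow_mul, lpNorm_rpow hp]
  set W : ℤ × (ℤ × ℤ) → ℝ≥0∞ := fun p => resWeight p.1 p.2.1 p.2.2 ^ x *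
    f₂ (p.1 - p.2.2) ^ q with hW
  have hmain := tsum_mul_rpow_interpolate W (fun p => g p.1) (fun p => f₃ (p.1 - p.2.1 - p.2.2))
    (s := q) (t := q) (s₀ := r) (t₀ := r' * (q - 1)) (s₁ := r * (q - 1)) (t₁ := r')
    hr0.le (by positivity) (by positivity) hr'0.le hθ hϑ hsum hsg hsf
  have hleft : ∑' i, W i * (g i.1 ^ r * f₃ (i.1 - i.2.1 - i.2.2) ^ (r' * (q - 1))) ≤
      lpNorm r g ^ r * (C₁ * (lpNorm q' f₂ ^ q * lpNorm r' f₃ ^ (r' * (q - 1)))) := by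
    rw [← tsum_iterated fun ξ z => W (ξ, z) * (g ξ ^ r * f₃ (ξ - z.1 - z.2) ^ (r' * (q - 1)))]
    refine tsum_rpow_le_of_le hr0 (fun ξ => ?_) le_rfl
    have e : ∀ z : ℤ × ℤ, W (ξ, z) * (g ξ ^ r * f₃ (ξ - z.1 - z.2) ^ (r' * (q - 1))) =
        g ξ ^ r * (resWeight ξ z.1 z.2 ^ x * ((f₂ (ξ - z.2) ^ q') ^ (q - 1) *
          (f₃ (ξ - z.1 - z.2) ^ r') ^ (q - 1))) := fun z => by
      simp only [hW, hroot]
      rw [← ENNReal.rpow_mul]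
      ring
    simp_rw [e]
    rw [ENNReal.tsum_mul_left]
    gcongr
    refine (h₁ (fun b => f₂ (ξ - b) ^ q') (fun b a => f₃ (ξ - a - b) ^ r') (∑' b, f₂ b ^ q')
        (∑' a, f₃ a ^ r') (tsum_comp_sub (fun k => f₂ k ^ q') ξ).le (fun b => ?_) ξ).trans_eq ?_
    · simp_rw [sub_right_comm ξ _ b]
      exact (tsum_comp_sub (fun k => f₃ k ^ r') (ξ - b)).le
    · rw [hnorm _ hq'0, hnorm _ hr'0, hq'e, div_mul_cancel₀ _ hq1.ne']
  have hright : ∑' i, W i * (g i.1 ^ (r * (q - 1)) * f₃ (i.1 - i.2.1 - i.2.2) ^ r') ≤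
      lpNorm r' f₃ ^ r' * (C₂ * (lpNorm q' f₂ ^ q * lpNorm r g ^ (r * (q - 1)))) := by
    rw [← tsum_iterated fun ξ z => W (ξ, z) * (g ξ ^ (r * (q - 1)) * f₃ (ξ - z.1 - z.2) ^ r'),
      tsum_sub_both_eq]
    refine tsum_rpow_le_of_le hr'0 (fun c => ?_) le_rfl
    have e : ∀ z : ℤ × ℤ, W (c + z.1 + z.2, z) * (g (c + z.1 + z.2) ^ (r * (q - 1)) *
        f₃ (c + z.1 + z.2 - z.1 - z.2) ^ r') = f₃ c ^ r' * (resWeight (c + z.1 + z.2) z.1 z.2 ^ x *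
        ((f₂ (c + z.1) ^ q') ^ (q - 1) * (g (c + z.1 + z.2) ^ r) ^ (q - 1))) := fun z => by
      simp only [hW, hroot]
      rw [show c + z.1 + z.2 - z.1 - z.2 = c by ring,
        show c + z.1 + z.2 - z.2 = c + z.1 by ring, ← ENNReal.rpow_mul]
      ring
    simp_rw [e]
    rw [ENNReal.tsum_mul_left]
    gcongr
    refine (h₂ (fun a => f₂ (c + a) ^ q') (fun a b => g (c + a + b) ^ r) (∑' b, f₂ b ^ q')
        (∑' a, g a ^ r) (tsum_comp_add (fun k => f₂ k ^ q') c).le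
        (fun a => (tsum_comp_add (fun k => g k ^ r) (c + a)).le) c).trans_eq ?_
    rw [hnorm _ hq'0, hnorm _ hr0, hq'e, div_mul_cancel₀ _ hq1.ne']
  calc _ = ∑' i, W i * (g i.1 ^ q * f₃ (i.1 - i.2.1 - i.2.2) ^ q) := by
        rw [tsum_iterated]
        refine tsum_congr fun p => ?_
        simp only [hW, ENNReal.mul_rpow_of_nonneg _ _ hq0.le]; ring
    _ ≤ _ := hmain
    _ ≤ (lpNorm r g ^ r * (C₁ * (lpNorm q' f₂ ^ q * lpNorm r' f₃ ^ (r' * (q - 1))))) ^ θ *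
        (lpNorm r' f₃ ^ r' * (C₂ * (lpNorm q' f₂ ^ q * lpNorm r g ^ (r * (q - 1))))) ^ ϑ := by
        gcongr
    _ = (C₁ ^ θ * C₂ ^ ϑ) * ((lpNorm r g ^ (r * θ) * lpNorm r g ^ (r * (q - 1) * ϑ)) *
        ((lpNorm q' f₂ ^ (q * θ) * lpNorm q' f₂ ^ (q * ϑ)) *
          (lpNorm r' f₃ ^ (r' * (q - 1) * θ) * lpNorm r' f₃ ^ (r' * ϑ)))) := by
        simp only [ENNReal.mul_rpow_of_nonneg _ _ hθ, ENNReal.mul_rpow_of_nonneg _ _ hϑ,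
          ← ENNReal.rpow_mul]
        ring
    _ = _ := by
        rw [← ENNReal.rpow_add_of_nonneg _ _ (by positivity) (by positivity),
          ← ENNReal.rpow_add_of_nonneg _ _ (by positivity) (by positivity),
          ← ENNReal.rpow_add_of_nonneg _ _ (by positivity) (by positivity), hsg, hsf,
          ← mul_add, hsum, mul_one, ENNReal.mul_rpow_of_nonneg _ _ hq0.le,
          ENNReal.mul_rpow_of_nonneg _ _ hq0.le]

/-- The sum arising when the conjugated input carries the large modulation. -/
theorem exists_localSum_le' {q' : ℝ} (hr : 0 < r) (hq' : 0 < q') (hrq : r ≤ q')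
    (hx : 0 < x) (hxy : 1 < x + r / q') :
    ∃ C : ℝ≥0∞, C ≠ ∞ ∧ ∀ g f₁ f₂ : ℤ → ℝ≥0∞,
      ∑' ξ : ℤ, ∑' z : ℤ × ℤ, resWeight ξ z.1 z.2 ^ x *
        (g ξ * (f₁ (ξ - z.1) * f₂ (ξ - z.2))) ^ r ≤
      C * (lpNorm r g * (lpNorm q' f₁ * lpNorm q' f₂)) ^ r := by
  obtain ⟨C, hC, h⟩ := exists_tsum_resWeight_le hx (by positivity) (div_le_one_of_le₀ hrq hq'.le)
    hxy
  refine ⟨C, hC, fun g f₁ f₂ => ?_⟩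
  have hroot : ∀ u : ℝ≥0∞, (u ^ q') ^ (r / q') = u ^ r := fun u => by
    rw [← ENNReal.rpow_mul, mul_div_cancel₀ _ hq'.ne']
  calc _ ≤ lpNorm r g ^ r * (C * (lpNorm q' f₂ ^ r * lpNorm q' f₁ ^ r)) := by
        refine tsum_rpow_le_of_le hr (fun ξ => ?_) le_rfl
        have e : ∀ z : ℤ × ℤ, resWeight ξ z.1 z.2 ^ x *
            (g ξ * (f₁ (ξ - z.1) * f₂ (ξ - z.2))) ^ r = g ξ ^ r * (resWeight ξ z.1 z.2 ^ x *
            ((f₂ (ξ - z.2) ^ q') ^ (r / q') * (f₁ (ξ - z.1) ^ q') ^ (r / q'))) := fun z => by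
          rw [hroot, hroot, ENNReal.mul_rpow_of_nonneg _ _ hr.le,
            ENNReal.mul_rpow_of_nonneg _ _ hr.le]
          ring
        simp_rw [e]
        rw [ENNReal.tsum_mul_left, ← lpNorm_conj_rpow hq', ← lpNorm_conj_rpow hq']
        gcongr
        exact h (fun b => f₂ (ξ - b) ^ q') (fun _ a => f₁ (ξ - a) ^ q') _ _
          (tsum_comp_sub (fun k => f₂ k ^ q') ξ).le
          (fun _ => (tsum_comp_sub (fun k => f₁ k ^ q') ξ).le) ξ
    _ = _ := by
        rw [ENNReal.mul_rpow_of_nonneg _ _ hr.le, ENNReal.mul_rpow_of_nonneg _ _ hr.le]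
        ring

end

/-! ### Almost orthogonality of the resonant translates. -/

theorem rpow_half_sq (x : ℝ≥0∞) : (x ^ 2) ^ (1 / 2 : ℝ) = x := by
  rw [← ENNReal.rpow_natCast, ← ENNReal.rpow_mul]; norm_num

theorem sq_rpow_half (x : ℝ≥0∞) : (x ^ (1 / 2 : ℝ)) ^ 2 = x := by
  rw [← ENNReal.rpow_natCast, ← ENNReal.rpow_mul]; norm_num

theorem le_rpow_half_of_sq_le {x y : ℝ≥0∞} (h : x ^ 2 ≤ y) : x ≤ y ^ (1 / 2 : ℝ) := by
  rw [← rpow_half_sq x]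
  exact ENNReal.rpow_le_rpow h (by norm_num)

theorem lintegral_mul_le_rpow_half {α : Type*} [MeasurableSpace α] {μ : Measure α}
    {f g : α → ℝ≥0∞} (hf : AEMeasurable f μ) (hg : AEMeasurable g μ) :
    ∫⁻ a, f a * g a ∂μ ≤
      (∫⁻ a, f a ^ 2 ∂μ) ^ (1 / 2 : ℝ) * (∫⁻ a, g a ^ 2 ∂μ) ^ (1 / 2 : ℝ) := by
  rw [← ENNReal.mul_rpow_of_nonneg _ _ (by norm_num)]
  exact le_rpow_half_of_sq_le (sq_lintegral_mul_le hf hg)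

/-- The cutoff to `⟨s⟩ ≤ ℓ⁻¹`. -/
def cutoff (ℓ : ℝ≥0∞) (s : ℝ) : ℝ≥0∞ := if jap s * ℓ ≤ 1 then 1 else 0

@[fun_prop]
theorem measurable_cutoff (ℓ : ℝ≥0∞) : Measurable (cutoff ℓ) :=
  Measurable.ite (measurableSet_le (by fun_prop) measurable_const) measurable_const
    measurable_const

/-- Where `⟨n+σ⟩ ℓ > 1`, the factor `(⟨n+σ⟩ ℓ)^η ≥ 1` may be inserted for free, and Cauchy–Schwarz
with a translation then applies. The complementary region is kept as it stands. -/
theorem lintegral_mul_le_add_cutoff {η : ℝ} (hη : 0 ≤ η) (ℓ : ℝ≥0∞) {G H : ℝ → ℝ≥0∞}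
    (hG : Measurable G) (hH : Measurable H) (n : ℝ) :
    ∫⁻ σ, G σ * H (n + σ) ≤
      ℓ ^ η * ((∫⁻ σ, G σ ^ 2) ^ (1 / 2 : ℝ) *
        (∫⁻ s, jap s ^ (2 * η) * H s ^ 2) ^ (1 / 2 : ℝ)) +
      ∫⁻ σ, G σ * H (n + σ) * cutoff ℓ (n + σ) := by
  have h1 : ∀ σ, G σ * H (n + σ) ≤ ℓ ^ η * (G σ * (jap (n + σ) ^ η * H (n + σ))) +
      G σ * H (n + σ) * cutoff ℓ (n + σ) := by
    intro σ
    by_cases h : jap (n + σ) * ℓ ≤ 1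
    · refine le_add_left ?_
      rw [cutoff, if_pos h, mul_one]
    · refine le_add_right ?_
      calc G σ * H (n + σ) ≤ (jap (n + σ) * ℓ) ^ η * (G σ * H (n + σ)) := by
            refine le_mul_of_one_le_left (zero_le) ?_
            simpa using ENNReal.rpow_le_rpow (not_le.mp h).le hη
        _ = _ := by rw [ENNReal.mul_rpow_of_nonneg _ _ hη]; ring
  refine (lintegral_mono h1).trans ?_
  rw [lintegral_add_left (by fun_prop), lintegral_const_mul _ (by fun_prop)]
  gcongr
  refine (lintegral_mul_le_rpow_half (by fun_prop) (by fun_prop)).trans_eq ?_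
  congr 2
  rw [lintegral_add_left_eq_self (fun s => (jap s ^ η * H s) ^ 2) n]
  refine lintegral_congr fun s => ?_
  rw [mul_pow, ← ENNReal.rpow_mul_natCast, mul_comm η]
  norm_num

/-- Almost orthogonality of the resonant translates for one fixed input function. -/
theorem exists_tsum_cutoff_le {ρ η γ : ℝ} (hρ : 1 < ρ) (hρ2 : ρ ≤ 2) (hγ : 0 < γ)
    (h : 1 - 1 / ρ < γ + η) :
    ∃ C : ℝ≥0∞, C ≠ ∞ ∧ ∀ (ℓ : ℤ × ℤ → ℝ≥0∞), (∀ z, z.1 * z.2 = 0 → ℓ z = 0) →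
      (∀ z, ℓ z ^ 2 * jap ((z.1 - z.2 : ℤ) : ℝ) ≤ 192) →
      ∀ (G : ℝ → ℝ≥0∞) (H : ℤ × ℤ → ℝ → ℝ≥0∞) (d : ℤ × ℤ → ℝ≥0∞), Measurable G →
      (∀ z, Measurable (H z)) →
      ∑' z : ℤ × ℤ, ℓ z ^ γ * d z *
        ∫⁻ σ, G σ * H z (2 * (z.1 * z.2 : ℤ) + σ) * cutoff (ℓ z) (2 * (z.1 * z.2 : ℤ) + σ) ≤
      C * ((∫⁻ σ, G σ ^ 2) ^ (1 / 2 : ℝ) *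
        lpNorm ρ fun z => d z * (∫⁻ s, jap s ^ (2 * η) * H z s ^ 2) ^ (1 / 2 : ℝ)) := by
  set θ : ℝ := 1 - 1 / ρ with hθ
  have hρ0 : 0 < ρ := by linarith
  have hi1 : 1 / ρ < 1 := by rw [div_lt_one hρ0]; exact hρ
  have hi2 : 1 / 2 ≤ 1 / ρ := one_div_le_one_div_of_le hρ0 hρ2
  have hθ0 : 0 < θ := by rw [hθ]; linarith
  have hθ2 : 0 ≤ 1 - 2 * θ := by rw [hθ]; linarith
  -- `ℓ^γ` is divided in two. On the support of the cutoff, `ℓ^{γ'}` becomes decay in the translated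
  -- variable, bringing its exponent above `θ`. The remaining `ℓ^{γ-γ'}` becomes a negative power of
  -- `⟨a-b⟩`. After raising to the power `1/θ`, both hypotheses of the hyperbola bound hold.
  obtain ⟨γ', hγ'0, hγ'1, hγ'2⟩ : ∃ γ' : ℝ, 0 ≤ γ' ∧ θ < γ' + η ∧ γ' < γ :=
    ⟨max 0 ((θ - η + γ) / 2), le_max_left _ _,
      by linarith [le_max_right 0 ((θ - η + γ) / 2)], max_lt hγ (by linarith)⟩
  obtain ⟨C, hC, hsum⟩ := exists_tsum_jap_hyperbola_le (p := (γ' + η) / θ)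
    (ε := (γ - γ') / 2 / θ) (by rw [lt_div_iff₀ hθ0]; linarith)
    (div_pos (by linarith) hθ0)
  set D : ℝ≥0∞ := 192 ^ ((γ - γ') / 2 / θ) with hD
  have hDtop : D ≠ ∞ := ENNReal.rpow_ne_top_of_nonneg (div_pos (by linarith) hθ0).le (by simp)
  refine ⟨(D * C) ^ θ, ENNReal.rpow_ne_top_of_nonneg hθ0.le (ENNReal.mul_ne_top hDtop hC),
    fun ℓ hℓ0 hℓ G H d hG hH => ?_⟩
  set s : ℤ × ℤ → ℝ → ℝ := fun z σ => 2 * (z.1 * z.2 : ℤ) + σ with hs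
  set T : ℤ × ℤ → ℝ → ℝ≥0∞ := fun z σ => ℓ z ^ γ * (jap (s z σ) ^ (-η) * cutoff (ℓ z) (s z σ))
    with hT
  have hsm : ∀ z, Measurable (s z) := fun z => by simp only [hs]; fun_prop
  have hTm : ∀ z, Measurable (T z) := fun z => by simp only [hT]; fun_prop
  have hTle : ∀ σ z, T z σ ^ (1 / θ) ≤ D * (if z.1 * z.2 = 0 then 0 else
      jap (σ + 2 * (z.1 * z.2 : ℤ)) ^ (-((γ' + η) / θ)) *
        jap ((z.1 - z.2 : ℤ) : ℝ) ^ (-((γ - γ') / 2 / θ))) := by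
    intro σ z
    by_cases hz : z.1 * z.2 = 0
    · simp only [hT, hℓ0 z hz, ENNReal.zero_rpow_of_pos hγ, zero_mul]
      rw [ENNReal.zero_rpow_of_pos (by positivity)]
      exact zero_le
    rw [if_neg hz]
    by_cases hc : jap (s z σ) * ℓ z ≤ 1
    swap
    · simp only [hT, cutoff, if_neg hc, mul_zero]
      rw [ENNReal.zero_rpow_of_pos (by positivity)]
      exact zero_le
    have h1 : ℓ z ^ γ' ≤ jap (s z σ) ^ (-γ') := by
      have h2 : ℓ z ≤ (jap (s z σ))⁻¹ := by
        rw [ENNReal.le_inv_iff_mul_le, mul_comm]; exact hc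
      calc _ ≤ ((jap (s z σ))⁻¹) ^ γ' := ENNReal.rpow_le_rpow h2 hγ'0
        _ = _ := by rw [ENNReal.inv_rpow, ENNReal.rpow_neg]
    have h3 : ℓ z ^ (γ - γ') ≤ 192 ^ ((γ - γ') / 2) *
        jap ((z.1 - z.2 : ℤ) : ℝ) ^ (-((γ - γ') / 2)) := by
      have h4 : ℓ z ^ 2 ≤ 192 * (jap ((z.1 - z.2 : ℤ) : ℝ))⁻¹ := by
        rw [← div_eq_mul_inv, ENNReal.le_div_iff_mul_le (Or.inl (jap_ne_zero _))
          (Or.inl (jap_ne_top _))]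
        exact hℓ z
      have h5 := ENNReal.rpow_le_rpow h4 (show 0 ≤ (γ - γ') / 2 by linarith)
      rw [ENNReal.mul_rpow_of_nonneg _ _ (show 0 ≤ (γ - γ') / 2 by linarith), ENNReal.inv_rpow,
        ← ENNReal.rpow_neg, ← ENNReal.rpow_natCast_mul] at h5
      refine le_of_eq_of_le ?_ h5
      congr 1
      push_cast
      ring
    have h6 : T z σ ≤ 192 ^ ((γ - γ') / 2) * (jap (s z σ) ^ (-(γ' + η)) *
        jap ((z.1 - z.2 : ℤ) : ℝ) ^ (-((γ - γ') / 2))) := by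
      simp only [hT, cutoff, if_pos hc, mul_one]
      have h7 : ℓ z ^ γ = ℓ z ^ γ' * ℓ z ^ (γ - γ') := by
        rw [← ENNReal.rpow_add_of_nonneg _ _ hγ'0 (by linarith)]; congr 1; ring
      rw [h7, neg_add, jap_rpow_add]
      calc _ ≤ (jap (s z σ) ^ (-γ') * (192 ^ ((γ - γ') / 2) *
            jap ((z.1 - z.2 : ℤ) : ℝ) ^ (-((γ - γ') / 2)))) * jap (s z σ) ^ (-η) := by gcongr
        _ = _ := by ring
    have hθi : 0 ≤ 1 / θ := by positivity
    refine (ENNReal.rpow_le_rpow h6 hθi).trans_eq ?_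
    rw [ENNReal.mul_rpow_of_nonneg _ _ hθi, ENNReal.mul_rpow_of_nonneg _ _ hθi,
      ← ENNReal.rpow_mul, ← ENNReal.rpow_mul, ← ENNReal.rpow_mul, hD]
    simp only [hs, neg_div, mul_one_div]
    rw [add_comm σ]
  set E : ℝ≥0∞ := ∫⁻ σ, G σ ^ 2 with hE
  set X : ℤ × ℤ → ℝ≥0∞ := fun z => ∫⁻ σ, T z σ ^ (1 / θ) * G σ ^ 2 with hX
  -- The almost orthogonality itself: for each `σ` the weights `T z σ ^ (1/θ)` have a bounded sum
  -- over `z`, so all translates together cost only one copy of `‖G‖²`.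
  have hXsum : ∑' z, X z ≤ D * C * E := by
    simp only [hX]
    rw [← lintegral_tsum fun z => by fun_prop, hE, ← lintegral_const_mul _ (by fun_prop)]
    refine lintegral_mono fun σ => ?_
    simp only
    rw [ENNReal.tsum_mul_right]
    gcongr
    refine (ENNReal.tsum_le_tsum (hTle σ)).trans ?_
    rw [ENNReal.tsum_mul_left]
    gcongr
    exact hsum σ
  set m : ℤ × ℤ → ℝ≥0∞ := fun z =>
    d z * (∫⁻ s, jap s ^ (2 * η) * H z s ^ 2) ^ (1 / 2 : ℝ) with hm
  have hterm : ∀ z, ℓ z ^ γ * d z * (∫⁻ σ, G σ * H z (2 * (z.1 * z.2 : ℤ) + σ) *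
      cutoff (ℓ z) (2 * (z.1 * z.2 : ℤ) + σ)) ≤ E ^ (1 / 2 - θ) * ((m z ^ ρ) ^ (1 / ρ) *
        X z ^ θ) := by
    intro z
    have hHm := hH z
    have e1 : ℓ z ^ γ * d z * (∫⁻ σ, G σ * H z (2 * (z.1 * z.2 : ℤ) + σ) *
      cutoff (ℓ z) (2 * (z.1 * z.2 : ℤ) + σ)) =
        d z * ∫⁻ σ, (T z σ * G σ) * (jap (s z σ) ^ η * H z (s z σ)) := by
      rw [mul_comm (ℓ z ^ γ), mul_assoc, ← lintegral_const_mul _ (by fun_prop)]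
      congr 1
      refine lintegral_congr fun σ => ?_
      have : jap (s z σ) ^ (-η) * jap (s z σ) ^ η = 1 := by rw [← jap_rpow_add]; simp
      calc _ = ℓ z ^ γ * (G σ * H z (s z σ) * cutoff (ℓ z) (s z σ)) *
            (jap (s z σ) ^ (-η) * jap (s z σ) ^ η) := by rw [this, mul_one]
        _ = _ := by simp only [hT]; ring
    have e2 : ∫⁻ σ, (jap (s z σ) ^ η * H z (s z σ)) ^ 2 =
        ∫⁻ s, jap s ^ (2 * η) * H z s ^ 2 := by
      simp only [hs]
      rw [lintegral_add_left_eq_self (fun s => (jap s ^ η * H z s) ^ 2)]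
      refine lintegral_congr fun s => ?_
      rw [mul_pow, ← ENNReal.rpow_mul_natCast, mul_comm η]
      norm_num
    -- Hölder between the measures `T^{1/θ} G²` and `G²`; it needs `2θ ≤ 1`, that is `ρ ≤ 2`. Since
    -- `θ = 1 - 1/ρ`, the factor `X z ^ θ` pairs with the `ℓ^ρ` sequence `m` in the final Hölder
    -- inequality.
    have e3 : ∫⁻ σ, (T z σ * G σ) ^ 2 ≤ X z ^ (2 * θ) * E ^ (1 - 2 * θ) := by
      have h1 := ENNReal.lintegral_mul_norm_pow_le (μ := volume)
        (f := fun σ => T z σ ^ (1 / θ) * G σ ^ 2) (g := fun σ => G σ ^ 2) (by fun_prop)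
        (by fun_prop) (show 0 ≤ 2 * θ by positivity) hθ2 (by ring)
      refine le_of_eq_of_le (lintegral_congr fun σ => ?_) h1
      rw [ENNReal.mul_rpow_of_nonneg _ _ (by positivity),
        mul_assoc ((T z σ ^ (1 / θ)) ^ (2 * θ)),
        ← ENNReal.rpow_add_of_nonneg _ _ (by positivity) hθ2, ← ENNReal.rpow_mul,
        show 1 / θ * (2 * θ) = ((2 : ℕ) : ℝ) by field_simp; norm_num,
        show 2 * θ + (1 - 2 * θ) = 1 by ring, ENNReal.rpow_one, ENNReal.rpow_natCast, mul_pow]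
    rw [e1, ← ENNReal.rpow_mul, mul_one_div_cancel hρ0.ne', ENNReal.rpow_one]
    calc _ ≤ d z * ((X z ^ (2 * θ) * E ^ (1 - 2 * θ)) ^ (1 / 2 : ℝ) *
          (∫⁻ s, jap s ^ (2 * η) * H z s ^ 2) ^ (1 / 2 : ℝ)) := by
          gcongr
          refine (lintegral_mul_le_rpow_half (by fun_prop) (by fun_prop)).trans ?_
          rw [e2]
          gcongr
      _ = _ := by
          rw [ENNReal.mul_rpow_of_nonneg _ _ (by norm_num), ← ENNReal.rpow_mul,
            ← ENNReal.rpow_mul, show 2 * θ * (1 / 2) = θ by ring,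
            show (1 - 2 * θ) * (1 / 2) = 1 / 2 - θ by ring, hm]
          ring
  have hexp : 0 ≤ 1 / 2 - θ := by linarith
  calc _ ≤ ∑' z, E ^ (1 / 2 - θ) * ((m z ^ ρ) ^ (1 / ρ) * X z ^ θ) := ENNReal.tsum_le_tsum hterm
    _ = E ^ (1 / 2 - θ) * ∑' z, ((m z ^ ρ) ^ (1 / ρ) * X z ^ θ) := ENNReal.tsum_mul_left
    _ ≤ E ^ (1 / 2 - θ) * ((∑' z, m z ^ ρ) ^ (1 / ρ) * (∑' z, X z) ^ θ) := by
        gcongr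
        exact tsum_rpow_mul_rpow_le _ _ (by positivity) hθ0.le (by rw [hθ]; ring)
    _ ≤ E ^ (1 / 2 - θ) * (lpNorm ρ m * (D * C * E) ^ θ) := by
        gcongr
        exact le_rfl
    _ = (D * C) ^ θ * (E ^ (1 / 2 - θ) * E ^ θ * lpNorm ρ m) := by
        rw [ENNReal.mul_rpow_of_nonneg _ _ hθ0.le]; ring
    _ = _ := by
        rw [← ENNReal.rpow_add_of_nonneg _ _ hexp hθ0.le, show 1 / 2 - θ + θ = 1 / 2 by ring]

/-- The estimate of `exists_tsum_cutoff_le` summed over the distinguished frequency. -/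
theorem exists_tsum_tsum_cutoff_le {ρ ρ' η γ : ℝ} (hρ : 1 < ρ) (hρ2 : ρ ≤ 2)
    (hρρ : 1 / ρ' + 1 / ρ = 1) (hγ : 0 < γ) (h : 1 - 1 / ρ < γ + η) :
    ∃ C : ℝ≥0∞, C ≠ ∞ ∧ ∀ (ℓ : ℤ → ℤ × ℤ → ℝ≥0∞), (∀ k z, z.1 * z.2 = 0 → ℓ k z = 0) →
      (∀ k z, ℓ k z ^ 2 * jap ((z.1 - z.2 : ℤ) : ℝ) ≤ 192) →
      ∀ (G : ℤ → ℝ → ℝ≥0∞) (H : ℤ → ℤ × ℤ → ℝ → ℝ≥0∞) (d : ℤ → ℤ × ℤ → ℝ≥0∞),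
      (∀ k, Measurable (G k)) → (∀ k z, Measurable (H k z)) →
      ∑' k, ∑' z : ℤ × ℤ, ℓ k z ^ γ * d k z *
        ∫⁻ σ, G k σ * H k z (2 * (z.1 * z.2 : ℤ) + σ) *
          cutoff (ℓ k z) (2 * (z.1 * z.2 : ℤ) + σ) ≤
      C * (lpNorm ρ' (fun k => (∫⁻ σ, G k σ ^ 2) ^ (1 / 2 : ℝ)) * (∑' k, ∑' z,
        (d k z * (∫⁻ s, jap s ^ (2 * η) * H k z s ^ 2) ^ (1 / 2 : ℝ)) ^ ρ) ^ (1 / ρ)) := by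
  obtain ⟨C, hC, hL⟩ := exists_tsum_cutoff_le hρ hρ2 hγ h
  have hρ0 : 0 < ρ := by linarith
  have hρ'0 : 0 < ρ' := by
    have : 1 / ρ < 1 := by rw [div_lt_one hρ0]; exact hρ
    exact one_div_pos.mp (by linarith)
  refine ⟨C, hC, fun ℓ h0 h1 G H d hG hH => ?_⟩
  refine (ENNReal.tsum_le_tsum fun k => hL (ℓ k) (h0 k) (h1 k) (G k) (H k) (d k) (hG k)
    (hH k)).trans ?_
  rw [ENNReal.tsum_mul_left]
  gcongr
  refine (tsum_mul_le_lpNorm_mul_lpNorm _ _ hρ'0 hρ0 hρρ).trans ?_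
  gcongr
  refine le_of_eq ?_
  conv_lhs => rw [lpNorm]
  simp_rw [lpNorm_rpow hρ0]

/-! ### Weighted norms and the splitting by the largest modulation. -/

/-- The weighted norm `‖⟨x⟩^e P‖_{L²}`. -/
def wNorm (e : ℝ) (P : ℝ → ℝ≥0∞) : ℝ≥0∞ := energy e P ^ (1 / 2 : ℝ)

/-- The kernel `⟨x⟩^{-1}`. -/
def japInv (x : ℝ) : ℝ≥0∞ := jap x ^ (-1 : ℝ)

@[fun_prop]
theorem measurable_japInv : Measurable japInv := by unfold japInv; fun_prop

/-- Multiplication by `⟨x⟩^{1/2}`. -/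
def halfMul (P : ℝ → ℝ≥0∞) (x : ℝ) : ℝ≥0∞ := jap x ^ (1 / 2 : ℝ) * P x

@[fun_prop]
theorem measurable_halfMul {P : ℝ → ℝ≥0∞} (hP : Measurable P) : Measurable (halfMul P) := by
  unfold halfMul; fun_prop

theorem lintegral_halfMul_sq (P : ℝ → ℝ≥0∞) :
    (∫⁻ x, halfMul P x ^ 2) ^ (1 / 2 : ℝ) = wNorm (1 / 2) P := by
  unfold wNorm energy halfMul
  congr 1
  refine lintegral_congr fun x => ?_
  rw [mul_pow, ← ENNReal.rpow_mul_natCast, mul_comm (1 / 2 : ℝ)]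
  norm_num

section pointwise
variable {Φ P Q R : ℝ → ℝ≥0∞}

theorem triInt_eq_lintegral_prod (hΦ : Measurable Φ) (hP : Measurable P) (hQ : Measurable Q)
    (hR : Measurable R) (c : ℝ) :
    triInt Φ P Q R c = ∫⁻ z : ℝ × ℝ × ℝ,
      P z.1 * (Q z.2.1 * R z.2.2 * Φ (c + z.1 + z.2.1 + z.2.2)) := by
  rw [Measure.volume_eq_prod, lintegral_prod _ (by fun_prop)]
  refine lintegral_congr fun x => ?_
  rw [biInt_eq_lintegral_prod hΦ hQ hR, ← lintegral_const_mul _ (by fun_prop)]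

theorem le_jap_of_half_le {A s : ℝ} (h : A ≤ 2 * |s|) : ENNReal.ofReal A ≤ 2 * jap s := by
  rw [jap, ← ENNReal.ofReal_ofNat 2, ← ENNReal.ofReal_mul (by norm_num)]
  exact ENNReal.ofReal_le_ofReal (by linarith [abs_le_bracket s])

/-- Distribution of the resonance weight according to the largest modulation. -/
theorem freqRatio_mul_japInv_le {η : ℝ} (hη : 0 ≤ η) (hη2 : η ≤ 1 / 2) {ξ a b : ℤ}
    (hab : a * b ≠ 0) (x y z : ℝ) :
    ENNReal.ofReal (freqRatio ξ a b) ^ (1 / 2 : ℝ) *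
        japInv (2 * (a * b : ℤ) + x + y + z) ≤
      2 * (resWeight ξ a b ^ (1 / 2 + η) *
          jap (2 * (a * b : ℤ) + x + y + z) ^ (-(1 / 2 - η)) +
        resWeight ξ a b ^ (1 / 2 : ℝ) * ((jap x ^ (1 / 2 : ℝ) + jap y ^ (1 / 2 : ℝ) +
          jap z ^ (1 / 2 : ℝ)) * japInv (2 * (a * b : ℤ) + x + y + z))) := by
  set A : ℝ := |(a : ℝ)| * |(b : ℝ)| with hA
  set s : ℝ := 2 * (a * b : ℤ) + x + y + z with hs
  have hApos : 0 < A := by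
    obtain ⟨ha, hb⟩ := mul_ne_zero_iff.mp hab
    exact mul_pos (abs_pos.mpr (by exact_mod_cast ha)) (abs_pos.mpr (by exact_mod_cast hb))
  have hκ := freqRatio_nonneg ξ a b
  have h1 : ENNReal.ofReal (freqRatio ξ a b) ≤ resWeight ξ a b * ENNReal.ofReal A := by
    rw [resWeight, ← ENNReal.ofReal_mul (by positivity), div_mul_cancel₀ _ hApos.ne']
    exact ENNReal.ofReal_le_ofReal (by linarith)
  -- The summand `1` in `resWeight` guarantees this bound. It allows the exponent `1/2` to be raised
  -- to `1/2 + η` when the output modulation is large.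
  have h2 : 1 ≤ resWeight ξ a b * ENNReal.ofReal A := by
    rw [resWeight, ← ENNReal.ofReal_mul (by positivity), div_mul_cancel₀ _ hApos.ne',
      ← ENNReal.ofReal_one]
    exact ENNReal.ofReal_le_ofReal (by linarith)
  have hpow : ∀ e : ℝ, e ≤ 1 → (2 : ℝ≥0∞) ^ e ≤ 2 := fun e he => by
    simpa using ENNReal.rpow_le_rpow_of_exponent_le (one_le_two : (1 : ℝ≥0∞) ≤ 2) he
  have hinput : ∀ t : ℝ, A ≤ 2 * |t| → ENNReal.ofReal (freqRatio ξ a b) ^ (1 / 2 : ℝ) ≤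
      2 * (resWeight ξ a b ^ (1 / 2 : ℝ) * jap t ^ (1 / 2 : ℝ)) := by
    intro t ht
    calc _ ≤ (resWeight ξ a b * (2 * jap t)) ^ (1 / 2 : ℝ) := by
          gcongr
          refine h1.trans ?_
          gcongr
          exact le_jap_of_half_le ht
      _ = 2 ^ (1 / 2 : ℝ) * (resWeight ξ a b ^ (1 / 2 : ℝ) * jap t ^ (1 / 2 : ℝ)) := by
          rw [ENNReal.mul_rpow_of_nonneg _ _ (by norm_num),
            ENNReal.mul_rpow_of_nonneg _ _ (by norm_num)]
          ring
      _ ≤ _ := by gcongr; exact hpow _ (by norm_num)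
  -- The resonance identity `s - x - y - z = 2ab` and the triangle inequality: four terms add up to
  -- at least `2A`, so one is at least `A/2`.
  have hcase : A ≤ 2 * |s| ∨ A ≤ 2 * |x| ∨ A ≤ 2 * |y| ∨ A ≤ 2 * |z| := by
    by_contra! hcon
    have e : 2 * A = |s - x - y - z| := by
      rw [hs, hA, ← abs_mul]
      push_cast
      rw [show 2 * ((a : ℝ) * b) + x + y + z - x - y - z = 2 * (a * b) by ring, abs_mul 2,
        abs_two]
    have := abs_sub (s - x - y) z
    have := abs_sub (s - x) y
    have := abs_sub s x
    linarith
  rw [mul_add]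
  rcases hcase with h | h
  · refine le_add_right ?_
    have h3 : ENNReal.ofReal (freqRatio ξ a b) ^ (1 / 2 : ℝ) ≤
        2 * (resWeight ξ a b ^ (1 / 2 + η) * jap s ^ (1 / 2 + η)) := by
      calc _ ≤ (resWeight ξ a b * ENNReal.ofReal A) ^ (1 / 2 : ℝ) *
            (resWeight ξ a b * ENNReal.ofReal A) ^ η := by
            refine le_mul_of_le_of_one_le (ENNReal.rpow_le_rpow h1 (by norm_num)) ?_
            simpa using ENNReal.rpow_le_rpow h2 hη
        _ = (resWeight ξ a b * ENNReal.ofReal A) ^ (1 / 2 + η) := by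
            rw [ENNReal.rpow_add_of_nonneg _ _ (by norm_num) hη]
        _ ≤ (resWeight ξ a b * (2 * jap s)) ^ (1 / 2 + η) := by
            gcongr
            exact le_jap_of_half_le h
        _ = 2 ^ (1 / 2 + η) * (resWeight ξ a b ^ (1 / 2 + η) * jap s ^ (1 / 2 + η)) := by
            rw [ENNReal.mul_rpow_of_nonneg _ _ (by positivity),
              ENNReal.mul_rpow_of_nonneg _ _ (by positivity)]
            ring
        _ ≤ _ := by gcongr; exact hpow _ (by linarith)
    calc _ ≤ 2 * (resWeight ξ a b ^ (1 / 2 + η) * jap s ^ (1 / 2 + η)) * jap s ^ (-1 : ℝ) := by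
          rw [japInv]; gcongr
      _ = 2 * (resWeight ξ a b ^ (1 / 2 + η) * (jap s ^ (1 / 2 + η) * jap s ^ (-1 : ℝ))) := by
          ring
      _ = _ := by rw [← jap_rpow_add]; ring_nf
  · refine le_add_left ?_
    rw [← mul_assoc (resWeight _ _ _ ^ _), ← mul_assoc 2]
    gcongr
    rcases h with h | h | h
    · exact (hinput x h).trans (by gcongr; exact le_add_right (le_add_right le_rfl))
    · exact (hinput y h).trans (by gcongr; exact le_add_right (le_add_left le_rfl))
    · exact (hinput z h).trans (by gcongr; exact le_add_left le_rfl)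

/-- The pointwise splitting integrated against `P`, `Q`, `R`. The symmetry of `triInt` brings the
factor of large modulation to the first slot, so one treatment serves all three inputs. -/
theorem freqRatio_mul_triInt_le {η : ℝ} (hη : 0 ≤ η) (hη2 : η ≤ 1 / 2) {ξ a b : ℤ}
    (hab : a * b ≠ 0) (hP : Measurable P) (hQ : Measurable Q) (hR : Measurable R) :
    ENNReal.ofReal (freqRatio ξ a b) ^ (1 / 2 : ℝ) * triInt japInv P Q R (2 * (a * b : ℤ)) ≤
      2 * (resWeight ξ a b ^ (1 / 2 + η) *
          triInt (fun s => jap s ^ (-(1 / 2 - η))) P Q R (2 * (a * b : ℤ)) +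
        resWeight ξ a b ^ (1 / 2 : ℝ) * (triInt japInv (halfMul P) Q R (2 * (a * b : ℤ)) +
          triInt japInv (halfMul Q) P R (2 * (a * b : ℤ)) +
          triInt japInv (halfMul R) P Q (2 * (a * b : ℤ)))) := by
  have hJ := measurable_japInv
  rw [← triInt_swap_left hJ hP (measurable_halfMul hQ) hR,
    ← triInt_swap_left hJ hP (measurable_halfMul hR) hQ,
    triInt_swap_right hJ (measurable_halfMul hR) hQ,
    triInt_eq_lintegral_prod hJ hP hQ hR,
    triInt_eq_lintegral_prod (by fun_prop) hP hQ hR,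
    triInt_eq_lintegral_prod hJ (measurable_halfMul hP) hQ hR,
    triInt_eq_lintegral_prod hJ hP (measurable_halfMul hQ) hR,
    triInt_eq_lintegral_prod hJ hP hQ (measurable_halfMul hR),
    ← lintegral_add_left (by fun_prop), ← lintegral_add_left (by fun_prop),
    ← lintegral_const_mul _ (by fun_prop), ← lintegral_const_mul _ (by fun_prop),
    ← lintegral_const_mul _ (by fun_prop), ← lintegral_add_left (by fun_prop),
    ← lintegral_const_mul _ (by fun_prop)]
  refine lintegral_mono fun z => ?_
  simp only [halfMul]
  calc _ = P z.1 * (Q z.2.1 * R z.2.2) * (ENNReal.ofReal (freqRatio ξ a b) ^ (1 / 2 : ℝ) *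
        japInv (2 * (a * b : ℤ) + z.1 + z.2.1 + z.2.2)) := by ring
    _ ≤ _ := mul_le_mul_right (freqRatio_mul_japInv_le hη hη2 hab z.1 z.2.1 z.2.2) _
    _ = _ := by ring

end pointwise

section norms

theorem measurable_biInt_japInv {P Q : ℝ → ℝ≥0∞} (hP : Measurable P) (hQ : Measurable Q) :
    Measurable (biInt japInv P Q) := measurable_biInt measurable_japInv hP hQ

/-- The weighted `L²` norm of `biInt japInv P Q`. -/
def biNorm (η : ℝ) (P Q : ℝ → ℝ≥0∞) : ℝ≥0∞ :=
  (∫⁻ s, jap s ^ (2 * η) * biInt japInv P Q s ^ 2) ^ (1 / 2 : ℝ)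

variable {β η : ℝ}

theorem exists_biNorm_le (hβ : β ≤ 1) (hη : 0 ≤ η) (h : 2 * η < 2 * β - 1) :
    ∃ C : ℝ≥0∞, C ≠ ∞ ∧ ∀ P Q : ℝ → ℝ≥0∞, Measurable P → Measurable Q →
      biNorm η P Q ≤ C * (wNorm (β / 2) P * wNorm (β / 2) Q) := by
  obtain ⟨C, hC, H⟩ := exists_biInt_le hβ hη h
  refine ⟨C ^ (1 / 2 : ℝ), ENNReal.rpow_ne_top_of_nonneg (by norm_num) hC, fun P Q hP hQ => ?_⟩
  unfold wNorm
  rw [← ENNReal.mul_rpow_of_nonneg _ _ (by norm_num), ← ENNReal.mul_rpow_of_nonneg _ _ (by norm_num)]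
  exact ENNReal.rpow_le_rpow (H P Q hP hQ) (by norm_num)

theorem exists_triInt_le_wNorm (hβ : β ≤ 1) (hη : 0 ≤ η) (h : 2 * η < 2 * β - 1) :
    ∃ C : ℝ≥0∞, C ≠ ∞ ∧ ∀ P Q R : ℝ → ℝ≥0∞, Measurable P → Measurable Q → Measurable R →
      ∀ c : ℝ, triInt (fun x => jap x ^ (-(1 / 2 - η))) P Q R c ≤
        C * (wNorm (1 / 2) P * wNorm (β / 2) Q * wNorm (β / 2) R) := by
  obtain ⟨C, hC, H⟩ := exists_triInt_le hβ hη h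
  refine ⟨C ^ (1 / 2 : ℝ), ENNReal.rpow_ne_top_of_nonneg (by norm_num) hC,
    fun P Q R hP hQ hR c => ?_⟩
  unfold wNorm
  rw [← ENNReal.mul_rpow_of_nonneg _ _ (by norm_num),
    ← ENNReal.mul_rpow_of_nonneg _ _ (by norm_num),
    ← ENNReal.mul_rpow_of_nonneg _ _ (by norm_num), mul_assoc]
  exact le_rpow_half_of_sq_le (H P Q R hP hQ hR c)

/-- The product of the norms of three families. -/
def normProd (q' r' e₁ e₂ e₃ : ℝ) (Q₁ Q₂ Q₃ : ℤ → ℝ → ℝ≥0∞) : ℝ≥0∞ :=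
  lpNorm q' (fun k => wNorm e₁ (Q₁ k)) * lpNorm q' (fun k => wNorm e₂ (Q₂ k)) *
    lpNorm r' fun k => wNorm e₃ (Q₃ k)

end norms

/-! ### The four modulation regions and their sum. -/

section regions
variable {q q' r r' β η : ℝ}

/-- The contribution of the region where the output modulation is largest. -/
theorem exists_tsum_output_le (hq' : 1 ≤ q') (hr : 0 < r) (hr' : 0 < r')
    (hrr : 1 / r + 1 / r' = 1) (hβ : β ≤ 1) (hη : 0 ≤ η) (h : 2 * η < 2 * β - 1)
    (hηq : 1 < 1 / 2 + η + 1 / q') :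
    ∃ C : ℝ≥0∞, C ≠ ∞ ∧ ∀ (g : ℤ → ℝ≥0∞) (Q₁ Q₂ Q₃ : ℤ → ℝ → ℝ≥0∞),
      (∀ k, Measurable (Q₁ k)) → (∀ k, Measurable (Q₂ k)) → (∀ k, Measurable (Q₃ k)) →
      ∑' ξ : ℤ, ∑' z : ℤ × ℤ, resWeight ξ z.1 z.2 ^ (1 / 2 + η) * (g ξ *
        triInt (fun s => jap s ^ (-(1 / 2 - η))) (Q₁ (ξ - z.1)) (Q₂ (ξ - z.2))
          (Q₃ (ξ - z.1 - z.2)) (2 * (z.1 * z.2 : ℤ))) ≤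
      C * (lpNorm r g * normProd q' r' (1 / 2) (β / 2) (β / 2) Q₁ Q₂ Q₃) := by
  obtain ⟨C, hC, H⟩ := exists_triInt_le_wNorm hβ hη h
  obtain ⟨D, hD, K⟩ := exists_quadSum_le hq' hr hr' hrr (x := 1 / 2 + η) (by linarith) hηq
  refine ⟨C * D, ENNReal.mul_ne_top hC hD, fun g Q₁ Q₂ Q₃ h₁ h₂ h₃ => ?_⟩
  calc _ ≤ ∑' ξ : ℤ, ∑' z : ℤ × ℤ, C * (resWeight ξ z.1 z.2 ^ (1 / 2 + η) * (g ξ *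
        (wNorm (1 / 2) (Q₁ (ξ - z.1)) * wNorm (β / 2) (Q₂ (ξ - z.2)) *
          wNorm (β / 2) (Q₃ (ξ - z.1 - z.2))))) := by
        refine ENNReal.tsum_le_tsum fun ξ => ENNReal.tsum_le_tsum fun z => ?_
        calc _ ≤ resWeight ξ z.1 z.2 ^ (1 / 2 + η) * (g ξ * (C *
              (wNorm (1 / 2) (Q₁ (ξ - z.1)) * wNorm (β / 2) (Q₂ (ξ - z.2)) *
                wNorm (β / 2) (Q₃ (ξ - z.1 - z.2))))) := by
              gcongr
              exact H _ _ _ (h₁ _) (h₂ _) (h₃ _) _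
          _ = _ := by ring
    _ = C * ∑' ξ : ℤ, ∑' z : ℤ × ℤ, (resWeight ξ z.1 z.2 ^ (1 / 2 + η) * (g ξ *
        (wNorm (1 / 2) (Q₁ (ξ - z.1)) * wNorm (β / 2) (Q₂ (ξ - z.2)) *
          wNorm (β / 2) (Q₃ (ξ - z.1 - z.2))))) := by
        simp_rw [ENNReal.tsum_mul_left]
    _ ≤ _ := mul_le_mul_right (K g (fun k => wNorm (1 / 2) (Q₁ k))
        (fun k => wNorm (β / 2) (Q₂ k)) fun k => wNorm (β / 2) (Q₃ k)) _
    _ = _ := by unfold normProd; ring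

/-- Splitting of the trilinear form when the modulation of its first entry is largest. -/
theorem exists_triInt_halfMul_le (hβ : β ≤ 1) (hη : 0 ≤ η) (h : 2 * η < 2 * β - 1) :
    ∃ C : ℝ≥0∞, C ≠ ∞ ∧ ∀ (ℓ : ℝ≥0∞) (P Q R : ℝ → ℝ≥0∞),
      Measurable P → Measurable Q → Measurable R → ∀ n : ℝ,
      triInt japInv (halfMul P) Q R n ≤
        C * (ℓ ^ η * (wNorm (1 / 2) P * wNorm (β / 2) Q * wNorm (β / 2) R)) +
        ∫⁻ σ, halfMul P σ * biInt japInv Q R (n + σ) * cutoff ℓ (n + σ) := by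
  obtain ⟨C, hC, H⟩ := exists_biNorm_le hβ hη h
  refine ⟨C, hC, fun ℓ P Q R hP hQ hR n => ?_⟩
  refine (lintegral_mul_le_add_cutoff hη ℓ (measurable_halfMul hP)
    (measurable_biInt_japInv hQ hR) n).trans (add_le_add_left ?_ _)
  rw [lintegral_halfMul_sq]
  calc _ ≤ ℓ ^ η * (wNorm (1 / 2) P * (C * (wNorm (β / 2) Q * wNorm (β / 2) R))) := by
        gcongr
        exact H Q R hQ hR
    _ = _ := by ring

/-- The part of a region where the modulation of the output is small compared with the weight. -/
theorem exists_tsum_local_le {ρ ρ' γ : ℝ} (hρ : 1 < ρ) (hρ2 : ρ ≤ 2)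
    (hρρ : 1 / ρ' + 1 / ρ = 1) (hγ : 0 < γ) (hγ2 : γ ≤ 1 / 2) (h : 1 - 1 / ρ < γ + η)
    (φ κ : ℤ → ℤ × ℤ → ℤ) (hφκ : ∀ k z, κ (φ k z) z = k)
    (hφ : ∀ f : ℤ → ℤ × ℤ → ℝ≥0∞,
      ∑' ξ, ∑' z : ℤ × ℤ, f ξ z = ∑' k, ∑' z : ℤ × ℤ, f (φ k z) z) :
    ∃ C : ℝ≥0∞, C ≠ ∞ ∧ ∀ (g : ℤ → ℝ≥0∞) (P : ℤ → ℝ → ℝ≥0∞) (Q R : ℤ → ℤ × ℤ → ℝ → ℝ≥0∞),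
      (∀ k, Measurable (P k)) → (∀ k z, Measurable (Q k z)) → (∀ k z, Measurable (R k z)) →
      ∑' ξ : ℤ, ∑' z : ℤ × ℤ, resWeight ξ z.1 z.2 ^ (1 / 2 : ℝ) * (g ξ *
        ∫⁻ σ, halfMul (P (κ ξ z)) σ * biInt japInv (Q ξ z) (R ξ z) (2 * (z.1 * z.2 : ℤ) + σ) *
          cutoff (resWeight ξ z.1 z.2) (2 * (z.1 * z.2 : ℤ) + σ)) ≤
      C * (lpNorm ρ' (fun k => wNorm (1 / 2) (P k)) * (∑' ξ, ∑' z : ℤ × ℤ,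
        resWeight ξ z.1 z.2 ^ ((1 / 2 - γ) * ρ) * (g ξ * biNorm η (Q ξ z) (R ξ z)) ^ ρ) ^
          (1 / ρ)) := by
  obtain ⟨C, hC, H⟩ := exists_tsum_tsum_cutoff_le hρ hρ2 hρρ hγ h
  refine ⟨C, hC, fun g P Q R hP hQ hR => ?_⟩
  -- `φ` makes the frequency of the distinguished input the outer summation variable. Of `ℓ^{1/2}`,
  -- the part `ℓ^γ` is spent on almost orthogonality and `ℓ^{1/2-γ}` stays in the frequency sum.
  have key := H (fun k z => resWeight (φ k z) z.1 z.2)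
    (fun k z hz => resWeight_of_mul_eq_zero _ hz) (fun k z => resWeight_sq_mul_jap_le _ _ _)
    (fun k => halfMul (P k)) (fun k z => biInt japInv (Q (φ k z) z) (R (φ k z) z))
    (fun k z => resWeight (φ k z) z.1 z.2 ^ (1 / 2 - γ) * g (φ k z))
    (fun k => measurable_halfMul (hP k)) fun k z => measurable_biInt_japInv (hQ _ _) (hR _ _)
  simp_rw [lintegral_halfMul_sq] at key
  rw [hφ, hφ fun ξ z => resWeight ξ z.1 z.2 ^ ((1 / 2 - γ) * ρ) *
    (g ξ * biNorm η (Q ξ z) (R ξ z)) ^ ρ]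
  refine (le_of_eq ?_).trans (key.trans_eq ?_)
  · refine tsum_congr fun k => tsum_congr fun z => ?_
    rw [hφκ, ← mul_assoc, ← mul_assoc, ← ENNReal.rpow_add_of_nonneg _ _ hγ.le (by linarith),
      add_sub_cancel, mul_assoc]
  · congr 3
    refine tsum_congr fun k => tsum_congr fun z => ?_
    change (_ * biNorm η _ _) ^ ρ = _
    rw [mul_assoc, ENNReal.mul_rpow_of_nonneg _ _ (by linarith), ← ENNReal.rpow_mul]

theorem rpow_one_div_le_of_le {ρ : ℝ} (hρ : 0 < ρ) {S C D M : ℝ≥0∞}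
    (h : S ≤ C ^ ρ * (D * M ^ ρ)) : S ^ (1 / ρ) ≤ C * D ^ (1 / ρ) * M := by
  refine (ENNReal.rpow_le_rpow h (by positivity)).trans_eq ?_
  rw [ENNReal.mul_rpow_of_nonneg _ _ (by positivity), ENNReal.mul_rpow_of_nonneg _ _ (by positivity),
    ← ENNReal.rpow_mul, ← ENNReal.rpow_mul, mul_one_div_cancel hρ.ne', ENNReal.rpow_one,
    ENNReal.rpow_one, mul_assoc]

theorem tsum_tsum_mul_mul_rpow {ρ : ℝ} (hρ : 0 ≤ ρ) (C : ℝ≥0∞) (W F : ℤ → ℤ × ℤ → ℝ≥0∞) :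
    ∑' ξ, ∑' z : ℤ × ℤ, W ξ z * (C * F ξ z) ^ ρ = C ^ ρ * ∑' ξ, ∑' z : ℤ × ℤ, W ξ z * F ξ z ^ ρ := by
  simp_rw [ENNReal.mul_rpow_of_nonneg _ _ hρ, mul_left_comm _ (C ^ ρ), ENNReal.tsum_mul_left]

/-- The contribution of the region where the modulation of the first factor is largest. -/
theorem exists_tsum_first_le (hq : 4 / 3 < q) (hqr : q ≤ r) (hr2 : r ≤ 2)
    (hqq : 1 / q + 1 / q' = 1) (hrr : 1 / r + 1 / r' = 1)
    (hβ : β ≤ 1) (hη : 0 ≤ η) (h : 2 * η < 2 * β - 1) (hηq : 1 / q < 1 / 2 + η) :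
    ∃ C : ℝ≥0∞, C ≠ ∞ ∧ ∀ (g : ℤ → ℝ≥0∞) (Q₁ Q₂ Q₃ : ℤ → ℝ → ℝ≥0∞),
      (∀ k, Measurable (Q₁ k)) → (∀ k, Measurable (Q₂ k)) → (∀ k, Measurable (Q₃ k)) →
      ∑' ξ : ℤ, ∑' z : ℤ × ℤ, resWeight ξ z.1 z.2 ^ (1 / 2 : ℝ) * (g ξ *
        triInt japInv (halfMul (Q₁ (ξ - z.1))) (Q₂ (ξ - z.2))
          (Q₃ (ξ - z.1 - z.2)) (2 * (z.1 * z.2 : ℤ))) ≤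
      C * (lpNorm r g * normProd q' r' (1 / 2) (β / 2) (β / 2) Q₁ Q₂ Q₃) := by
  have hq0 : 0 < q := by linarith
  have hr0 : 0 < r := by linarith
  have hqi : 1 / q < 3 / 4 := by rw [div_lt_iff₀ hq0]; linarith
  have hqi2 : 1 / 2 ≤ 1 / q := one_div_le_one_div_of_le hq0 (by linarith)
  have hri2 : 1 / 2 ≤ 1 / r := one_div_le_one_div_of_le hr0 hr2
  have hri : 1 / r ≤ 1 / q := one_div_le_one_div_of_le hq0 hqr
  have hq'0 : 0 < q' := one_div_pos.mp (by linarith)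
  have hr'0 : 0 < r' := one_div_pos.mp (by linarith)
  have hq'1 : 1 ≤ q' := (one_div_le_one_div hq'0 one_pos).mp (by linarith)
  -- The lower bounds are what almost orthogonality needs with `ρ = q`; the upper bound is
  -- equivalent to `hxq`, the summability in `exists_localSum_le`. The interval is nonempty because
  -- `q > 4/3` and `1/q < 1/2 + η`.
  obtain ⟨γ, hγ, hγ2⟩ : ∃ γ, max 0 (1 - 1 / q - η) < γ ∧ γ < 3 / 2 - 2 * (1 / q) :=
    exists_between (max_lt (by linarith) (by linarith))
  obtain ⟨hγ0, hγ1⟩ := max_lt_iff.mp hγ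
  have hxq : 1 < (1 / 2 - γ) * q + (q - 1) := by
    have : (2 + (γ - 3 / 2) * q) < 0 := by
      have := mul_lt_mul_of_pos_right hγ2 hq0
      have e : 1 / q * q = 1 := one_div_mul_cancel hq0.ne'
      linarith
    linarith
  obtain ⟨C₁, hC₁, H₁⟩ := exists_triInt_halfMul_le hβ hη h
  obtain ⟨C₂, hC₂, H₂⟩ := exists_quadSum_le (x := 1 / 2 + η) hq'1 hr0 hr'0 hrr (by linarith)
    (by linarith)
  obtain ⟨C₃, hC₃, H₃⟩ := exists_tsum_local_le (η := η) (ρ := q) (ρ' := q') (γ := γ) (by linarith)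
    (by linarith) (by linarith) hγ0 (by linarith) (by linarith) (fun k z => k + z.1)
    (fun ξ z => ξ - z.1) (fun k z => by ring) tsum_sub_fst_eq
  obtain ⟨C₄, hC₄, H₄⟩ := exists_localSum_le (x := (1 / 2 - γ) * q) (by linarith) (by linarith) hqr
    hr2 hqq hrr (mul_pos (by linarith) hq0) hxq
  obtain ⟨C₅, hC₅, H₅⟩ := exists_biNorm_le hβ hη h
  refine ⟨C₁ * C₂ + C₃ * (C₅ * C₄ ^ (1 / q)), by
    have := ENNReal.rpow_ne_top_of_nonneg (y := 1 / q) (by positivity) hC₄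
    finiteness, fun g Q₁ Q₂ Q₃ h₁ h₂ h₃ => ?_⟩
  have hloc : (∑' ξ, ∑' z : ℤ × ℤ, resWeight ξ z.1 z.2 ^ ((1 / 2 - γ) * q) *
      (g ξ * biNorm η (Q₂ (ξ - z.2)) (Q₃ (ξ - z.1 - z.2))) ^ q) ^ (1 / q) ≤
      C₅ * C₄ ^ (1 / q) * (lpNorm r g * (lpNorm q' (fun k => wNorm (β / 2) (Q₂ k)) *
        lpNorm r' fun k => wNorm (β / 2) (Q₃ k))) := by
    refine rpow_one_div_le_of_le hq0 ((ENNReal.tsum_le_tsum fun ξ =>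
      ENNReal.tsum_le_tsum fun z => ?_ : _ ≤ ∑' ξ, ∑' z : ℤ × ℤ,
        resWeight ξ z.1 z.2 ^ ((1 / 2 - γ) * q) * (C₅ * (g ξ *
          (wNorm (β / 2) (Q₂ (ξ - z.2)) * wNorm (β / 2) (Q₃ (ξ - z.1 - z.2))))) ^ q).trans
      ((tsum_tsum_mul_mul_rpow hq0.le C₅ (fun ξ z => resWeight ξ z.1 z.2 ^ ((1 / 2 - γ) * q))
        fun ξ z => g ξ * (wNorm (β / 2) (Q₂ (ξ - z.2)) * wNorm (β / 2) (Q₃ (ξ - z.1 - z.2)))).trans_le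
      (mul_le_mul_right (H₄ g (fun k => wNorm (β / 2) (Q₂ k))
        fun k => wNorm (β / 2) (Q₃ k)) _)))
    exact mul_le_mul_right (ENNReal.rpow_le_rpow ((mul_le_mul_right (H₅ _ _ (h₂ _)
      (h₃ _)) (g ξ)).trans_eq (mul_left_comm _ _ _)) hq0.le) _
  calc _ ≤ ∑' ξ : ℤ, ∑' z : ℤ × ℤ, (C₁ * (resWeight ξ z.1 z.2 ^ (1 / 2 + η) * (g ξ *
        (wNorm (1 / 2) (Q₁ (ξ - z.1)) * wNorm (β / 2) (Q₂ (ξ - z.2)) *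
          wNorm (β / 2) (Q₃ (ξ - z.1 - z.2))))) +
        resWeight ξ z.1 z.2 ^ (1 / 2 : ℝ) * (g ξ * ∫⁻ σ, halfMul (Q₁ (ξ - z.1)) σ *
          biInt japInv (Q₂ (ξ - z.2)) (Q₃ (ξ - z.1 - z.2)) (2 * (z.1 * z.2 : ℤ) + σ) *
          cutoff (resWeight ξ z.1 z.2) (2 * (z.1 * z.2 : ℤ) + σ))) := by
        refine ENNReal.tsum_le_tsum fun ξ => ENNReal.tsum_le_tsum fun z => ?_
        refine (mul_le_mul_right (mul_le_mul_right (H₁ (resWeight ξ z.1 z.2) _ _ _ (h₁ _) (h₂ _)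
          (h₃ _) _) _) _).trans_eq ?_
        rw [ENNReal.rpow_add_of_nonneg _ _ (by norm_num) hη]
        ring
    _ ≤ C₁ * (C₂ * (lpNorm r g * normProd q' r' (1 / 2) (β / 2) (β / 2) Q₁ Q₂ Q₃)) +
        C₃ * (lpNorm q' (fun k => wNorm (1 / 2) (Q₁ k)) * (C₅ * C₄ ^ (1 / q) *
          (lpNorm r g * (lpNorm q' (fun k => wNorm (β / 2) (Q₂ k)) *
            lpNorm r' fun k => wNorm (β / 2) (Q₃ k))))) := by
        simp_rw [ENNReal.tsum_add, ENNReal.tsum_mul_left]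
        refine add_le_add (mul_le_mul_right (H₂ g (fun k => wNorm (1 / 2) (Q₁ k))
          (fun k => wNorm (β / 2) (Q₂ k)) fun k => wNorm (β / 2) (Q₃ k)) _) ?_
        exact (H₃ g Q₁ (fun ξ z => Q₂ (ξ - z.2)) (fun ξ z => Q₃ (ξ - z.1 - z.2)) h₁
          (fun _ _ => h₂ _) fun _ _ => h₃ _).trans (mul_le_mul_right (mul_le_mul_right hloc _) _)
    _ = _ := by unfold normProd; ring

/-- The contribution of the region where the modulation of the second factor is largest. -/
theorem exists_tsum_second_le (hq : 4 / 3 < q) (hqr : q ≤ r) (hr2 : r ≤ 2)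
    (hqq : 1 / q + 1 / q' = 1) (hrr : 1 / r + 1 / r' = 1)
    (hβ : β ≤ 1) (hη : 0 ≤ η) (h : 2 * η < 2 * β - 1) (hηq : 1 / q < 1 / 2 + η) :
    ∃ C : ℝ≥0∞, C ≠ ∞ ∧ ∀ (g : ℤ → ℝ≥0∞) (Q₁ Q₂ Q₃ : ℤ → ℝ → ℝ≥0∞),
      (∀ k, Measurable (Q₁ k)) → (∀ k, Measurable (Q₂ k)) → (∀ k, Measurable (Q₃ k)) →
      ∑' ξ : ℤ, ∑' z : ℤ × ℤ, resWeight ξ z.1 z.2 ^ (1 / 2 : ℝ) * (g ξ *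
        triInt japInv (halfMul (Q₂ (ξ - z.2))) (Q₁ (ξ - z.1))
          (Q₃ (ξ - z.1 - z.2)) (2 * (z.1 * z.2 : ℤ))) ≤
      C * (lpNorm r g * normProd q' r' (β / 2) (1 / 2) (β / 2) Q₁ Q₂ Q₃) := by
  obtain ⟨C, hC, H⟩ := exists_tsum_first_le hq hqr hr2 hqq hrr hβ hη h hηq
  refine ⟨C, hC, fun g Q₁ Q₂ Q₃ h₁ h₂ h₃ => (le_of_eq ?_).trans
    ((H g Q₂ Q₁ Q₃ h₂ h₁ h₃).trans_eq ?_)⟩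
  · refine tsum_congr fun ξ => (tsum_swap_pair _).trans (tsum_congr fun z => ?_)
    dsimp only
    rw [resWeight_swap, mul_comm z.2, sub_right_comm ξ z.2]
  · unfold normProd
    ring

/-- The contribution of the region where the modulation of the third factor is largest. -/
theorem exists_tsum_third_le (hq : 4 / 3 < q) (hqr : q ≤ r) (hr2 : r ≤ 2)
    (hqq : 1 / q + 1 / q' = 1) (hrr : 1 / r + 1 / r' = 1)
    (hβ : β ≤ 1) (hη : 0 ≤ η) (h : 2 * η < 2 * β - 1) (hηq : 1 / q < 1 / 2 + η) :
    ∃ C : ℝ≥0∞, C ≠ ∞ ∧ ∀ (g : ℤ → ℝ≥0∞) (Q₁ Q₂ Q₃ : ℤ → ℝ → ℝ≥0∞),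
      (∀ k, Measurable (Q₁ k)) → (∀ k, Measurable (Q₂ k)) → (∀ k, Measurable (Q₃ k)) →
      ∑' ξ : ℤ, ∑' z : ℤ × ℤ, resWeight ξ z.1 z.2 ^ (1 / 2 : ℝ) * (g ξ *
        triInt japInv (halfMul (Q₃ (ξ - z.1 - z.2))) (Q₁ (ξ - z.1))
          (Q₂ (ξ - z.2)) (2 * (z.1 * z.2 : ℤ))) ≤
      C * (lpNorm r g * normProd q' r' (β / 2) (β / 2) (1 / 2) Q₁ Q₂ Q₃) := by
  have hq0 : 0 < q := by linarith
  have hr0 : 0 < r := by linarith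
  have hqi : 1 / q < 3 / 4 := by rw [div_lt_iff₀ hq0]; linarith
  have hqi2 : 1 / 2 ≤ 1 / q := one_div_le_one_div_of_le hq0 (by linarith)
  have hri2 : 1 / 2 ≤ 1 / r := one_div_le_one_div_of_le hr0 hr2
  have hri : 1 / r ≤ 1 / q := one_div_le_one_div_of_le hq0 hqr
  have hq'0 : 0 < q' := one_div_pos.mp (by linarith)
  have hr'0 : 0 < r' := one_div_pos.mp (by linarith)
  have hq'1 : 1 ≤ q' := (one_div_le_one_div hq'0 one_pos).mp (by linarith)
  have hrq' : r ≤ q' := by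
    refine (one_div_le_one_div hq'0 hr0).mp ?_
    linarith
  -- The same balance with `ρ = r`, as the distinguished input lies in `ℓ^{r'}`. The upper bound is
  -- positive because `1/r ≤ 1/q < 3/4`, and exceeds the other lower bound by `1/q < 1/2 + η`.
  obtain ⟨γ, hγ, hγ2⟩ : ∃ γ, max 0 (1 - 1 / r - η) < γ ∧ γ < 3 / 2 - 1 / q - 1 / r :=
    exists_between (max_lt (by linarith) (by linarith))
  obtain ⟨hγ0, hγ1⟩ := max_lt_iff.mp hγ
  have hxq : 1 < (1 / 2 - γ) * r + r / q' := by
    have e1 : r / q' = 1 / q' * r := by ring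
    have e2 : 1 / r * r = 1 := one_div_mul_cancel hr0.ne'
    have := mul_lt_mul_of_pos_right hγ2 hr0
    have e3 : 1 / q' * r = r - 1 / q * r := by rw [eq_sub_iff_add_eq'.mpr hqq]; ring
    linarith
  obtain ⟨C₁, hC₁, H₁⟩ := exists_triInt_halfMul_le hβ hη h
  obtain ⟨C₂, hC₂, H₂⟩ := exists_quadSum_le (x := 1 / 2 + η) hq'1 hr0 hr'0 hrr (by linarith)
    (by linarith)
  obtain ⟨C₃, hC₃, H₃⟩ := exists_tsum_local_le (η := η) (ρ := r) (ρ' := r') (γ := γ) (by linarith)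
    hr2 (by linarith) hγ0 (by linarith) (by linarith) (fun k z => k + z.1 + z.2)
    (fun ξ z => ξ - z.1 - z.2) (fun k z => by ring) tsum_sub_both_eq
  obtain ⟨C₄, hC₄, H₄⟩ := exists_localSum_le' (x := (1 / 2 - γ) * r) hr0 hq'0 hrq'
    (mul_pos (by linarith) hr0) hxq
  obtain ⟨C₅, hC₅, H₅⟩ := exists_biNorm_le hβ hη h
  refine ⟨C₁ * C₂ + C₃ * (C₅ * C₄ ^ (1 / r)), by
    have := ENNReal.rpow_ne_top_of_nonneg (y := 1 / r) (by positivity) hC₄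
    finiteness, fun g Q₁ Q₂ Q₃ h₁ h₂ h₃ => ?_⟩
  have hloc : (∑' ξ, ∑' z : ℤ × ℤ, resWeight ξ z.1 z.2 ^ ((1 / 2 - γ) * r) *
      (g ξ * biNorm η (Q₁ (ξ - z.1)) (Q₂ (ξ - z.2))) ^ r) ^ (1 / r) ≤
      C₅ * C₄ ^ (1 / r) * (lpNorm r g * (lpNorm q' (fun k => wNorm (β / 2) (Q₁ k)) *
        lpNorm q' fun k => wNorm (β / 2) (Q₂ k))) := by
    refine rpow_one_div_le_of_le hr0 ((ENNReal.tsum_le_tsum fun ξ =>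
      ENNReal.tsum_le_tsum fun z => ?_ : _ ≤ ∑' ξ, ∑' z : ℤ × ℤ,
        resWeight ξ z.1 z.2 ^ ((1 / 2 - γ) * r) * (C₅ * (g ξ *
          (wNorm (β / 2) (Q₁ (ξ - z.1)) * wNorm (β / 2) (Q₂ (ξ - z.2))))) ^ r).trans
      ((tsum_tsum_mul_mul_rpow hr0.le C₅ (fun ξ z => resWeight ξ z.1 z.2 ^ ((1 / 2 - γ) * r))
        fun ξ z => g ξ * (wNorm (β / 2) (Q₁ (ξ - z.1)) * wNorm (β / 2) (Q₂ (ξ - z.2)))).trans_le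
      (mul_le_mul_right (H₄ g (fun k => wNorm (β / 2) (Q₁ k))
        fun k => wNorm (β / 2) (Q₂ k)) _)))
    exact mul_le_mul_right (ENNReal.rpow_le_rpow ((mul_le_mul_right (H₅ _ _ (h₁ _)
      (h₂ _)) (g ξ)).trans_eq (mul_left_comm _ _ _)) hr0.le) _
  calc _ ≤ ∑' ξ : ℤ, ∑' z : ℤ × ℤ, (C₁ * (resWeight ξ z.1 z.2 ^ (1 / 2 + η) * (g ξ *
        (wNorm (β / 2) (Q₁ (ξ - z.1)) * wNorm (β / 2) (Q₂ (ξ - z.2)) *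
          wNorm (1 / 2) (Q₃ (ξ - z.1 - z.2))))) +
        resWeight ξ z.1 z.2 ^ (1 / 2 : ℝ) * (g ξ * ∫⁻ σ, halfMul (Q₃ (ξ - z.1 - z.2)) σ *
          biInt japInv (Q₁ (ξ - z.1)) (Q₂ (ξ - z.2)) (2 * (z.1 * z.2 : ℤ) + σ) *
          cutoff (resWeight ξ z.1 z.2) (2 * (z.1 * z.2 : ℤ) + σ))) := by
        refine ENNReal.tsum_le_tsum fun ξ => ENNReal.tsum_le_tsum fun z => ?_
        refine (mul_le_mul_right (mul_le_mul_right (H₁ (resWeight ξ z.1 z.2) _ _ _ (h₃ _) (h₁ _)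
          (h₂ _) _) _) _).trans_eq ?_
        rw [ENNReal.rpow_add_of_nonneg _ _ (by norm_num) hη]
        ring
    _ ≤ C₁ * (C₂ * (lpNorm r g * normProd q' r' (β / 2) (β / 2) (1 / 2) Q₁ Q₂ Q₃)) +
        C₃ * (lpNorm r' (fun k => wNorm (1 / 2) (Q₃ k)) * (C₅ * C₄ ^ (1 / r) *
          (lpNorm r g * (lpNorm q' (fun k => wNorm (β / 2) (Q₁ k)) *
            lpNorm q' fun k => wNorm (β / 2) (Q₂ k))))) := by
        simp_rw [ENNReal.tsum_add, ENNReal.tsum_mul_left]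
        refine add_le_add (mul_le_mul_right (H₂ g (fun k => wNorm (β / 2) (Q₁ k))
          (fun k => wNorm (β / 2) (Q₂ k)) fun k => wNorm (1 / 2) (Q₃ k)) _) ?_
        exact (H₃ g Q₃ (fun ξ z => Q₁ (ξ - z.1)) (fun ξ z => Q₂ (ξ - z.2)) h₃
          (fun _ _ => h₁ _) fun _ _ => h₂ _).trans (mul_le_mul_right (mul_le_mul_right hloc _) _)
    _ = _ := by unfold normProd; ring

/-- The trilinear estimate, summed against a test sequence. -/
theorem exists_trilinear_le (hq : 4 / 3 < q) (hqr : q ≤ r) (hr2 : r ≤ 2)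
    (hqq : 1 / q + 1 / q' = 1) (hrr : 1 / r + 1 / r' = 1)
    (hβ : β ≤ 1) (hη : 0 ≤ η) (hη2 : η ≤ 1 / 2) (h : 2 * η < 2 * β - 1)
    (hηq : 1 / q < 1 / 2 + η) :
    ∃ C : ℝ≥0∞, C ≠ ∞ ∧ ∀ (g : ℤ → ℝ≥0∞) (Q₁ Q₂ Q₃ : ℤ → ℝ → ℝ≥0∞),
      (∀ k, Measurable (Q₁ k)) → (∀ k, Measurable (Q₂ k)) → (∀ k, Measurable (Q₃ k)) →
      ∑' ξ : ℤ, ∑' z : ℤ × ℤ, (if z.1 * z.2 = 0 then 0 else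
        ENNReal.ofReal (freqRatio ξ z.1 z.2) ^ (1 / 2 : ℝ) * (g ξ *
          triInt japInv (Q₁ (ξ - z.1)) (Q₂ (ξ - z.2)) (Q₃ (ξ - z.1 - z.2))
            (2 * (z.1 * z.2 : ℤ)))) ≤
      C * (lpNorm r g * (normProd q' r' (1 / 2) (β / 2) (β / 2) Q₁ Q₂ Q₃ +
        normProd q' r' (β / 2) (1 / 2) (β / 2) Q₁ Q₂ Q₃ +
        normProd q' r' (β / 2) (β / 2) (1 / 2) Q₁ Q₂ Q₃)) := by
  have hq0 : 0 < q := by linarith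
  have hr0 : 0 < r := by linarith
  have hqi : 1 / q < 3 / 4 := by rw [div_lt_iff₀ hq0]; linarith
  have hqi2 : 1 / 2 ≤ 1 / q := one_div_le_one_div_of_le hq0 (by linarith)
  have hri2 : 1 / 2 ≤ 1 / r := one_div_le_one_div_of_le hr0 hr2
  have hri : 1 / r ≤ 1 / q := one_div_le_one_div_of_le hq0 hqr
  have hq'0 : 0 < q' := one_div_pos.mp (by linarith)
  have hr'0 : 0 < r' := one_div_pos.mp (by linarith)
  have hq'1 : 1 ≤ q' := (one_div_le_one_div hq'0 one_pos).mp (by linarith)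
  obtain ⟨C₀, hC₀, H₀⟩ := exists_tsum_output_le hq'1 hr0 hr'0 hrr hβ hη h (by linarith)
  obtain ⟨C₁, hC₁, H₁⟩ := exists_tsum_first_le hq hqr hr2 hqq hrr hβ hη h hηq
  obtain ⟨C₂, hC₂, H₂⟩ := exists_tsum_second_le hq hqr hr2 hqq hrr hβ hη h hηq
  obtain ⟨C₃, hC₃, H₃⟩ := exists_tsum_third_le hq hqr hr2 hqq hrr hβ hη h hηq
  refine ⟨2 * (C₀ + C₁ + C₂ + C₃), by finiteness, fun g Q₁ Q₂ Q₃ h₁ h₂ h₃ => ?_⟩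
  refine (ENNReal.tsum_le_tsum fun ξ => ENNReal.tsum_le_tsum fun z => ?_ : _ ≤ ∑' ξ : ℤ,
    ∑' z : ℤ × ℤ, 2 * (resWeight ξ z.1 z.2 ^ (1 / 2 + η) * (g ξ *
      triInt (fun s => jap s ^ (-(1 / 2 - η))) (Q₁ (ξ - z.1)) (Q₂ (ξ - z.2))
        (Q₃ (ξ - z.1 - z.2)) (2 * (z.1 * z.2 : ℤ))) +
      (resWeight ξ z.1 z.2 ^ (1 / 2 : ℝ) * (g ξ * triInt japInv (halfMul (Q₁ (ξ - z.1)))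
        (Q₂ (ξ - z.2)) (Q₃ (ξ - z.1 - z.2)) (2 * (z.1 * z.2 : ℤ))) +
      resWeight ξ z.1 z.2 ^ (1 / 2 : ℝ) * (g ξ * triInt japInv (halfMul (Q₂ (ξ - z.2)))
        (Q₁ (ξ - z.1)) (Q₃ (ξ - z.1 - z.2)) (2 * (z.1 * z.2 : ℤ))) +
      resWeight ξ z.1 z.2 ^ (1 / 2 : ℝ) * (g ξ * triInt japInv (halfMul (Q₃ (ξ - z.1 - z.2)))
        (Q₁ (ξ - z.1)) (Q₂ (ξ - z.2)) (2 * (z.1 * z.2 : ℤ)))))).trans ?_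
  · split_ifs with hz
    · exact zero_le
    · rw [mul_left_comm]
      refine (mul_le_mul_right (freqRatio_mul_triInt_le hη hη2 hz (h₁ _) (h₂ _) (h₃ _))
        (g ξ)).trans_eq ?_
      ring
  · simp_rw [ENNReal.tsum_mul_left, ENNReal.tsum_add]
    refine (mul_le_mul_right (add_le_add (H₀ g Q₁ Q₂ Q₃ h₁ h₂ h₃) (add_le_add (add_le_add
      (H₁ g Q₁ Q₂ Q₃ h₁ h₂ h₃) (H₂ g Q₁ Q₂ Q₃ h₁ h₂ h₃)) (H₃ g Q₁ Q₂ Q₃ h₁ h₂ h₃))) 2).trans ?_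
    set M₁ := normProd q' r' (1 / 2) (β / 2) (β / 2) Q₁ Q₂ Q₃
    set M₂ := normProd q' r' (β / 2) (1 / 2) (β / 2) Q₁ Q₂ Q₃
    set M₃ := normProd q' r' (β / 2) (β / 2) (1 / 2) Q₁ Q₂ Q₃
    have e₁ : M₁ ≤ M₁ + M₂ + M₃ := le_add_right le_self_add
    have e₂ : M₂ ≤ M₁ + M₂ + M₃ := le_add_right le_add_self
    have e₃ : M₃ ≤ M₁ + M₂ + M₃ := le_add_self
    calc _ ≤ 2 * (C₀ * (lpNorm r g * (M₁ + M₂ + M₃)) + (C₁ * (lpNorm r g * (M₁ + M₂ + M₃)) +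
          C₂ * (lpNorm r g * (M₁ + M₂ + M₃)) + C₃ * (lpNorm r g * (M₁ + M₂ + M₃)))) := by gcongr
      _ = _ := by ring

end regions

/-! ### Plancherel theory on the intersection of `L¹` and `L²`. -/

section fourier
open FourierTransform SchwartzMap Real
open scoped ContDiff

variable {f g : ℝ → ℂ}

theorem ae_eq_of_integral_schwartz_eq (hf : LocallyIntegrable f) (hg : LocallyIntegrable g)
    (h : ∀ φ : 𝓢(ℝ, ℂ), ∫ x, φ x • f x = ∫ x, φ x • g x) : f =ᵐ[volume] g := by
  refine ae_eq_of_integral_contDiff_smul_eq hf hg fun φ hφ hφc => ?_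
  have h₁ : HasCompactSupport (Complex.ofRealCLM ∘ φ) := hφc.comp_left rfl
  have h₂ : ContDiff ℝ ∞ (Complex.ofRealCLM ∘ φ) := by fun_prop
  simpa using h (h₁.toSchwartzMap h₂)

theorem integral_schwartz_smul_fourier (hf : Integrable f) (φ : 𝓢(ℝ, ℂ)) :
    ∫ x, φ x • 𝓕 f x = ∫ x, (𝓕 φ) x • f x := by
  have := VectorFourier.integral_fourierIntegral_smul_eq_flip (L := innerₗ ℝ)
    Real.continuous_fourierChar continuous_inner (φ.integrable (μ := volume)) hf
  simpa using! this.symm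

theorem integral_schwartz_smul_fourier_Lp (k : Lp (α := ℝ) ℂ 2) (φ : 𝓢(ℝ, ℂ)) :
    ∫ x, φ x • (𝓕 k : Lp (α := ℝ) ℂ 2) x = ∫ x, (𝓕 φ) x • k x := by
  rw [← Lp.toTemperedDistribution_apply, ← Lp.fourier_toTemperedDistribution_eq,
    TemperedDistribution.fourier_apply, Lp.toTemperedDistribution_apply]

theorem continuous_fourier_of_integrable (hf : Integrable f) : Continuous (𝓕 f) :=
  VectorFourier.fourierIntegral_continuous Real.continuous_fourierChar
    (L := innerₗ ℝ) continuous_inner hf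

/-- The transform defined on `L²` and the Fourier integral have the same pairing with every Schwartz
function, hence agree almost everywhere. -/
theorem coeFn_fourier_toLp (hf : Integrable f) (hf2 : MemLp f 2) :
    ((𝓕 (hf2.toLp f) : Lp (α := ℝ) ℂ 2) : ℝ → ℂ) =ᵐ[volume] 𝓕 f := by
  refine ae_eq_of_integral_schwartz_eq ((Lp.memLp _).locallyIntegrable one_le_two)
    (continuous_fourier_of_integrable hf).locallyIntegrable fun φ => ?_
  rw [integral_schwartz_smul_fourier_Lp, integral_schwartz_smul_fourier hf]
  refine integral_congr_ae ?_
  filter_upwards [hf2.coeFn_toLp] with x hx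
  rw [hx]

theorem eLpNorm_fourier_eq (hf : Integrable f) (hf2 : MemLp f 2) :
    eLpNorm (𝓕 f) 2 = eLpNorm f 2 := by
  have h := congrArg ENNReal.ofReal (Lp.norm_fourier_eq (hf2.toLp f))
  rw [ofReal_norm, ofReal_norm, Lp.enorm_def, Lp.enorm_def,
    eLpNorm_congr_ae (coeFn_fourier_toLp hf hf2), eLpNorm_congr_ae hf2.coeFn_toLp] at h
  exact h

/-- The inverse `L²` transform of `𝓕 f` and `f` itself define the same distribution. This direction
recovers `L²` membership of products of coefficients from bounds on their transforms. -/
theorem memLp_of_memLp_fourier (hf : Integrable f) (hf2 : MemLp (𝓕 f) 2) : MemLp f 2 := by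
  let k₀ : Lp (α := ℝ) ℂ 2 := hf2.toLp (𝓕 f)
  let k : Lp (α := ℝ) ℂ 2 := 𝓕⁻ k₀
  have hk : 𝓕 k = k₀ := fourier_fourierInv_eq k₀
  refine (Lp.memLp k).ae_eq (ae_eq_of_integral_schwartz_eq
    ((Lp.memLp _).locallyIntegrable one_le_two) hf.locallyIntegrable fun φ => ?_)
  have hφ : 𝓕 (𝓕⁻ φ) = φ := fourier_fourierInv_eq φ
  rw [← hφ, ← integral_schwartz_smul_fourier_Lp, ← integral_schwartz_smul_fourier hf, hk]
  refine integral_congr_ae ?_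
  filter_upwards [hf2.coeFn_toLp] with x hx
  rw [hx]

theorem integral_conj_fourier_mul_fourier (hf : Integrable f) (hf2 : MemLp f 2)
    (hg : Integrable g) (hg2 : MemLp g 2) :
    ∫ x, starRingEnd ℂ (𝓕 f x) * 𝓕 g x = ∫ x, starRingEnd ℂ (f x) * g x := by
  have := Lp.inner_fourier_eq (hf2.toLp f) (hg2.toLp g)
  rw [L2.inner_def, L2.inner_def] at this
  refine (integral_congr_ae ?_).trans (this.trans (integral_congr_ae ?_))
  · filter_upwards [coeFn_fourier_toLp hf hf2, coeFn_fourier_toLp hg hg2] with x h1 h2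
    rw [h1, h2, RCLike.inner_apply, mul_comm]
  · filter_upwards [hf2.coeFn_toLp, hg2.coeFn_toLp] with x h1 h2
    rw [h1, h2, RCLike.inner_apply, mul_comm]

end fourier

/-! ### The unitary Fourier transform in time. -/

section timeFourier
open FourierTransform Real

variable {f g h : ℝ → ℂ}

theorem timeFourier_eq (f : ℝ → ℂ) (τ : ℝ) :
    timeFourier f τ = ((√(2 * π) : ℝ) : ℂ)⁻¹ * 𝓕 f (τ / (2 * π)) := by
  unfold timeFourier
  rw [Real.fourier_real_eq_integral_exp_smul]
  congr 1
  refine integral_congr_ae (Filter.Eventually.of_forall fun t => ?_)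
  simp only [smul_eq_mul]
  congr 2
  push_cast
  have : (π : ℂ) ≠ 0 := by exact_mod_cast pi_ne_zero
  field_simp

theorem lintegral_comp_div {c : ℝ} (hc : 0 < c) (F : ℝ → ℝ≥0∞) :
    ∫⁻ x, F (x / c) = ENNReal.ofReal c * ∫⁻ x, F x := by
  have h := Real.smul_map_volume_mul_left (a := c⁻¹) (by positivity)
  have e : (MeasurableEquiv.mulLeft₀ c⁻¹ (by positivity)).toFun = fun x => c⁻¹ * x := rfl
  calc _ = ∫⁻ x, F ((MeasurableEquiv.mulLeft₀ c⁻¹ (by positivity)) x) := by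
        refine lintegral_congr fun x => ?_
        simp [div_eq_inv_mul]
    _ = ENNReal.ofReal c * (ENNReal.ofReal |c⁻¹| *
        ∫⁻ x, F ((MeasurableEquiv.mulLeft₀ c⁻¹ (by positivity)) x)) := by
        rw [← mul_assoc, ← ENNReal.ofReal_mul hc.le, abs_of_pos (by positivity),
          mul_inv_cancel₀ hc.ne', ENNReal.ofReal_one, one_mul]
    _ = _ := by
        rw [← lintegral_map_equiv, ← smul_eq_mul (ENNReal.ofReal |c⁻¹|), ← lintegral_smul_measure]
        congr 2

theorem continuous_timeFourier (hf : Integrable f) : Continuous (timeFourier f) := by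
  have : timeFourier f = fun τ => ((√(2 * π) : ℝ) : ℂ)⁻¹ * 𝓕 f (τ / (2 * π)) :=
    funext (timeFourier_eq f)
  rw [this]
  exact continuous_const.mul ((continuous_fourier_of_integrable hf).comp (by fun_prop))

theorem one_le_sqrt_two_pi : 1 ≤ √(2 * π) := by
  rw [Real.one_le_sqrt]
  linarith [pi_gt_three]

theorem enorm_sqrt_two_pi_inv : ‖((√(2 * π) : ℝ) : ℂ)⁻¹‖ₑ = ENNReal.ofReal (√(2 * π))⁻¹ := by
  rw [← ofReal_norm, norm_inv, Complex.norm_real, Real.norm_of_nonneg (by positivity)]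

theorem lintegral_enorm_timeFourier_sq (hf : Integrable f) (hf2 : MemLp f 2) :
    ∫⁻ τ, ‖timeFourier f τ‖ₑ ^ 2 = ∫⁻ t, ‖f t‖ₑ ^ 2 := by
  have e : ∀ F : ℝ → ℂ, ∫⁻ t, ‖F t‖ₑ ^ 2 = eLpNorm F 2 ^ 2 := fun F => by
    rw [eLpNorm_eq_lintegral_rpow_enorm_toReal (by norm_num) (by norm_num)]
    simp only [ENNReal.toReal_ofNat, ENNReal.rpow_ofNat]
    exact (sq_rpow_half _).symm
  simp_rw [timeFourier_eq, enorm_mul, mul_pow, enorm_sqrt_two_pi_inv]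
  rw [lintegral_const_mul' _ _ (by finiteness),
    lintegral_comp_div two_pi_pos fun τ => ‖𝓕 f τ‖ₑ ^ 2, e, e f, eLpNorm_fourier_eq hf hf2,
    ← mul_assoc, ← ENNReal.ofReal_pow (by positivity), ← ENNReal.ofReal_mul (by positivity),
    inv_pow, Real.sq_sqrt two_pi_pos.le, inv_mul_cancel₀ two_pi_pos.ne', ENNReal.ofReal_one,
    one_mul]

theorem memLp_of_lintegral_timeFourier_sq (hf : Integrable f)
    (h : ∫⁻ τ, ‖timeFourier f τ‖ₑ ^ 2 < ∞) : MemLp f 2 := by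
  refine memLp_of_memLp_fourier hf
    ⟨(continuous_fourier_of_integrable hf).aestronglyMeasurable, ?_⟩
  simp_rw [timeFourier_eq, enorm_mul, mul_pow, enorm_sqrt_two_pi_inv] at h
  rw [lintegral_const_mul' _ _ (by finiteness),
    lintegral_comp_div two_pi_pos fun τ => ‖𝓕 f τ‖ₑ ^ 2, ← mul_assoc] at h
  rw [eLpNorm_lt_top_iff_lintegral_rpow_enorm_lt_top (by norm_num) (by norm_num)]
  simp only [ENNReal.toReal_ofNat, ENNReal.rpow_ofNat]
  refine ENNReal.lt_top_of_mul_ne_top_right h.ne (mul_ne_zero ?_ ?_)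
  · exact pow_ne_zero _ (by simpa using by positivity)
  · simpa using by positivity

theorem enorm_timeFourier_le (f : ℝ → ℂ) (τ : ℝ) :
    ‖timeFourier f τ‖ₑ ≤ ENNReal.ofReal (√(2 * π))⁻¹ * ∫⁻ t, ‖f t‖ₑ := by
  unfold timeFourier
  rw [enorm_mul, enorm_sqrt_two_pi_inv]
  gcongr
  refine (enorm_integral_le_lintegral_enorm _).trans_eq (lintegral_congr fun t => ?_)
  rw [enorm_mul, ← ofReal_norm (Complex.exp _), norm_timeKernel, ENNReal.ofReal_one, one_mul]

theorem fourier_conj (f : ℝ → ℂ) (w : ℝ) :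
    𝓕 (fun t => starRingEnd ℂ (f t)) w = starRingEnd ℂ (𝓕 f (-w)) := by
  rw [Real.fourier_real_eq_integral_exp_smul, Real.fourier_real_eq_integral_exp_smul,
    ← integral_conj]
  refine integral_congr_ae (Filter.Eventually.of_forall fun t => ?_)
  simp only [smul_eq_mul, map_mul, ← Complex.exp_conj, Complex.conj_I, Complex.conj_ofReal]
  congr 2
  push_cast
  ring

theorem timeFourier_conj (f : ℝ → ℂ) (τ : ℝ) :
    timeFourier (fun t => starRingEnd ℂ (f t)) τ = starRingEnd ℂ (timeFourier f (-τ)) := by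
  rw [timeFourier_eq, timeFourier_eq, fourier_conj, map_mul, map_inv₀, Complex.conj_ofReal, neg_div]

theorem fourier_exp_mul (f : ℝ → ℂ) (v w : ℝ) :
    𝓕 (fun t => Complex.exp (((-2 * π * t * w : ℝ) : ℂ) * Complex.I) * f t) v = 𝓕 f (v + w) := by
  rw [Real.fourier_real_eq_integral_exp_smul, Real.fourier_real_eq_integral_exp_smul]
  refine integral_congr_ae (Filter.Eventually.of_forall fun t => ?_)
  simp only [smul_eq_mul]
  rw [← mul_assoc, ← Complex.exp_add]
  congr 2
  push_cast
  ring

/-- Parseval for `conj f` and `e^{-2πitw} g`. The formula holds at every `w`, not only almost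
everywhere. -/
theorem fourier_mul (hf : Integrable f) (hf2 : MemLp f 2) (hg : Integrable g) (hg2 : MemLp g 2)
    (w : ℝ) : 𝓕 (fun t => f t * g t) w = ∫ s, 𝓕 f (-s) * 𝓕 g (s + w) := by
  have hc : Continuous fun t : ℝ => Complex.exp (((-2 * π * t * w : ℝ) : ℂ) * Complex.I) := by
    fun_prop
  have hn : ∀ t : ℝ, ‖Complex.exp (((-2 * π * t * w : ℝ) : ℂ) * Complex.I)‖ = 1 := fun t =>
    Complex.norm_exp_ofReal_mul_I _
  have key := integral_conj_fourier_mul_fourier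
    (f := fun t => starRingEnd ℂ (f t))
    (g := fun t => Complex.exp (((-2 * π * t * w : ℝ) : ℂ) * Complex.I) * g t)
    (by simpa using (Complex.conjCLE.toContinuousLinearMap.integrable_comp hf)) hf2.star
    (hg.bdd_mul (c := 1) hc.aestronglyMeasurable (Filter.Eventually.of_forall fun t => (hn t).le))
    (hg2.of_le (hc.aestronglyMeasurable.mul hg2.1)
      (Filter.Eventually.of_forall fun t => by rw [norm_mul, hn, one_mul]))
  simp only [fourier_conj, fourier_exp_mul, Complex.conj_conj] at key
  rw [key, Real.fourier_real_eq_integral_exp_smul]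
  refine integral_congr_ae (Filter.Eventually.of_forall fun t => ?_)
  simp only [smul_eq_mul]
  ring

theorem enorm_timeFourier_mul_le (hf : Integrable f) (hf2 : MemLp f 2) (hg : Integrable g)
    (hg2 : MemLp g 2) (τ : ℝ) :
    ‖timeFourier (fun t => f t * g t) τ‖ₑ ≤
      ∫⁻ s, ‖timeFourier f (-s)‖ₑ * ‖timeFourier g (s + τ)‖ₑ := by
  simp_rw [timeFourier_eq, fourier_mul hf hf2 hg hg2, enorm_mul, enorm_sqrt_two_pi_inv]
  set c := ENNReal.ofReal (√(2 * π))⁻¹ with hc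
  -- In this normalization the convolution formula carries the factor `(2π)^{-1/2}`, which is simply
  -- dropped.
  have hc1 : c ≤ 1 := by
    rw [hc, ← ENNReal.ofReal_one]
    exact ENNReal.ofReal_le_ofReal (inv_le_one_of_one_le₀ one_le_sqrt_two_pi)
  have e : ∫⁻ s, c * ‖𝓕 f (-s / (2 * π))‖ₑ * (c * ‖𝓕 g ((s + τ) / (2 * π))‖ₑ) =
      ∫⁻ s, ‖𝓕 f (-s)‖ₑ * ‖𝓕 g (s + τ / (2 * π))‖ₑ := by
    simp_rw [mul_mul_mul_comm c, neg_div, add_div]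
    rw [lintegral_const_mul' _ _ (by finiteness), lintegral_comp_div two_pi_pos
      fun s => ‖𝓕 f (-s)‖ₑ * ‖𝓕 g (s + τ / (2 * π))‖ₑ, ← mul_assoc, hc,
      ← ENNReal.ofReal_mul (by positivity), ← ENNReal.ofReal_mul (by positivity), ← mul_inv,
      Real.mul_self_sqrt two_pi_pos.le, inv_mul_cancel₀ two_pi_pos.ne', ENNReal.ofReal_one,
      one_mul]
  rw [e]
  refine (mul_le_of_le_one_left' hc1).trans ((enorm_integral_le_lintegral_enorm _).trans_eq ?_)
  simp_rw [enorm_mul]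

end timeFourier

/-! ### Convolutions of nonnegative functions and products of coefficients. -/

section convolution
variable {Φ A B C : ℝ → ℝ≥0∞}

/-- The convolution of two nonnegative functions. -/
def conv (A B : ℝ → ℝ≥0∞) (τ : ℝ) : ℝ≥0∞ := ∫⁻ s, A (-s) * B (s + τ)

@[fun_prop]
theorem measurable_conv (hA : Measurable A) (hB : Measurable B) : Measurable (conv A B) := by
  refine Measurable.lintegral_prod_right' (f := fun z : ℝ × ℝ => A (-z.2) * B (z.2 + z.1)) ?_
  fun_prop

theorem lintegral_mul_conv (hΦ : Measurable Φ) (hA : Measurable A) (hB : Measurable B) :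
    ∫⁻ τ, Φ τ * conv A B τ = ∫⁻ x, A x * ∫⁻ y, B y * Φ (x + y) := by
  calc _ = ∫⁻ τ, ∫⁻ s, Φ τ * (A (-s) * B (s + τ)) :=
        lintegral_congr fun τ => (lintegral_const_mul _ (by fun_prop)).symm
    _ = ∫⁻ s, ∫⁻ τ, Φ τ * (A (-s) * B (s + τ)) :=
        lintegral_lintegral_swap (by fun_prop)
    _ = ∫⁻ s, A (-s) * ∫⁻ τ, B (s + τ) * Φ (-s + (s + τ)) := by
        refine lintegral_congr fun s => ?_
        rw [← lintegral_const_mul _ (by fun_prop)]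
        refine lintegral_congr fun τ => ?_
        rw [neg_add_cancel_left]
        ring
    _ = ∫⁻ s, A (-s) * ∫⁻ y, B y * Φ (-s + y) :=
        lintegral_congr fun s => congrArg _
          (lintegral_add_left_eq_self (fun y => B y * Φ (-s + y)) s)
    _ = _ := lintegral_neg_eq_self fun x => A x * ∫⁻ y, B y * Φ (x + y)

theorem lintegral_mul_conv_conv (hΦ : Measurable Φ) (hA : Measurable A) (hB : Measurable B)
    (hC : Measurable C) :
    ∫⁻ τ, Φ τ * conv (conv A B) C τ = triInt Φ A B C 0 := by
  have hΦC : Measurable fun w => ∫⁻ y, C y * Φ (w + y) :=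
    Measurable.lintegral_prod_right' (f := fun z : ℝ × ℝ => C z.2 * Φ (z.1 + z.2)) (by fun_prop)
  rw [lintegral_mul_conv hΦ (by fun_prop) hC]
  simp_rw [mul_comm (conv A B _)]
  rw [lintegral_mul_conv hΦC hA hB]
  simp only [triInt, biInt, zero_add, add_assoc]

/-- Translations of the three inputs add up in the base point. Recentring each transform on its own
parabola thereby produces the resonance `2ab`. -/
theorem triInt_shift (Φ A B C : ℝ → ℝ≥0∞) (k l m n : ℝ) :
    triInt Φ (fun x => A (x - k)) (fun x => B (x - l)) (fun x => C (x - m)) n =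
      triInt Φ A B C (n + k + l + m) := by
  unfold triInt biInt
  rw [← lintegral_add_right_eq_self _ k]
  refine lintegral_congr fun x => ?_
  simp only [add_sub_cancel_right]
  rw [← lintegral_add_right_eq_self _ l]
  congr 1
  refine lintegral_congr fun y => ?_
  simp only [add_sub_cancel_right]
  rw [← lintegral_add_right_eq_self _ m]
  congr 1
  refine lintegral_congr fun z => ?_
  simp only [add_sub_cancel_right]
  congr 2
  ring

theorem triInt_translate (Φ A B C : ℝ → ℝ≥0∞) (k n : ℝ) :
    triInt (fun x => Φ (x + k)) A B C n = triInt Φ A B C (n + k) := by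
  unfold triInt biInt
  refine lintegral_congr fun x => congrArg _ (lintegral_congr fun y => congrArg _
    (lintegral_congr fun z => congrArg _ (congrArg Φ ?_)))
  ring

/-- Cauchy–Schwarz with the weights `⟨·+m⟩^{1/2}`, `⟨·+n⟩^{1/2}`: the integral of the product of the
inverse weights squared is bounded uniformly in `m`, `n` and `τ`. -/
theorem conv_sq_le (hA : Measurable A) (hB : Measurable B) (m n τ : ℝ) :
    conv A B τ ^ 2 ≤ 4 * japInt 2 * conv (fun σ => jap (σ + m) * A σ ^ 2)
      (fun σ => jap (σ + n) * B σ ^ 2) τ := by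
  have h1 : ∫⁻ s, (jap (-s + m) ^ (-(1 / 2) : ℝ) * jap (s + τ + n) ^ (-(1 / 2) : ℝ)) ^ 2 ≤
      4 * japInt 2 := by
    calc _ = ∫⁻ s, jap (s - m) ^ (-1 : ℝ) * jap (m + τ + n + (s - m)) ^ (-1 : ℝ) := by
          refine lintegral_congr fun s => ?_
          rw [mul_pow, ← ENNReal.rpow_mul_natCast, ← ENNReal.rpow_mul_natCast, ← jap_neg (s - m),
            neg_sub, neg_add_eq_sub, show m + τ + n + (s - m) = s + τ + n by ring]
          norm_num
      _ = ∫⁻ s, jap s ^ (-1 : ℝ) * jap (m + τ + n + s) ^ (-1 : ℝ) :=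
          lintegral_sub_right_eq_self
            (fun s => jap s ^ (-1 : ℝ) * jap (m + τ + n + s) ^ (-1 : ℝ)) m
      _ ≤ _ := (lintegral_jap_mul_jap_le le_rfl le_rfl le_rfl (by norm_num) _).trans_eq
          (by norm_num)
  have hone : ∀ x, jap x ^ (-(1 / 2) : ℝ) * jap x ^ (1 / 2 : ℝ) = 1 := fun x => by
    rw [← jap_rpow_add, neg_add_cancel, ENNReal.rpow_zero]
  calc conv A B τ ^ 2 = (∫⁻ s, jap (-s + m) ^ (-(1 / 2) : ℝ) * jap (s + τ + n) ^ (-(1 / 2) : ℝ) *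
        (jap (-s + m) ^ (1 / 2 : ℝ) * A (-s) * (jap (s + τ + n) ^ (1 / 2 : ℝ) * B (s + τ)))) ^ 2 := by
        congr 1
        refine lintegral_congr fun s => ?_
        calc _ = (jap (-s + m) ^ (-(1 / 2) : ℝ) * jap (-s + m) ^ (1 / 2 : ℝ)) *
              (jap (s + τ + n) ^ (-(1 / 2) : ℝ) * jap (s + τ + n) ^ (1 / 2 : ℝ)) *
              (A (-s) * B (s + τ)) := by rw [hone, hone, one_mul, one_mul]
          _ = _ := by ring
    _ ≤ _ := sq_lintegral_mul_le (by fun_prop) (by fun_prop)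
    _ ≤ _ := by
        refine mul_le_mul' h1 (le_of_eq (lintegral_congr fun s => ?_))
        rw [mul_pow, mul_pow, mul_pow, sq_rpow_half, sq_rpow_half]

theorem lintegral_conv_sq_lt_top (hA : Measurable A) (hB : Measurable B) {m n : ℝ}
    (hA2 : ∫⁻ σ, jap (σ + m) * A σ ^ 2 < ∞) (hB2 : ∫⁻ σ, jap (σ + n) * B σ ^ 2 < ∞) :
    ∫⁻ τ, conv A B τ ^ 2 < ∞ := by
  refine (lintegral_mono fun τ => conv_sq_le hA hB m n τ).trans_lt ?_
  have := lintegral_mul_conv (Φ := fun _ => 1) measurable_const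
    (A := fun σ => jap (σ + m) * A σ ^ 2) (B := fun σ => jap (σ + n) * B σ ^ 2)
    (by fun_prop) (by fun_prop)
  simp only [one_mul, mul_one] at this
  rw [lintegral_const_mul _ (by fun_prop), this, lintegral_mul_const _ (by fun_prop)]
  have := japInt_lt_top (p := 2) (by norm_num)
  finiteness

end convolution

section products
variable {f g h : ℝ → ℂ}

theorem measurable_enorm_timeFourier (hf : Integrable f) :
    Measurable fun τ => ‖timeFourier f τ‖ₑ :=
  (continuous_timeFourier hf).measurable.enorm

/-- Half a derivative on each factor puts the product in `L²`. Hence triple products are integrable,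
and the product rule for transforms can be applied a second time. -/
theorem memLp_mul_of_weighted (hf : Integrable f) (hf2 : MemLp f 2) (hg : Integrable g)
    (hg2 : MemLp g 2) {m n : ℝ} (hfw : ∫⁻ σ, jap (σ + m) * ‖timeFourier f σ‖ₑ ^ 2 < ∞)
    (hgw : ∫⁻ σ, jap (σ + n) * ‖timeFourier g σ‖ₑ ^ 2 < ∞) :
    MemLp (fun t => f t * g t) 2 := by
  refine memLp_of_lintegral_timeFourier_sq (hf2.integrable_mul hg2) ?_
  refine (lintegral_mono fun τ => pow_le_pow_left' (enorm_timeFourier_mul_le hf hf2 hg hg2 τ)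
    2).trans_lt ?_
  exact lintegral_conv_sq_lt_top (measurable_enorm_timeFourier hf)
    (measurable_enorm_timeFourier hg) hfw hgw

theorem integrable_mul_mul_of_weighted (hf : Integrable f) (hf2 : MemLp f 2) (hg : Integrable g)
    (hg2 : MemLp g 2) (hh2 : MemLp h 2) {m n : ℝ}
    (hfw : ∫⁻ σ, jap (σ + m) * ‖timeFourier f σ‖ₑ ^ 2 < ∞)
    (hgw : ∫⁻ σ, jap (σ + n) * ‖timeFourier g σ‖ₑ ^ 2 < ∞) :
    Integrable fun t => f t * g t * h t :=
  (memLp_mul_of_weighted hf hf2 hg hg2 hfw hgw).integrable_mul hh2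

theorem lintegral_mul_enorm_timeFourier_le {Φ : ℝ → ℝ≥0∞} (hΦ : Measurable Φ) (hf : Integrable f)
    (hf2 : MemLp f 2) (hg : Integrable g) (hg2 : MemLp g 2) (hh : Integrable h) (hh2 : MemLp h 2)
    {m n : ℝ} (hfw : ∫⁻ σ, jap (σ + m) * ‖timeFourier f σ‖ₑ ^ 2 < ∞)
    (hgw : ∫⁻ σ, jap (σ + n) * ‖timeFourier g σ‖ₑ ^ 2 < ∞) :
    ∫⁻ τ, Φ τ * ‖timeFourier (fun t => f t * g t * h t) τ‖ₑ ≤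
      triInt Φ (fun σ => ‖timeFourier f σ‖ₑ) (fun σ => ‖timeFourier g σ‖ₑ)
        (fun σ => ‖timeFourier h σ‖ₑ) 0 := by
  rw [← lintegral_mul_conv_conv hΦ (measurable_enorm_timeFourier hf)
    (measurable_enorm_timeFourier hg) (measurable_enorm_timeFourier hh)]
  refine lintegral_mono fun τ => mul_le_mul_right ?_ _
  refine (enorm_timeFourier_mul_le (hf2.integrable_mul hg2)
    (memLp_mul_of_weighted hf hf2 hg hg2 hfw hgw) hh hh2 τ).trans ?_
  exact lintegral_mono fun s => mul_le_mul_left (enorm_timeFourier_mul_le hf hf2 hg hg2 (-s)) _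

end products

/-! ### Gain from localization in time. -/

section localization
variable {f : ℝ → ℂ} {T : ℝ}

theorem sq_lintegral_enorm_le (hf2 : MemLp f 2) (hs : ∀ᵐ t : ℝ, T < |t| → f t = 0) :
    (∫⁻ t, ‖f t‖ₑ) ^ 2 ≤ ENNReal.ofReal (2 * T) * ∫⁻ t, ‖f t‖ₑ ^ 2 := by
  have hS : MeasurableSet (Set.Icc (-T) T) := measurableSet_Icc
  calc _ = (∫⁻ t, (Set.Icc (-T) T).indicator 1 t * ‖f t‖ₑ) ^ 2 := by
        congr 1
        refine lintegral_congr_ae ?_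
        filter_upwards [hs] with t ht
        by_cases h : t ∈ Set.Icc (-T) T
        · simp [h]
        · have : T < |t| := by
            by_contra! hcon
            exact h (abs_le.mp hcon)
          simp [ht this]
    _ ≤ _ := by
        refine (sq_lintegral_mul_le (by fun_prop (disch := assumption)) hf2.1.enorm).trans_eq ?_
        congr 1
        have : ∀ t, (Set.Icc (-T) T).indicator (1 : ℝ → ℝ≥0∞) t ^ 2 =
            (Set.Icc (-T) T).indicator 1 t := fun t => by
          by_cases h : t ∈ Set.Icc (-T) T <;> simp [h]
        simp_rw [this]
        rw [lintegral_indicator_one hS, Real.volume_Icc]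
        congr 1
        ring

theorem integrable_of_memLp_of_support (hf2 : MemLp f 2)
    (hs : ∀ᵐ t : ℝ, T < |t| → f t = 0) : Integrable f := by
  refine ⟨hf2.1, ?_⟩
  have h := sq_lintegral_enorm_le hf2 hs
  have h2 : ∫⁻ t, ‖f t‖ₑ ^ 2 < ∞ := by
    simpa using (eLpNorm_lt_top_iff_lintegral_rpow_enorm_lt_top (f := f) (by norm_num)
      (by norm_num)).mp hf2.2
  have : (∫⁻ t, ‖f t‖ₑ) ^ 2 < ∞ := h.trans_lt (by finiteness)
  exact (ENNReal.pow_lt_top_iff.mp this).resolve_right (by norm_num)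

/-- For a function supported in `|t| ≤ T` at least half of the mass of its Fourier transform lies
outside every interval of length `1 / T`. -/
theorem lintegral_enorm_timeFourier_sq_le (hf2 : MemLp f 2) (hT : 0 < T)
    (hs : ∀ᵐ t : ℝ, T < |t| → f t = 0) (m : ℝ) :
    ∫⁻ σ, ‖timeFourier f σ‖ₑ ^ 2 ≤
      ENNReal.ofReal (4 * T) * ∫⁻ σ, jap (σ + m) * ‖timeFourier f σ‖ₑ ^ 2 := by
  have hf := integrable_of_memLp_of_support hf2 hs
  set M := ∫⁻ σ, ‖timeFourier f σ‖ₑ ^ 2 with hM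
  have hMf : M = ∫⁻ t, ‖f t‖ₑ ^ 2 := lintegral_enorm_timeFourier_sq hf hf2
  have hMtop : M ≠ ∞ := by
    rw [hMf]
    simpa using ((eLpNorm_lt_top_iff_lintegral_rpow_enorm_lt_top (f := f) (by norm_num)
      (by norm_num)).mp hf2.2).ne
  -- A uniform bound on the transform through the `L¹` norm, with Cauchy–Schwarz on an interval of
  -- length `2T`.
  have hpt : ∀ σ, ‖timeFourier f σ‖ₑ ^ 2 ≤ ENNReal.ofReal (T / Real.pi) * M := fun σ => by
    calc _ ≤ (ENNReal.ofReal (√(2 * Real.pi))⁻¹ * ∫⁻ t, ‖f t‖ₑ) ^ 2 :=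
          pow_le_pow_left' (enorm_timeFourier_le f σ) 2
      _ ≤ ENNReal.ofReal (√(2 * Real.pi))⁻¹ ^ 2 * (ENNReal.ofReal (2 * T) * M) := by
          rw [mul_pow, hMf]
          exact mul_le_mul_right (sq_lintegral_enorm_le hf2 hs) _
      _ = _ := by
          rw [← mul_assoc, ← ENNReal.ofReal_pow (by positivity),
            ← ENNReal.ofReal_mul (by positivity), inv_pow, Real.sq_sqrt (by positivity)]
          congr 2
          field_simp
  set S : Set ℝ := Set.Icc (-m - 1 / (2 * T)) (-m + 1 / (2 * T)) with hS
  have hSm : MeasurableSet S := measurableSet_Icc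
  -- `S` has length `1/T`, so it carries at most the fraction `1/π` of the mass, less than one half.
  -- Off `S` one has `2T ⟨σ+m⟩ ≥ 1`.
  have h1 : ∫⁻ σ in S, ‖timeFourier f σ‖ₑ ^ 2 ≤ M / 2 := by
    calc _ ≤ ∫⁻ _ in S, ENNReal.ofReal (T / Real.pi) * M := lintegral_mono fun σ => hpt σ
      _ = ENNReal.ofReal (1 / Real.pi) * M := by
          rw [setLIntegral_const, hS, Real.volume_Icc, mul_right_comm,
            ← ENNReal.ofReal_mul (by positivity)]
          congr 2
          field_simp
          ring
      _ ≤ ENNReal.ofReal (1 / 2) * M := by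
          gcongr
          linarith [Real.pi_gt_three]
      _ = _ := by
          rw [one_div, ENNReal.ofReal_inv_of_pos two_pos, ENNReal.ofReal_ofNat, mul_comm,
            div_eq_mul_inv]
  have h2 : M ≤ M / 2 + ∫⁻ σ in Sᶜ, ‖timeFourier f σ‖ₑ ^ 2 := by
    calc M = _ := (lintegral_add_compl _ hSm).symm
      _ ≤ _ := add_le_add_left h1 _
  have h3 : M / 2 ≤ ∫⁻ σ in Sᶜ, ‖timeFourier f σ‖ₑ ^ 2 := by
    rw [← ENNReal.add_halves M, ENNReal.add_halves (M)] at h2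
    nth_rewrite 1 [← ENNReal.add_halves M] at h2
    exact (ENNReal.add_le_add_iff_left (ENNReal.div_ne_top hMtop (by norm_num))).mp h2
  have h4 : ∫⁻ σ in Sᶜ, ‖timeFourier f σ‖ₑ ^ 2 ≤
      ENNReal.ofReal (2 * T) * ∫⁻ σ, jap (σ + m) * ‖timeFourier f σ‖ₑ ^ 2 := by
    rw [← lintegral_const_mul' _ _ (by finiteness)]
    refine (setLIntegral_mono' hSm.compl fun σ hσ => ?_).trans (setLIntegral_le_lintegral _ _)
    rw [← mul_assoc]
    refine le_mul_of_one_le_left' ?_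
    rw [jap, ← ENNReal.ofReal_mul (by positivity), ← ENNReal.ofReal_one]
    refine ENNReal.ofReal_le_ofReal ?_
    have h5 : 1 / (2 * T) ≤ |σ + m| := by
      by_contra! hcon
      rw [abs_lt] at hcon
      exact hσ ⟨by linarith [hcon.1], by linarith [hcon.2]⟩
    calc (1 : ℝ) = 2 * T * (1 / (2 * T)) := by field_simp
      _ ≤ _ := by gcongr; exact h5.trans (abs_le_bracket _)
  calc M = 2 * (M / 2) := (ENNReal.mul_div_cancel (by norm_num) (by norm_num)).symm
    _ ≤ 2 * (ENNReal.ofReal (2 * T) * ∫⁻ σ, jap (σ + m) * ‖timeFourier f σ‖ₑ ^ 2) :=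
        mul_le_mul_right (h3.trans h4) 2
    _ = _ := by
        rw [← mul_assoc, ← ENNReal.ofReal_ofNat 2, ← ENNReal.ofReal_mul (by norm_num)]
        congr 2
        ring

/-- Hölder interpolation between the weights `⟨·⟩^0` and `⟨·⟩^1`, with the gain `4T` at the first
endpoint. -/
theorem lintegral_jap_rpow_mul_timeFourier_le (hf2 : MemLp f 2) (hT : 0 < T)
    (hs : ∀ᵐ t : ℝ, T < |t| → f t = 0) {β : ℝ} (hβ0 : 0 ≤ β) (hβ : β ≤ 1) (m : ℝ) :
    ∫⁻ σ, jap (σ + m) ^ β * ‖timeFourier f σ‖ₑ ^ 2 ≤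
      ENNReal.ofReal (4 * T) ^ (1 - β) * ∫⁻ σ, jap (σ + m) * ‖timeFourier f σ‖ₑ ^ 2 := by
  have hm := measurable_enorm_timeFourier (integrable_of_memLp_of_support hf2 hs)
  set E := ∫⁻ σ, jap (σ + m) * ‖timeFourier f σ‖ₑ ^ 2 with hE
  calc _ = ∫⁻ σ, (‖timeFourier f σ‖ₑ ^ 2) ^ (1 - β) *
        (jap (σ + m) * ‖timeFourier f σ‖ₑ ^ 2) ^ β := by
        refine lintegral_congr fun σ => ?_
        rw [ENNReal.mul_rpow_of_nonneg _ _ hβ0, mul_left_comm,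
          ← ENNReal.rpow_add_of_nonneg _ _ (by linarith) hβ0, sub_add_cancel, ENNReal.rpow_one]
    _ ≤ (∫⁻ σ, ‖timeFourier f σ‖ₑ ^ 2) ^ (1 - β) * E ^ β :=
        ENNReal.lintegral_mul_norm_pow_le (hm.pow_const 2).aemeasurable (by fun_prop) (by linarith) hβ0
          (by linarith)
    _ ≤ (ENNReal.ofReal (4 * T) * E) ^ (1 - β) * E ^ β := by
        refine mul_le_mul_left (ENNReal.rpow_le_rpow ?_ (by linarith)) _
        exact lintegral_enorm_timeFourier_sq_le hf2 hT hs m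
    _ = _ := by
        rw [ENNReal.mul_rpow_of_nonneg _ _ (by linarith), mul_assoc,
          ← ENNReal.rpow_add_of_nonneg _ _ (by linarith) hβ0, sub_add_cancel, ENNReal.rpow_one]

end localization

/-! ### Sequence norms and their duality. -/

section duality
variable {r r' : ℝ}

theorem lpNorm_single (hr : 0 < r) (i : ℤ) (c : ℝ≥0∞) : lpNorm r (Pi.single i c) = c := by
  unfold lpNorm
  rw [tsum_eq_single i]
  · rw [Pi.single_eq_same, ← ENNReal.rpow_mul, mul_one_div_cancel hr.ne', ENNReal.rpow_one]
  · intro j hj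
    rw [Pi.single_eq_of_ne hj, ENNReal.zero_rpow_of_pos hr]

theorem lpNorm_mono (hr : 0 < r) {f g : ℤ → ℝ≥0∞} (h : ∀ i, f i ≤ g i) :
    lpNorm r f ≤ lpNorm r g :=
  ENNReal.rpow_le_rpow (ENNReal.tsum_le_tsum fun i => ENNReal.rpow_le_rpow (h i) hr.le)
    (by positivity)

theorem lpNorm_const_mul (hr : 0 < r) (c : ℝ≥0∞) (f : ℤ → ℝ≥0∞) :
    lpNorm r (fun i => c * f i) = c * lpNorm r f := by
  unfold lpNorm
  simp_rw [ENNReal.mul_rpow_of_nonneg _ _ hr.le, ENNReal.tsum_mul_left]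
  rw [ENNReal.mul_rpow_of_nonneg _ _ (by positivity), ← ENNReal.rpow_mul,
    mul_one_div_cancel hr.ne', ENNReal.rpow_one]

theorem lpNorm_add_le (hr : 1 ≤ r) (f g : ℤ → ℝ≥0∞) :
    lpNorm r (fun i => f i + g i) ≤ lpNorm r f + lpNorm r g := by
  have := ENNReal.lintegral_Lp_add_le (μ := (Measure.count : Measure ℤ)) (f := f) (g := g)
    (measurable_of_countable _).aemeasurable (measurable_of_countable _).aemeasurable hr
  simpa [lpNorm, lintegral_count] using this

/-- The converse of Hölder's inequality for sequences. -/
theorem lpNorm_le_of_forall_tsum_mul_le (hr : 0 < r) (hr' : 0 < r') (hrr : 1 / r + 1 / r' = 1)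
    {E : ℤ → ℝ≥0∞} {C : ℝ≥0∞} (h : ∀ g : ℤ → ℝ≥0∞, ∑' ξ, g ξ * E ξ ≤ C * lpNorm r g) :
    lpNorm r' E ≤ C := by
  rcases eq_or_ne C ∞ with rfl | hC
  · exact le_top
  have hE : ∀ i, E i ≠ ∞ := fun i => by
    have h1 := h (Pi.single i 1)
    rw [lpNorm_single hr, mul_one] at h1
    have h2 := (ENNReal.le_tsum i).trans h1
    rw [Pi.single_eq_same, one_mul] at h2
    exact ne_top_of_le_ne_top hC h2
  have hmul : (r' - 1) * r = r' := by
    field_simp at hrr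
    linarith
  have hr'1 : 0 ≤ r' - 1 := by
    by_contra! hcon
    nlinarith
  -- The extremal test sequence `E^{r'-1}` is truncated to finite sets, where the sum is finite and
  -- a power of it can be cancelled.
  have key : ∀ s : Finset ℤ, ∑ i ∈ s, E i ^ r' ≤ C ^ r' := fun s => by
    set S := ∑ i ∈ s, E i ^ r' with hS
    have hStop : S ≠ ∞ := ENNReal.sum_ne_top.mpr fun i _ =>
      ENNReal.rpow_ne_top_of_nonneg hr'.le (hE i)
    rcases eq_or_ne S 0 with h0 | h0
    · rw [h0]; exact zero_le
    have h1 := h fun i => if i ∈ s then E i ^ (r' - 1) else 0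
    have h2 : ∑' i, (if i ∈ s then E i ^ (r' - 1) else 0) * E i = S := by
      rw [tsum_eq_sum (s := s) fun i hi => by rw [if_neg hi, zero_mul]]
      refine Finset.sum_congr rfl fun i hi => ?_
      rw [if_pos hi]
      nth_rewrite 2 [← ENNReal.rpow_one (E i)]
      rw [← ENNReal.rpow_add_of_nonneg _ _ hr'1 zero_le_one, sub_add_cancel]
    have h3 : lpNorm r (fun i => if i ∈ s then E i ^ (r' - 1) else 0) = S ^ (1 / r) := by
      unfold lpNorm
      rw [tsum_eq_sum (s := s) fun i hi => by
        simp only [if_neg hi, ENNReal.zero_rpow_of_pos hr]]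
      congr 1
      refine Finset.sum_congr rfl fun i hi => ?_
      simp only [if_pos hi]
      rw [← ENNReal.rpow_mul, hmul]
    rw [h2, h3] at h1
    have h4 : S ^ (1 / r') ≤ C := by
      have e : S = S ^ (1 / r') * S ^ (1 / r) := by
        rw [← ENNReal.rpow_add _ _ h0 hStop, add_comm, hrr, ENNReal.rpow_one]
      nth_rewrite 1 [e] at h1
      exact (ENNReal.mul_le_mul_iff_left (by simp [ENNReal.rpow_eq_zero_iff, h0, hStop])
        (ENNReal.rpow_ne_top_of_nonneg (by positivity) hStop)).mp h1
    calc S = (S ^ (1 / r')) ^ r' := by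
          rw [← ENNReal.rpow_mul, one_div_mul_cancel hr'.ne', ENNReal.rpow_one]
      _ ≤ _ := ENNReal.rpow_le_rpow h4 hr'.le
  calc lpNorm r' E ≤ (C ^ r') ^ (1 / r') := by
        refine ENNReal.rpow_le_rpow ?_ (by positivity)
        rw [ENNReal.tsum_eq_iSup_sum]
        exact iSup_le key
    _ = C := by rw [← ENNReal.rpow_mul, mul_one_div_cancel hr'.ne', ENNReal.rpow_one]

end duality

/-! ### The `X` norms in terms of modulation profiles. -/

section norms
variable {s b : ℝ}

theorem eLpNorm_count_eq {p : ℝ} (hp : 0 < p) (f : ℤ → ℝ≥0∞) :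
    eLpNorm f (ENNReal.ofReal p) Measure.count = lpNorm p f := by
  rw [eLpNorm_eq_lintegral_rpow_enorm_toReal (by simpa using hp) ENNReal.ofReal_ne_top,
    ENNReal.toReal_ofReal hp.le, lintegral_count]
  rfl

theorem ennreal_conjExponent_ofReal {p : ℝ} (hp : 1 < p) :
    ENNReal.conjExponent (ENNReal.ofReal p) = ENNReal.ofReal (Real.conjExponent p) := by
  have hp1 : 0 < p - 1 := by linarith
  rw [ENNReal.conjExponent, ← ENNReal.ofReal_one, ← ENNReal.ofReal_sub _ zero_le_one,
    ← ENNReal.ofReal_inv_of_pos hp1, ← ENNReal.ofReal_add zero_le_one (by positivity),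
    Real.conjExponent]
  congr 1
  field_simp
  ring

theorem ennreal_conjExponent_two : ENNReal.conjExponent 2 = 2 := by
  rw [ENNReal.conjExponent, ← one_add_one_eq_two,
    ENNReal.add_sub_cancel_right ENNReal.one_ne_top, inv_one]

theorem ennreal_conjExponent_top : ENNReal.conjExponent ⊤ = 1 := by
  simp [ENNReal.conjExponent]

theorem enorm_weight_mul (s b x y : ℝ) (z : ℂ) :
    ‖((bracket x ^ b * bracket y ^ s : ℝ) : ℂ) * z‖ₑ = jap x ^ b * jap y ^ s * ‖z‖ₑ := by
  have hx := bracket_pos x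
  have hy := bracket_pos y
  rw [enorm_mul, ← ofReal_norm (Complex.ofReal _), Complex.norm_real,
    Real.norm_of_nonneg (by positivity), ENNReal.ofReal_mul (by positivity), jap_rpow_eq_ofReal,
    jap_rpow_eq_ofReal]

/-- The weighted modulus of a space-time Fourier transform on the fibre over `k`, as a function of
the modulation. -/
def profile (v : ℤ → ℝ → ℂ) (k : ℤ) (σ : ℝ) : ℝ≥0∞ :=
  jap k ^ (1 / 2 : ℝ) * ‖v k (σ - (k : ℝ) ^ 2)‖ₑ

/-- The reflection of `profile`. -/
def profileNeg (v : ℤ → ℝ → ℂ) (k : ℤ) (σ : ℝ) : ℝ≥0∞ := profile v k (-σ)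

theorem energy_profile (e : ℝ) (v : ℤ → ℝ → ℂ) (k : ℤ) :
    energy e (profile v k) =
      jap k * ∫⁻ σ, jap (σ + (k : ℝ) ^ 2) ^ (2 * e) * ‖v k σ‖ₑ ^ 2 := by
  unfold energy profile
  rw [← lintegral_const_mul' _ _ (jap_ne_top _), ← lintegral_add_right_eq_self _ ((k : ℝ) ^ 2)]
  refine lintegral_congr fun σ => ?_
  rw [add_sub_cancel_right, mul_pow, sq_rpow_half]
  ring

theorem wNorm_profileNeg (e : ℝ) (v : ℤ → ℝ → ℂ) (k : ℤ) :
    wNorm e (profileNeg v k) = wNorm e (profile v k) := by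
  unfold wNorm energy profileNeg
  rw [← lintegral_neg_eq_self]
  simp only [neg_neg, jap_neg]

theorem xNormFourier_eq {q : ℝ} (hq : 1 < q) (v : ℤ → ℝ → ℂ) :
    xNormFourier (1 / 2) (1 / 2) (ENNReal.ofReal q) 2 v =
      lpNorm (Real.conjExponent q) fun k => wNorm (1 / 2) (profile v k) := by
  have hq' : 0 < Real.conjExponent q := div_pos (by linarith) (by linarith)
  unfold xNormFourier
  rw [ennreal_conjExponent_ofReal hq, eLpNorm_count_eq hq']
  congr 1
  funext k
  rw [ennreal_conjExponent_two,
    eLpNorm_eq_lintegral_rpow_enorm_toReal (by norm_num) (by norm_num)]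
  simp only [ENNReal.toReal_ofNat, ENNReal.rpow_ofNat, enorm_weight_mul]
  rw [wNorm, energy_profile, ← lintegral_const_mul' _ _ (jap_ne_top _)]
  congr 1
  refine lintegral_congr fun σ => ?_
  rw [mul_pow, mul_pow, sq_rpow_half, sq_rpow_half, mul_one_div_cancel two_ne_zero,
    ENNReal.rpow_one]
  ring

theorem xNormFourier_top_eq {r : ℝ} (hr : 1 < r) (v : ℤ → ℝ → ℂ) :
    xNormFourier (1 / 2) (-1) (ENNReal.ofReal r) ⊤ v =
      lpNorm (Real.conjExponent r) fun ξ : ℤ =>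
        jap ξ ^ (1 / 2 : ℝ) * ∫⁻ τ, japInv (τ + (ξ : ℝ) ^ 2) * ‖v ξ τ‖ₑ := by
  have hr' : 0 < Real.conjExponent r := div_pos (by linarith) (by linarith)
  unfold xNormFourier
  rw [ennreal_conjExponent_ofReal hr, eLpNorm_count_eq hr']
  congr 1
  funext ξ
  rw [ennreal_conjExponent_top, eLpNorm_one_eq_lintegral_enorm,
    ← lintegral_const_mul' _ _ (jap_rpow_ne_top _ _)]
  refine lintegral_congr fun τ => ?_
  rw [enorm_weight_mul, japInv]
  ring

end norms

/-! ### Fourier coefficients of the admissible functions. -/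

section coefficients
variable {u : ℝ × Torus → ℂ} {T : ℝ}

theorem spaceFourier_conjFun (u : ℝ × Torus → ℂ) (ξ : ℤ) (t : ℝ) :
    spaceFourier (conjFun u) ξ t = starRingEnd ℂ (spaceFourier u (-ξ) t) := by
  unfold spaceFourier conjFun
  rw [map_mul, map_inv₀, Complex.conj_ofReal, ← integral_conj]
  congr 1
  refine integral_congr_ae (Filter.Eventually.of_forall fun x => ?_)
  simp only [map_mul, fourier_neg, neg_neg]

theorem memLp_spaceFourier (hu : MemLp u 2) (k : ℤ) : MemLp (spaceFourier u k) 2 := by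
  have hm : AEStronglyMeasurable (fun z : ℝ × Torus => fourier (-k) z.2 * u z)
      ((volume : Measure ℝ).prod (volume : Measure Torus)) :=
    ((fourier (-k)).continuous.comp continuous_snd).aestronglyMeasurable.mul hu.1
  refine ⟨aestronglyMeasurable_const.mul hm.integral_prod_right', ?_⟩
  have hu2 : ∫⁻ z, ‖u z‖ₑ ^ 2 < ∞ := by
    simpa using (eLpNorm_lt_top_iff_lintegral_rpow_enorm_lt_top (f := u) (by norm_num)
      (by norm_num)).mp hu.2
  rw [eLpNorm_lt_top_iff_lintegral_rpow_enorm_lt_top (by norm_num) (by norm_num)]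
  simp only [ENNReal.toReal_ofNat, ENNReal.rpow_ofNat]
  set c : ℝ≥0∞ := ‖((√(2 * Real.pi) : ℝ) : ℂ)⁻¹‖ₑ
  have hae : ∀ᵐ t : ℝ, AEStronglyMeasurable (fun x : Torus => u (t, x)) volume :=
    hu.1.prodMk_left
  have hpt : ∀ᵐ t : ℝ, ‖spaceFourier u k t‖ₑ ^ 2 ≤
      c ^ 2 * ((volume : Measure Torus) Set.univ * ∫⁻ x : Torus, ‖u (t, x)‖ₑ ^ 2) := by
    filter_upwards [hae] with t ht
    unfold spaceFourier
    rw [enorm_mul, mul_pow]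
    gcongr
    calc _ ≤ (∫⁻ x : Torus, 1 * ‖u (t, x)‖ₑ) ^ 2 := by
          gcongr
          refine (enorm_integral_le_lintegral_enorm _).trans_eq (lintegral_congr fun x => ?_)
          rw [enorm_mul, ← ofReal_norm (fourier (-k) x), fourier_apply, Circle.norm_coe,
            ENNReal.ofReal_one]
      _ ≤ _ := (sq_lintegral_mul_le aemeasurable_const ht.enorm).trans_eq (by simp)
  refine (lintegral_mono_ae hpt).trans_lt ?_
  rw [lintegral_const_mul' _ _ (by finiteness), lintegral_const_mul' _ _ (by finiteness)]
  have hprod : ∫⁻ t : ℝ, ∫⁻ x : Torus, ‖u (t, x)‖ₑ ^ 2 = ∫⁻ z, ‖u z‖ₑ ^ 2 :=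
    (lintegral_prod (fun z => ‖u z‖ₑ ^ 2) (hu.1.enorm.pow_const 2)).symm
  rw [hprod]
  finiteness

theorem spaceFourier_eq_zero (hs : ∀ᵐ z : ℝ × Torus, T < |z.1| → u z = 0) (k : ℤ) :
    ∀ᵐ t : ℝ, T < |t| → spaceFourier u k t = 0 := by
  filter_upwards [Measure.ae_ae_of_ae_prod hs] with t ht hT
  unfold spaceFourier
  rw [integral_eq_zero_of_ae, mul_zero]
  filter_upwards [ht] with x hx
  rw [hx hT, mul_zero, Pi.zero_apply]

theorem integrable_spaceFourier (hu : MemLp u 2)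
    (hs : ∀ᵐ z : ℝ × Torus, T < |z.1| → u z = 0) (k : ℤ) : Integrable (spaceFourier u k) :=
  integrable_of_memLp_of_support (memLp_spaceFourier hu k) (spaceFourier_eq_zero hs k)

theorem measurable_profile (hu : MemLp u 2) (hs : ∀ᵐ z : ℝ × Torus, T < |z.1| → u z = 0)
    (k : ℤ) : Measurable (profile (spaceTimeFourier u) k) := by
  have := measurable_enorm_timeFourier (integrable_spaceFourier hu hs k)
  unfold profile
  exact (this.comp (measurable_id.sub_const _)).const_mul _

theorem measurable_profileNeg (hu : MemLp u 2) (hs : ∀ᵐ z : ℝ × Torus, T < |z.1| → u z = 0)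
    (k : ℤ) : Measurable (profileNeg (spaceTimeFourier u) k) :=
  (measurable_profile hu hs k).comp measurable_neg

theorem wNorm_profile_le (hu : MemLp u 2) (hT : 0 < T)
    (hs : ∀ᵐ z : ℝ × Torus, T < |z.1| → u z = 0) {β : ℝ} (hβ0 : 0 ≤ β) (hβ : β ≤ 1) (k : ℤ) :
    wNorm (β / 2) (profile (spaceTimeFourier u) k) ≤
      (ENNReal.ofReal (4 * T) ^ (1 - β)) ^ (1 / 2 : ℝ) *
        wNorm (1 / 2) (profile (spaceTimeFourier u) k) := by
  unfold wNorm
  rw [← ENNReal.mul_rpow_of_nonneg _ _ (by norm_num), energy_profile, energy_profile]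
  refine ENNReal.rpow_le_rpow ?_ (by norm_num)
  rw [mul_left_comm, mul_one_div_cancel two_ne_zero, mul_div_cancel₀ β two_ne_zero]
  simp only [ENNReal.rpow_one]
  exact mul_le_mul_right (lintegral_jap_rpow_mul_timeFourier_le (memLp_spaceFourier hu k) hT
    (spaceFourier_eq_zero hs k) hβ0 hβ _) _

theorem lpNorm_wNorm_profile_le (hu : MemLp u 2) (hT : 0 < T)
    (hs : ∀ᵐ z : ℝ × Torus, T < |z.1| → u z = 0) {β q : ℝ} (hβ0 : 0 ≤ β) (hβ : β ≤ 1)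
    (hq : 1 < q) :
    lpNorm (Real.conjExponent q) (fun k => wNorm (β / 2) (profile (spaceTimeFourier u) k)) ≤
      (ENNReal.ofReal (4 * T) ^ (1 - β)) ^ (1 / 2 : ℝ) *
        xNorm (1 / 2) (1 / 2) (ENNReal.ofReal q) 2 u := by
  have hq' : 0 < Real.conjExponent q := div_pos (by linarith) (by linarith)
  rw [xNorm, xNormFourier_eq hq, ← lpNorm_const_mul hq']
  exact lpNorm_mono hq' (wNorm_profile_le hu hT hs hβ0 hβ)

theorem lintegral_weighted_lt_top {q : ℝ} (hq : 1 < q)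
    (hX : xNorm (1 / 2) (1 / 2) (ENNReal.ofReal q) 2 u < ∞) (k : ℤ) :
    ∫⁻ σ, jap (σ + (k : ℝ) ^ 2) * ‖timeFourier (spaceFourier u k) σ‖ₑ ^ 2 < ∞ := by
  have hq' : 0 < Real.conjExponent q := div_pos (by linarith) (by linarith)
  rw [xNorm, xNormFourier_eq hq] at hX
  have h1 := (le_lpNorm hq' (fun k => wNorm (1 / 2) (profile (spaceTimeFourier u) k)) k).trans_lt hX
  have h2 : energy (1 / 2) (profile (spaceTimeFourier u) k) < ∞ := by
    by_contra hcon
    rw [not_lt_top_iff] at hcon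
    rw [wNorm, hcon, ENNReal.top_rpow_of_pos (by norm_num)] at h1
    exact lt_irrefl _ h1
  rw [energy_profile, mul_one_div_cancel two_ne_zero] at h2
  simp only [ENNReal.rpow_one] at h2
  exact ENNReal.lt_top_of_mul_ne_top_right h2.ne (jap_ne_zero _)

end coefficients

/-! ### The estimate for sequences of profiles, diagonal included. -/

section sequence
variable {q q' r r' β η : ℝ}

/-- The contribution of the pair of frequency shifts `z` to the trilinear estimate. -/
def resTerm (Q₁ Q₂ Q₃ : ℤ → ℝ → ℝ≥0∞) (ξ : ℤ) (z : ℤ × ℤ) : ℝ≥0∞ :=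
  if z.1 * z.2 = 0 then 0 else ENNReal.ofReal (freqRatio ξ z.1 z.2) ^ (1 / 2 : ℝ) *
    triInt japInv (Q₁ (ξ - z.1)) (Q₂ (ξ - z.2)) (Q₃ (ξ - z.1 - z.2)) (2 * (z.1 * z.2 : ℤ))

theorem japInv_le (hη : 0 ≤ η) (x : ℝ) : japInv x ≤ jap x ^ (-(1 / 2 - η)) :=
  ENNReal.rpow_le_rpow_of_exponent_le (one_le_jap x) (by linarith)

theorem triInt_mono_kernel {Φ Ψ : ℝ → ℝ≥0∞} (h : ∀ x, Φ x ≤ Ψ x) (P Q R : ℝ → ℝ≥0∞) (c : ℝ) :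
    triInt Φ P Q R c ≤ triInt Ψ P Q R c := by
  unfold triInt biInt
  gcongr
  exact h _

/-- The off-diagonal part follows by duality from the tested estimate. The diagonal part couples a
single frequency: the first two inputs are taken in supremum, bounded by their `ℓ^{q'}` norms, and
the third carries the `ℓ^{r'}` sum. -/
theorem exists_lpNorm_resTerm_le (hq : 4 / 3 < q) (hqr : q ≤ r) (hr2 : r ≤ 2)
    (hqq : 1 / q + 1 / q' = 1) (hrr : 1 / r + 1 / r' = 1)
    (hβ : β ≤ 1) (hη : 0 ≤ η) (hη2 : η ≤ 1 / 2) (h : 2 * η < 2 * β - 1)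
    (hηq : 1 / q < 1 / 2 + η) :
    ∃ C : ℝ≥0∞, C ≠ ∞ ∧ ∀ Q₁ Q₂ Q₃ : ℤ → ℝ → ℝ≥0∞,
      (∀ k, Measurable (Q₁ k)) → (∀ k, Measurable (Q₂ k)) → (∀ k, Measurable (Q₃ k)) →
      lpNorm r' (fun ξ => ∑' z, resTerm Q₁ Q₂ Q₃ ξ z + triInt japInv (Q₁ ξ) (Q₂ ξ) (Q₃ ξ) 0) ≤
      C * (normProd q' r' (1 / 2) (β / 2) (β / 2) Q₁ Q₂ Q₃ +
        normProd q' r' (β / 2) (1 / 2) (β / 2) Q₁ Q₂ Q₃ +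
        normProd q' r' (β / 2) (β / 2) (1 / 2) Q₁ Q₂ Q₃) := by
  have hr0 : 0 < r := by linarith
  have hq0 : 0 < q := by linarith
  have hr1 : 1 / r < 1 := by rw [div_lt_one hr0]; linarith
  have hq1 : 1 / q < 1 := by rw [div_lt_one hq0]; linarith
  have hr'0 : 0 < r' := one_div_pos.mp (by linarith)
  have hq'0 : 0 < q' := one_div_pos.mp (by linarith)
  have hr'1 : 1 ≤ r' := (one_div_le_one_div hr'0 one_pos).mp (by
    have := one_div_pos.mpr hr0
    linarith)
  obtain ⟨C, hC, H⟩ := exists_trilinear_le hq hqr hr2 hqq hrr hβ hη hη2 h hηq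
  obtain ⟨D, hD, K⟩ := exists_triInt_le_wNorm hβ hη h
  refine ⟨C + D, by finiteness, fun Q₁ Q₂ Q₃ h₁ h₂ h₃ => ?_⟩
  set N := normProd q' r' (1 / 2) (β / 2) (β / 2) Q₁ Q₂ Q₃ +
    normProd q' r' (β / 2) (1 / 2) (β / 2) Q₁ Q₂ Q₃ +
    normProd q' r' (β / 2) (β / 2) (1 / 2) Q₁ Q₂ Q₃ with hN
  refine (lpNorm_add_le hr'1 _ _).trans ?_
  rw [add_mul]
  refine add_le_add ?_ ?_
  · refine lpNorm_le_of_forall_tsum_mul_le hr0 hr'0 hrr fun g => ?_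
    refine (le_of_eq ?_).trans ((H g Q₁ Q₂ Q₃ h₁ h₂ h₃).trans_eq (by ring))
    refine tsum_congr fun ξ => ?_
    rw [← ENNReal.tsum_mul_left]
    refine tsum_congr fun z => ?_
    unfold resTerm
    split_ifs
    · rw [mul_zero]
    · ring
  · calc _ ≤ lpNorm r' (fun ξ => D * (lpNorm q' (fun k => wNorm (1 / 2) (Q₁ k)) *
          lpNorm q' (fun k => wNorm (β / 2) (Q₂ k))) * wNorm (β / 2) (Q₃ ξ)) := by
          refine lpNorm_mono hr'0 fun ξ => ?_
          refine (triInt_mono_kernel (japInv_le hη) _ _ _ _).trans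
            ((K _ _ _ (h₁ ξ) (h₂ ξ) (h₃ ξ) 0).trans ?_)
          rw [mul_assoc D]
          gcongr
          · exact le_lpNorm hq'0 (fun k => wNorm (1 / 2) (Q₁ k)) ξ
          · exact le_lpNorm hq'0 (fun k => wNorm (β / 2) (Q₂ k)) ξ
      _ = D * normProd q' r' (1 / 2) (β / 2) (β / 2) Q₁ Q₂ Q₃ := by
          rw [lpNorm_const_mul hr'0, mul_assoc, normProd]
      _ ≤ _ := mul_le_mul_right (le_add_right le_self_add) D

end sequence

/-! ### From the trilinear operator to profiles. -/

section terms
variable {u₁ u₂ u₃ : ℝ × Torus → ℂ} {q r T : ℝ}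

/-- The hypotheses on each of the functions in the trilinear estimate. -/
structure Admissible (q T : ℝ) (u : ℝ × Torus → ℂ) : Prop where
  memLp : MemLp u 2
  xNorm_lt_top : xNorm (1 / 2) (1 / 2) (ENNReal.ofReal q) 2 u < ∞
  support : ∀ᵐ z : ℝ × Torus, T < |z.1| → u z = 0

/-- A product of three Fourier coefficients. -/
def tripleProduct (u₁ u₂ u₃ : ℝ × Torus → ℂ) (k l m : ℤ) (t : ℝ) : ℂ :=
  spaceFourier u₁ k t * spaceFourier u₂ l t * starRingEnd ℂ (spaceFourier u₃ m t)

theorem integrable_tripleProduct (hq : 1 < q) (h₁ : Admissible q T u₁) (h₂ : Admissible q T u₂)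
    (h₃ : Admissible r T u₃) (k l m : ℤ) : Integrable (tripleProduct u₁ u₂ u₃ k l m) :=
  integrable_mul_mul_of_weighted (integrable_spaceFourier h₁.memLp h₁.support k)
    (memLp_spaceFourier h₁.memLp k) (integrable_spaceFourier h₂.memLp h₂.support l)
    (memLp_spaceFourier h₂.memLp l) (memLp_spaceFourier h₃.memLp m).star
    (lintegral_weighted_lt_top hq h₁.xNorm_lt_top k)
    (lintegral_weighted_lt_top hq h₂.xNorm_lt_top l)

theorem triInt_const_mul (Φ P Q R : ℝ → ℝ≥0∞) {x y z : ℝ≥0∞} (hx : x ≠ ∞) (hy : y ≠ ∞)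
    (hz : z ≠ ∞) (c : ℝ) :
    triInt Φ (fun s => x * P s) (fun s => y * Q s) (fun s => z * R s) c =
      x * y * z * triInt Φ P Q R c := by
  unfold triInt biInt
  simp_rw [mul_assoc, lintegral_const_mul' z _ hz, mul_left_comm _ z,
    lintegral_const_mul' z _ hz, lintegral_const_mul' y _ hy, mul_left_comm _ z,
    lintegral_const_mul' z _ hz, mul_left_comm _ y, lintegral_const_mul' y _ hy,
    lintegral_const_mul' x _ hx]
  ring

/-- The product rule for transforms becomes a trilinear integral in the modulations. Conjugation
reflects the third transform and so reverses the sign of its parabola, whence `profileNeg`. -/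
theorem lintegral_japInv_mul_tripleProduct_le (hq : 1 < q) (h₁ : Admissible q T u₁)
    (h₂ : Admissible q T u₂) (h₃ : Admissible r T u₃) (ξ a b : ℤ) :
    jap (ξ - a : ℤ) ^ (1 / 2 : ℝ) * jap (ξ - b : ℤ) ^ (1 / 2 : ℝ) *
        jap (ξ - a - b : ℤ) ^ (1 / 2 : ℝ) * ∫⁻ τ, japInv (τ + (ξ : ℝ) ^ 2) *
      ‖timeFourier (tripleProduct u₁ u₂ u₃ (ξ - a) (ξ - b) (ξ - a - b)) τ‖ₑ ≤
    triInt japInv (profile (spaceTimeFourier u₁) (ξ - a)) (profile (spaceTimeFourier u₂) (ξ - b))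
      (profileNeg (spaceTimeFourier u₃) (ξ - a - b)) (2 * (a * b : ℤ)) := by
  have hi₃ := integrable_spaceFourier h₃.memLp h₃.support (ξ - a - b)
  have key := lintegral_mul_enorm_timeFourier_le (Φ := fun τ => japInv (τ + (ξ : ℝ) ^ 2))
    (by fun_prop) (integrable_spaceFourier h₁.memLp h₁.support (ξ - a))
    (memLp_spaceFourier h₁.memLp _) (integrable_spaceFourier h₂.memLp h₂.support (ξ - b))
    (memLp_spaceFourier h₂.memLp _)
    (h := fun t => starRingEnd ℂ (spaceFourier u₃ (ξ - a - b) t))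
    (by simpa using (Complex.conjCLE.toContinuousLinearMap.integrable_comp hi₃))
    (memLp_spaceFourier h₃.memLp _).star
    (lintegral_weighted_lt_top hq h₁.xNorm_lt_top _)
    (lintegral_weighted_lt_top hq h₂.xNorm_lt_top _)
  rw [triInt_translate japInv] at key
  refine (mul_le_mul_right key _).trans_eq ?_
  unfold profileNeg profile
  rw [triInt_const_mul _ _ _ _ (jap_rpow_ne_top _ _) (jap_rpow_ne_top _ _) (jap_rpow_ne_top _ _)]
  congr 1
  have hshift := triInt_shift japInv (fun σ => ‖timeFourier (spaceFourier u₁ (ξ - a)) σ‖ₑ)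
    (fun σ => ‖timeFourier (spaceFourier u₂ (ξ - b)) σ‖ₑ)
    (fun σ => ‖timeFourier (fun t => starRingEnd ℂ (spaceFourier u₃ (ξ - a - b) t)) σ‖ₑ)
    (((ξ - a : ℤ) : ℝ) ^ 2) (((ξ - b : ℤ) : ℝ) ^ 2) (-((ξ - a - b : ℤ) : ℝ) ^ 2)
    (2 * (a * b : ℤ))
  -- The resonance identity `2ab + (ξ-a)² + (ξ-b)² - (ξ-a-b)² = ξ²`.
  rw [show (2 * (a * b : ℤ) : ℝ) + ((ξ - a : ℤ) : ℝ) ^ 2 + ((ξ - b : ℤ) : ℝ) ^ 2 +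
    (-((ξ - a - b : ℤ) : ℝ) ^ 2) = 0 + (ξ : ℝ) ^ 2 by push_cast; ring] at hshift
  rw [← hshift]
  congr 1
  funext σ
  rw [timeFourier_conj, RCLike.enorm_conj]
  unfold spaceTimeFourier
  congr 2
  ring

/-- The derivative is bounded by `⟨ξ-a-b⟩`; half of its power is absorbed by the norm of `u₃`, and
what remains is exactly `freqRatio ^ (1/2)`. -/
theorem jap_mul_enorm_le (ξ a b : ℤ) :
    jap ξ ^ (1 / 2 : ℝ) * ENNReal.ofReal |((ξ - a - b : ℤ) : ℝ)| ≤
      ENNReal.ofReal (freqRatio ξ a b) ^ (1 / 2 : ℝ) * (jap (ξ - a : ℤ) ^ (1 / 2 : ℝ) *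
        jap (ξ - b : ℤ) ^ (1 / 2 : ℝ) * jap (ξ - a - b : ℤ) ^ (1 / 2 : ℝ)) := by
  have h1 := bracket_pos ((ξ : ℝ) - a)
  have h2 := bracket_pos ((ξ : ℝ) - b)
  have h3 := bracket_pos ((ξ : ℝ) - a - b)
  have h0 := bracket_pos (ξ : ℝ)
  calc _ ≤ jap ξ ^ (1 / 2 : ℝ) * jap (ξ - a - b : ℤ) := by
        gcongr
        exact ENNReal.ofReal_le_ofReal (abs_le_bracket _)
    _ = (jap ξ * jap (ξ - a - b : ℤ) ^ 2) ^ (1 / 2 : ℝ) := by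
        rw [ENNReal.mul_rpow_of_nonneg _ _ (by norm_num), rpow_half_sq]
    _ = (ENNReal.ofReal (freqRatio ξ a b) *
        (jap (ξ - a : ℤ) * jap (ξ - b : ℤ) * jap (ξ - a - b : ℤ))) ^ (1 / 2 : ℝ) := by
        congr 1
        unfold jap freqRatio
        push_cast
        rw [← ENNReal.ofReal_pow h3.le, ← ENNReal.ofReal_mul h0.le, ← ENNReal.ofReal_mul h1.le,
          ← ENNReal.ofReal_mul (by positivity), ← ENNReal.ofReal_mul (by positivity)]
        congr 1
        field_simp
    _ = _ := by
        rw [ENNReal.mul_rpow_of_nonneg _ _ (by norm_num),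
          ENNReal.mul_rpow_of_nonneg _ _ (by norm_num), ENNReal.mul_rpow_of_nonneg _ _ (by norm_num)]

theorem timeFourier_const_mul (c : ℂ) (f : ℝ → ℂ) (τ : ℝ) :
    timeFourier (fun t => c * f t) τ = c * timeFourier f τ := by
  unfold timeFourier
  simp_rw [mul_left_comm _ c]
  rw [integral_const_mul]
  ring

theorem triTerm_eq (u₁ u₂ u₃ : ℝ × Torus → ℂ) (ξ : ℤ) (p : FreqPairs ξ) :
    triTerm u₁ u₂ u₃ ξ p = fun t => (Complex.I * ((ξ - p.1.1 - p.1.2 : ℤ) : ℂ)) *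
      tripleProduct u₁ u₂ u₃ p.1.1 p.1.2 (-(ξ - p.1.1 - p.1.2)) t := by
  funext t
  unfold triTerm tripleProduct
  rw [spaceFourier_conjFun]
  ring

theorem triDiag_eq (u₁ u₂ u₃ : ℝ × Torus → ℂ) (ξ : ℤ) :
    triDiag u₁ u₂ u₃ ξ = fun t => (Complex.I * (ξ : ℂ)) * tripleProduct u₁ u₂ u₃ ξ ξ ξ t := by
  funext t
  unfold triDiag tripleProduct
  rw [spaceFourier_conjFun, neg_neg]
  ring

theorem enorm_I_mul_intCast (n : ℤ) : ‖Complex.I * (n : ℂ)‖ₑ = ENNReal.ofReal |(n : ℝ)| := by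
  rw [← ofReal_norm, norm_mul, Complex.norm_I, one_mul, Complex.norm_intCast]

/-- The multiplier `n` enters only through its modulus. This covers both the off-diagonal terms,
where `n = -(ξ-a-b)`, and the diagonal one, where `a = b = 0` and `n = ξ`. -/
theorem lintegral_const_mul_tripleProduct_le (hq : 1 < q) (h₁ : Admissible q T u₁)
    (h₂ : Admissible q T u₂) (h₃ : Admissible r T u₃) (ξ a b n : ℤ)
    (hn : |(n : ℝ)| = |((ξ - a - b : ℤ) : ℝ)|) :
    jap ξ ^ (1 / 2 : ℝ) * ∫⁻ τ, japInv (τ + (ξ : ℝ) ^ 2) * ‖timeFourier (fun t =>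
      (Complex.I * (n : ℂ)) * tripleProduct u₁ u₂ u₃ (ξ - a) (ξ - b) (ξ - a - b) t) τ‖ₑ ≤
    ENNReal.ofReal (freqRatio ξ a b) ^ (1 / 2 : ℝ) *
      triInt japInv (profile (spaceTimeFourier u₁) (ξ - a)) (profile (spaceTimeFourier u₂) (ξ - b))
        (profileNeg (spaceTimeFourier u₃) (ξ - a - b)) (2 * (a * b : ℤ)) := by
  simp_rw [timeFourier_const_mul, enorm_mul _ (timeFourier _ _), enorm_I_mul_intCast, hn,
    mul_left_comm (japInv _)]
  rw [lintegral_const_mul' _ _ ENNReal.ofReal_ne_top, ← mul_assoc]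
  refine (mul_le_mul_left (jap_mul_enorm_le ξ a b) _).trans ?_
  rw [mul_assoc]
  exact mul_le_mul_right (lintegral_japInv_mul_tripleProduct_le hq h₁ h₂ h₃ ξ a b) _

theorem integrable_triTerm (hq : 1 < q) (h₁ : Admissible q T u₁) (h₂ : Admissible q T u₂)
    (h₃ : Admissible r T u₃) (ξ : ℤ) (p : FreqPairs ξ) : Integrable (triTerm u₁ u₂ u₃ ξ p) := by
  rw [triTerm_eq]
  exact (integrable_tripleProduct hq h₁ h₂ h₃ _ _ _).const_mul _

theorem integrable_triDiag (hq : 1 < q) (h₁ : Admissible q T u₁) (h₂ : Admissible q T u₂)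
    (h₃ : Admissible r T u₃) (ξ : ℤ) : Integrable (triDiag u₁ u₂ u₃ ξ) := by
  rw [triDiag_eq]
  exact (integrable_tripleProduct hq h₁ h₂ h₃ _ _ _).const_mul _

/-- With `a = ξ - ξ₁` and `b = ξ - ξ₂`, the conditions `ξ₁ ≠ ξ`, `ξ₂ ≠ ξ` say exactly that `ab ≠ 0`.
-/
theorem lintegral_triTerm_le (hq : 1 < q) (h₁ : Admissible q T u₁) (h₂ : Admissible q T u₂)
    (h₃ : Admissible r T u₃) (ξ : ℤ) (p : FreqPairs ξ) :
    jap ξ ^ (1 / 2 : ℝ) * ∫⁻ τ, japInv (τ + (ξ : ℝ) ^ 2) *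
      ‖timeFourier (triTerm u₁ u₂ u₃ ξ p) τ‖ₑ ≤
    resTerm (profile (spaceTimeFourier u₁)) (profile (spaceTimeFourier u₂))
      (profileNeg (spaceTimeFourier u₃)) ξ (ξ - p.1.1, ξ - p.1.2) := by
  have hz : ¬ (ξ - p.1.1) * (ξ - p.1.2) = 0 :=
    mul_ne_zero (sub_ne_zero.mpr p.2.1.symm) (sub_ne_zero.mpr p.2.2.symm)
  have e : ξ - (ξ - p.1.1) - (ξ - p.1.2) = -(ξ - p.1.1 - p.1.2) := by ring
  have key := lintegral_const_mul_tripleProduct_le hq h₁ h₂ h₃ ξ (ξ - p.1.1) (ξ - p.1.2)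
    (ξ - p.1.1 - p.1.2) (by rw [e]; push_cast; rw [abs_neg])
  rw [resTerm, if_neg hz, triTerm_eq]
  simp only [e] at key ⊢
  simp only [sub_sub_cancel] at key ⊢
  exact key

theorem lintegral_triDiag_le (hq : 1 < q) (h₁ : Admissible q T u₁) (h₂ : Admissible q T u₂)
    (h₃ : Admissible r T u₃) (ξ : ℤ) :
    jap ξ ^ (1 / 2 : ℝ) * ∫⁻ τ, japInv (τ + (ξ : ℝ) ^ 2) *
      ‖timeFourier (triDiag u₁ u₂ u₃ ξ) τ‖ₑ ≤
    triInt japInv (profile (spaceTimeFourier u₁) ξ) (profile (spaceTimeFourier u₂) ξ)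
      (profileNeg (spaceTimeFourier u₃) ξ) 0 := by
  have key := lintegral_const_mul_tripleProduct_le hq h₁ h₂ h₃ ξ 0 0 ξ (by simp)
  have hf : freqRatio ξ 0 0 = 1 := by
    unfold freqRatio
    simp only [Int.cast_zero, sub_zero]
    exact div_self (mul_pos (bracket_pos _) (bracket_pos _)).ne'
  rw [hf] at key
  rw [triDiag_eq]
  simpa using key

theorem tsum_lintegral_triTerm_le (hq : 1 < q) (h₁ : Admissible q T u₁) (h₂ : Admissible q T u₂)
    (h₃ : Admissible r T u₃) (ξ : ℤ) :
    jap ξ ^ (1 / 2 : ℝ) * ∑' p, ∫⁻ τ, japInv (τ + (ξ : ℝ) ^ 2) *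
      ‖timeFourier (triTerm u₁ u₂ u₃ ξ p) τ‖ₑ ≤
    ∑' z, resTerm (profile (spaceTimeFourier u₁)) (profile (spaceTimeFourier u₂))
      (profileNeg (spaceTimeFourier u₃)) ξ z := by
  rw [← ENNReal.tsum_mul_left]
  refine (ENNReal.tsum_le_tsum fun p => lintegral_triTerm_le hq h₁ h₂ h₃ ξ p).trans ?_
  refine ENNReal.tsum_comp_le_tsum_of_injective (f := fun p : FreqPairs ξ =>
    (ξ - p.1.1, ξ - p.1.2)) ?_ _
  rintro ⟨⟨a, b⟩, _⟩ ⟨⟨c, d⟩, _⟩ h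
  simp only [Prod.mk.injEq, sub_right_inj] at h
  simp [h.1, h.2]

theorem measurable_japInv_mul_timeFourier {f : ℝ → ℂ} (hf : Integrable f) (m : ℝ) :
    Measurable fun τ => japInv (τ + m) * ‖timeFourier f τ‖ₑ :=
  Measurable.mul (by fun_prop) (measurable_enorm_timeFourier hf)

theorem enorm_triFourier_le (u₁ u₂ u₃ : ℝ × Torus → ℂ) (ξ : ℤ) (τ : ℝ) :
    ‖triFourier u₁ u₂ u₃ ξ τ‖ₑ ≤ ∑' p, ‖timeFourier (triTerm u₁ u₂ u₃ ξ p) τ‖ₑ +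
      ‖timeFourier (triDiag u₁ u₂ u₃ ξ) τ‖ₑ := by
  have hc : ‖(2 * (Real.pi : ℂ))⁻¹‖ₑ ≤ 1 := by
    rw [← ofReal_norm, ← ENNReal.ofReal_one]
    refine ENNReal.ofReal_le_ofReal ?_
    rw [norm_inv, norm_mul, Complex.norm_real, Real.norm_of_nonneg Real.pi_pos.le,
      Complex.norm_ofNat]
    exact inv_le_one_of_one_le₀ (by linarith [Real.pi_gt_three])
  unfold triFourier
  refine (enorm_add_le _ _).trans (add_le_add ?_ ?_)
  · rw [enorm_mul]
    exact (mul_le_of_le_one_left' hc).trans enorm_tsum_le_tsum_enorm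
  · rw [enorm_mul]
    exact mul_le_of_le_one_left' hc

theorem lintegral_triFourier_le (hq : 1 < q) (h₁ : Admissible q T u₁) (h₂ : Admissible q T u₂)
    (h₃ : Admissible r T u₃) (ξ : ℤ) :
    jap ξ ^ (1 / 2 : ℝ) * ∫⁻ τ, japInv (τ + (ξ : ℝ) ^ 2) * ‖triFourier u₁ u₂ u₃ ξ τ‖ₑ ≤
    ∑' z, resTerm (profile (spaceTimeFourier u₁)) (profile (spaceTimeFourier u₂))
      (profileNeg (spaceTimeFourier u₃)) ξ z +
    triInt japInv (profile (spaceTimeFourier u₁) ξ) (profile (spaceTimeFourier u₂) ξ)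
      (profileNeg (spaceTimeFourier u₃) ξ) 0 := by
  have hm := fun p => measurable_japInv_mul_timeFourier (integrable_triTerm hq h₁ h₂ h₃ ξ p)
    ((ξ : ℝ) ^ 2)
  calc _ ≤ jap ξ ^ (1 / 2 : ℝ) * ∫⁻ τ, (∑' p, japInv (τ + (ξ : ℝ) ^ 2) *
        ‖timeFourier (triTerm u₁ u₂ u₃ ξ p) τ‖ₑ + japInv (τ + (ξ : ℝ) ^ 2) *
        ‖timeFourier (triDiag u₁ u₂ u₃ ξ) τ‖ₑ) := by
        gcongr with τ
        rw [ENNReal.tsum_mul_left, ← mul_add]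
        gcongr
        exact enorm_triFourier_le u₁ u₂ u₃ ξ τ
    _ ≤ _ := by
        rw [lintegral_add_left (Measurable.tsum hm), lintegral_tsum fun p => (hm p).aemeasurable,
          mul_add]
        exact add_le_add (tsum_lintegral_triTerm_le hq h₁ h₂ h₃ ξ)
          (lintegral_triDiag_le hq h₁ h₂ h₃ ξ)

/-- The sum of the moduli has finite integral against a positive weight, so it is finite almost
everywhere. -/
theorem ae_summable_timeFourier_triTerm (hq : 1 < q) (h₁ : Admissible q T u₁)
    (h₂ : Admissible q T u₂) (h₃ : Admissible r T u₃) (ξ : ℤ)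
    (hfin : ∑' z, resTerm (profile (spaceTimeFourier u₁)) (profile (spaceTimeFourier u₂))
      (profileNeg (spaceTimeFourier u₃)) ξ z < ∞) :
    ∀ᵐ τ : ℝ, Summable fun p : FreqPairs ξ => timeFourier (triTerm u₁ u₂ u₃ ξ p) τ := by
  have hm := fun p => measurable_japInv_mul_timeFourier (integrable_triTerm hq h₁ h₂ h₃ ξ p)
    ((ξ : ℝ) ^ 2)
  have h := (tsum_lintegral_triTerm_le hq h₁ h₂ h₃ ξ).trans_lt hfin
  have h' := ENNReal.lt_top_of_mul_ne_top_right h.ne (jap_rpow_ne_zero _ _)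
  rw [← lintegral_tsum fun p => (hm p).aemeasurable] at h'
  filter_upwards [ae_lt_top (Measurable.tsum hm) h'.ne] with τ hτ
  rw [ENNReal.tsum_mul_left] at hτ
  have := ENNReal.lt_top_of_mul_ne_top_right hτ.ne (jap_rpow_ne_zero _ _)
  refine Summable.of_norm ?_
  simpa using ENNReal.summable_toReal this.ne

/-- Every summand has exactly two inputs measured with exponent `β/2`; each yields `(4T)^{(1-β)/2}`.
-/
theorem normProd_profile_le (hq : 1 < q) (hr : 1 < r) (hT : 0 < T) (h₁ : Admissible q T u₁)
    (h₂ : Admissible q T u₂) (h₃ : Admissible r T u₃) {β : ℝ} (hβ0 : 0 ≤ β) (hβ : β ≤ 1) :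
    normProd (Real.conjExponent q) (Real.conjExponent r) (1 / 2) (β / 2) (β / 2)
        (profile (spaceTimeFourier u₁)) (profile (spaceTimeFourier u₂))
        (profileNeg (spaceTimeFourier u₃)) +
      normProd (Real.conjExponent q) (Real.conjExponent r) (β / 2) (1 / 2) (β / 2)
        (profile (spaceTimeFourier u₁)) (profile (spaceTimeFourier u₂))
        (profileNeg (spaceTimeFourier u₃)) +
      normProd (Real.conjExponent q) (Real.conjExponent r) (β / 2) (β / 2) (1 / 2)
        (profile (spaceTimeFourier u₁)) (profile (spaceTimeFourier u₂))
        (profileNeg (spaceTimeFourier u₃)) ≤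
    3 * ENNReal.ofReal (4 * T) ^ (1 - β) * (xNorm (1 / 2) (1 / 2) (ENNReal.ofReal q) 2 u₁ *
      xNorm (1 / 2) (1 / 2) (ENNReal.ofReal q) 2 u₂ *
      xNorm (1 / 2) (1 / 2) (ENNReal.ofReal r) 2 u₃) := by
  have e₁ := lpNorm_wNorm_profile_le h₁.memLp hT h₁.support hβ0 hβ hq
  have e₂ := lpNorm_wNorm_profile_le h₂.memLp hT h₂.support hβ0 hβ hq
  have e₃ := lpNorm_wNorm_profile_le h₃.memLp hT h₃.support hβ0 hβ hr
  have f₁ : lpNorm (Real.conjExponent q) (fun k => wNorm (1 / 2) (profile (spaceTimeFourier u₁) k))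
    = xNorm (1 / 2) (1 / 2) (ENNReal.ofReal q) 2 u₁ := (xNormFourier_eq hq _).symm
  have f₂ : lpNorm (Real.conjExponent q) (fun k => wNorm (1 / 2) (profile (spaceTimeFourier u₂) k))
    = xNorm (1 / 2) (1 / 2) (ENNReal.ofReal q) 2 u₂ := (xNormFourier_eq hq _).symm
  have f₃ : lpNorm (Real.conjExponent r) (fun k => wNorm (1 / 2) (profile (spaceTimeFourier u₃) k))
    = xNorm (1 / 2) (1 / 2) (ENNReal.ofReal r) 2 u₃ := (xNormFourier_eq hr _).symm
  unfold normProd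
  simp_rw [wNorm_profileNeg, f₁, f₂, f₃]
  set X₁ := xNorm (1 / 2) (1 / 2) (ENNReal.ofReal q) 2 u₁
  set X₂ := xNorm (1 / 2) (1 / 2) (ENNReal.ofReal q) 2 u₂
  set X₃ := xNorm (1 / 2) (1 / 2) (ENNReal.ofReal r) 2 u₃
  set D := ENNReal.ofReal (4 * T) ^ (1 - β)
  calc _ ≤ X₁ * (D ^ (1 / 2 : ℝ) * X₂) * (D ^ (1 / 2 : ℝ) * X₃) +
        (D ^ (1 / 2 : ℝ) * X₁) * X₂ * (D ^ (1 / 2 : ℝ) * X₃) +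
        (D ^ (1 / 2 : ℝ) * X₁) * (D ^ (1 / 2 : ℝ) * X₂) * X₃ := by gcongr
    _ = 3 * (D ^ (1 / 2 : ℝ)) ^ 2 * (X₁ * X₂ * X₃) := by ring
    _ = _ := by rw [sq_rpow_half]

end terms

/-! ### Choice of parameters and conclusion. -/

section main
variable {q r δ : ℝ}

theorem one_div_add_one_div_conjExponent {p : ℝ} (hp : 1 < p) :
    1 / p + 1 / Real.conjExponent p = 1 := by
  have h0 : p ≠ 0 := by linarith
  have h1 : p - 1 ≠ 0 := by linarith
  unfold Real.conjExponent
  field_simp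
  ring

/-- The trilinear estimate with an extended nonnegative constant. -/
theorem exists_triFourier_le (hq : 4 / 3 < q) (hqr : q ≤ r) (hr : r ≤ 2) (hδ0 : 0 ≤ δ)
    (hδ : δ < 1 / Real.conjExponent q) :
    ∃ C : ℝ≥0∞, C ≠ ∞ ∧ ∀ T : ℝ, 0 < T → ∀ u₁ u₂ u₃ : ℝ × Torus → ℂ,
      Admissible q T u₁ → Admissible q T u₂ → Admissible r T u₃ →
      lpNorm (Real.conjExponent r) (fun ξ =>
        ∑' z, resTerm (profile (spaceTimeFourier u₁)) (profile (spaceTimeFourier u₂))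
          (profileNeg (spaceTimeFourier u₃)) ξ z +
        triInt japInv (profile (spaceTimeFourier u₁) ξ) (profile (spaceTimeFourier u₂) ξ)
          (profileNeg (spaceTimeFourier u₃) ξ) 0) ≤
      C * ENNReal.ofReal (T ^ δ) * (xNorm (1 / 2) (1 / 2) (ENNReal.ofReal q) 2 u₁ *
        xNorm (1 / 2) (1 / 2) (ENNReal.ofReal q) 2 u₂ *
        xNorm (1 / 2) (1 / 2) (ENNReal.ofReal r) 2 u₃) := by
  have hq1 : 1 < q := by linarith
  have hr1 : 1 < r := by linarith
  have hqq := one_div_add_one_div_conjExponent hq1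
  have hq2 : 1 / 2 ≤ 1 / q := one_div_le_one_div_of_le (by linarith) (by linarith)
  -- With `β = 1 - δ` the condition `2η < 2β - 1` reads `η < 1/2 - δ`. Together with `η > 1/q - 1/2`
  -- this leaves room exactly when `δ < 1 - 1/q = 1/q'`.
  obtain ⟨η, hη1, hη2⟩ : ∃ η, 1 / q - 1 / 2 < η ∧ η < 1 / 2 - δ := exists_between (by linarith)
  obtain ⟨C, hC, H⟩ := exists_lpNorm_resTerm_le (β := 1 - δ) (η := η) hq hqr hr hqq
    (one_div_add_one_div_conjExponent hr1) (by linarith) (by linarith) (by linarith) (by linarith)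
    (by linarith)
  -- `12 = 3 · 4`: three summands, and `4^δ ≤ 4`.
  refine ⟨C * 12, by finiteness, fun T hT u₁ u₂ u₃ h₁ h₂ h₃ => ?_⟩
  refine (H _ _ _ (measurable_profile h₁.memLp h₁.support)
    (measurable_profile h₂.memLp h₂.support)
    (measurable_profileNeg h₃.memLp h₃.support)).trans ?_
  refine (mul_le_mul_right (normProd_profile_le hq1 hr1 hT h₁ h₂ h₃ (by linarith)
    (by linarith)) C).trans ?_
  rw [sub_sub_cancel, ← mul_assoc]
  refine mul_le_mul_left ?_ _
  have h4 : ENNReal.ofReal (4 * T) ^ δ ≤ 4 * ENNReal.ofReal (T ^ δ) := by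
    rw [ENNReal.ofReal_mul (by norm_num), ENNReal.mul_rpow_of_nonneg _ _ hδ0,
      ENNReal.ofReal_rpow_of_pos hT, ENNReal.ofReal_ofNat]
    gcongr
    simpa using ENNReal.rpow_le_rpow_of_exponent_le (by norm_num : (1 : ℝ≥0∞) ≤ 4)
      (by linarith : δ ≤ 1)
  calc _ ≤ C * (3 * (4 * ENNReal.ofReal (T ^ δ))) := by gcongr
    _ = _ := by ring

end main

end PeriodicDNLS

end

theorem mainTheorem4 (q r δ : ℝ) (hq : 4 / 3 < q) (hqr : q ≤ r) (hr : r ≤ 2)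
    (hδ0 : 0 ≤ δ) (hδ : δ < 1 / Real.conjExponent q) :
    ∃ C : ℝ, 0 < C ∧
      ∀ T : ℝ, 0 < T → T ≤ 1 →
      ∀ u₁ u₂ u₃ : ℝ × PeriodicDNLS.Torus → ℂ,
        MeasureTheory.MemLp u₁ 2 MeasureTheory.volume →
        MeasureTheory.MemLp u₂ 2 MeasureTheory.volume →
        MeasureTheory.MemLp u₃ 2 MeasureTheory.volume →
        PeriodicDNLS.xNorm (1 / 2) (1 / 2) (ENNReal.ofReal q) 2 u₁ < ⊤ →
        PeriodicDNLS.xNorm (1 / 2) (1 / 2) (ENNReal.ofReal q) 2 u₂ < ⊤ →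
        PeriodicDNLS.xNorm (1 / 2) (1 / 2) (ENNReal.ofReal r) 2 u₃ < ⊤ →
        (∀ᵐ z : ℝ × PeriodicDNLS.Torus, T < |z.1| → u₁ z = 0) →
        (∀ᵐ z : ℝ × PeriodicDNLS.Torus, T < |z.1| → u₂ z = 0) →
        (∀ᵐ z : ℝ × PeriodicDNLS.Torus, T < |z.1| → u₃ z = 0) →
        (∀ ξ : ℤ,
          (∀ p : PeriodicDNLS.FreqPairs ξ,
            MeasureTheory.Integrable (PeriodicDNLS.triTerm u₁ u₂ u₃ ξ p)) ∧
          MeasureTheory.Integrable (PeriodicDNLS.triDiag u₁ u₂ u₃ ξ) ∧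
          ∀ᵐ τ : ℝ, Summable fun p : PeriodicDNLS.FreqPairs ξ =>
            PeriodicDNLS.timeFourier (PeriodicDNLS.triTerm u₁ u₂ u₃ ξ p) τ) ∧
        PeriodicDNLS.xNormFourier (1 / 2) (-1) (ENNReal.ofReal r) ⊤
            (PeriodicDNLS.triFourier u₁ u₂ u₃) ≤
          ENNReal.ofReal (C * T ^ δ) *
            PeriodicDNLS.xNorm (1 / 2) (1 / 2) (ENNReal.ofReal q) 2 u₁ *
            PeriodicDNLS.xNorm (1 / 2) (1 / 2) (ENNReal.ofReal q) 2 u₂ *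
            PeriodicDNLS.xNorm (1 / 2) (1 / 2) (ENNReal.ofReal r) 2 u₃ := by
  have hq1 : 1 < q := by linarith
  have hr1 : 1 < r := by linarith
  have hr' : 0 < Real.conjExponent r := div_pos (by linarith) (by linarith)
  obtain ⟨C, hC, H⟩ := PeriodicDNLS.exists_triFourier_le hq hqr hr hδ0 hδ
  -- Adding `1` makes the real constant strictly positive.
  refine ⟨C.toReal + 1, by positivity, fun T hT _ u₁ u₂ u₃ m₁ m₂ m₃ x₁ x₂ x₃ s₁ s₂ s₃ => ?_⟩
  have h₁ : PeriodicDNLS.Admissible q T u₁ := ⟨m₁, x₁, s₁⟩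
  have h₂ : PeriodicDNLS.Admissible q T u₂ := ⟨m₂, x₂, s₂⟩
  have h₃ : PeriodicDNLS.Admissible r T u₃ := ⟨m₃, x₃, s₃⟩
  have key := H T hT u₁ u₂ u₃ h₁ h₂ h₃
  have hfin := key.trans_lt (ENNReal.mul_lt_top (ENNReal.mul_lt_top hC.lt_top
    ENNReal.ofReal_lt_top) (ENNReal.mul_lt_top (ENNReal.mul_lt_top x₁ x₂) x₃))
  refine ⟨fun ξ => ⟨PeriodicDNLS.integrable_triTerm hq1 h₁ h₂ h₃ ξ,
    PeriodicDNLS.integrable_triDiag hq1 h₁ h₂ h₃ ξ,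
    PeriodicDNLS.ae_summable_timeFourier_triTerm hq1 h₁ h₂ h₃ ξ ?_⟩, ?_⟩
  -- Convergence of the series comes from the same bound: a finite `ℓ^{r'}` norm forces each entry
  -- to be finite.
  · refine lt_of_le_of_lt ?_ hfin
    exact le_self_add.trans (PeriodicDNLS.le_lpNorm hr' (fun ξ => _ + _) ξ)
  · rw [PeriodicDNLS.xNormFourier_top_eq hr1]
    refine (PeriodicDNLS.lpNorm_mono hr'
      (PeriodicDNLS.lintegral_triFourier_le hq1 h₁ h₂ h₃)).trans (key.trans ?_)
    rw [ENNReal.ofReal_mul (by positivity), mul_assoc (_ * ENNReal.ofReal (T ^ δ)),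
      mul_assoc (_ * ENNReal.ofReal (T ^ δ))]
    refine mul_le_mul_left (mul_le_mul_left ?_ _) _
    rw [ENNReal.ofReal_add ENNReal.toReal_nonneg zero_le_one, ENNReal.ofReal_toReal hC]
    exact le_self_add
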